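/- Let $\mathcal O\subset\mathbb R^2$ be a bounded domain with boundary of class $C^2$ and outward unit normal $\mathbf n$. Let $T>0$, $\nu>0$, $\mathcal O_T=(0,T)\times\mathcal O$, $\Gamma_T=(0,T)\times\partial\mathcal O$, and let $\overline\sigma\in C^2([0,T]\times\overline{\mathcal O})$ satisfy $\inf\overline\sigma>0$. Let $\tilde\omega_T\subset\widehat{\omega_T}$ be two relatively open subsets of $[0,T]\times\mathcal O$ such that $\tilde\omega_T\subset K\subset\widehat{\omega_T}$ for some compact set $K\subset[0,T]\times\mathcal O$. Let $\tilde\psi\in C^2([0,T]\times\overline{\mathcal O})$ take values in $[0,1]$ and satisfy: $\partial_{\mathbf n}\tilde\psi\le 0$ on $\Gamma_T$; for all $t\in[0,T]$, $\tilde\psi(t,\cdot)$ is constant on $\partial\mathcal O$ and this constant equals $\inf_{\mathcal O}\tilde\psi(t,\cdot)$; and, for some $\alpha>0$, $|\nabla\tilde\psi|\ge\alpha$ on $\mathcal O_T\setminus\tilde\omega_T$. (Here $\nabla$ and $\Delta$ act on the space variable $x$.) Let $T_0>0$ and $0<T_1\le 1/4$ with $T_0+2T_1<T$, and let $m\ge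 1$ be real. For each real $\mu>2$ let $\theta_{m,\mu}\in C^2([0,T))$ be such that $\theta_{m,\mu}(t)=1+(1-t/T_0)^\mu$ on $[0,T_0]$, $\theta_{m,\mu}=1$ on $[T_0,T-2T_1]$, $\theta_{m,\mu}$ is nondecreasing on $[T-2T_1,T-T_1]$, and $\theta_{m,\mu}(t)=(T-t)^{-m}$ on $[T-T_1,T)$; assume that the first and second derivatives of $\theta_{m,\mu}$ on $[T-2T_1,T-T_1]$ are bounded independently of $\mu$ (for instance, that $\theta_{m,\mu}$ does not depend on $\mu$ there). For $s\ge1$, $\lambda\ge1$ put $\mu=s\lambda^2e^{\lambda(6m-4)}$, $\theta=\theta_{m,\mu}$, $\psi=\tilde\psi+6m$ and $$\varphi(t,x)=\theta(t)\left(\lambda e^{6\lambda(m+1)}-e^{\lambda\psi(t,x)}\right),\qquad \xi(t,x)=\theta(t)e^{\lambda\psi(t,x)} .$$ Then there exist constants $C_0>0$, $s_0\ge1$ and $\lambda_0\ge1$ such that for all real-valued $z\in C^\infty([0,T]\times\overline{\mathcal O})$ with $z=0$ on $\Gamma_T$, all $s\ge s_0$ and all $\lambda\ge\lambda_0$, $$\int_{\mathcal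 O}|\nabla z(0)|^2e^{-2s\varphi(0)}+s^2\lambda^3e^{2\lambda(6m+1)}\int_{\mathcal O}|z(0)|^2e^{-2s\varphi(0)}+s\lambda^2\iint_{\mathcal O_T}\xi|\nabla z|^2e^{-2s\varphi}+s^3\lambda^4\iint_{\mathcal O_T}\xi^3|z|^2e^{-2s\varphi}$$ $$\le C_0\iint_{\mathcal O_T}|(-\overline\sigma\partial_t-\nu\Delta)z|^2e^{-2s\varphi}+C_0s^3\lambda^4\iint_{\widehat{\omega_T}}\xi^3|z|^2e^{-2s\varphi}.$$ -/

import Mathlib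

open Set MeasureTheory
open scoped ContDiff

noncomputable section

namespace CarlemanHeat

/-- The Euclidean plane. -/
abbrev Plane := EuclideanSpace ℝ (Fin 2)

/-- `O` is a bounded domain of the plane with boundary of class `C²`, described by a
defining function `ρ`: `O = {ρ < 0}`, with `ρ` of class `C²` and `∇ρ ≠ 0` on `∂O`.
A bounded domain has a boundary of class `C²` if and only if such a `ρ` exists. -/
structure IsBoundedC2Domain (O : Set Plane) (ρ : Plane → ℝ) : Prop where
  connected : IsConnected O
  bounded : Bornology.IsBounded O
  contDiff : ContDiff ℝ 2 ρ
  eq_sublevel : O = {x | ρ x < 0}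
  gradient_ne_zero : ∀ x ∈ frontier O, gradient ρ x ≠ 0

/-- The outward unit normal at a boundary point, computed from a defining function. -/
def outwardNormal (ρ : Plane → ℝ) (x : Plane) : Plane :=
  ‖gradient ρ x‖⁻¹ • gradient ρ x

/-- The open space-time cylinder `(0,T) × O`. -/
def cylinder (T : ℝ) (O : Set Plane) : Set (ℝ × Plane) := Ioo 0 T ×ˢ O

/-- The closed space-time cylinder `[0,T] × closure O`. -/
def closedCylinder (T : ℝ) (O : Set Plane) : Set (ℝ × Plane) := Icc 0 T ×ˢ closure O

/-- `A` is a relatively open subset of `[0,T] × O`. -/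
def IsRelOpen (T : ℝ) (O : Set Plane) (A : Set (ℝ × Plane)) : Prop :=
  ∃ U : Set (ℝ × Plane), IsOpen U ∧ A = U ∩ (Icc 0 T ×ˢ O)

/-- `A ⋐ B`: some compact subset `K` of `[0,T] × O` satisfies `A ⊆ K ⊆ B`. -/
def CompactlyInside (T : ℝ) (O : Set Plane) (A B : Set (ℝ × Plane)) : Prop :=
  ∃ K : Set (ℝ × Plane), IsCompact K ∧ K ⊆ Icc 0 T ×ˢ O ∧ A ⊆ K ∧ K ⊆ B

/-- Time derivative `∂ₜ z`. -/
def timeDeriv (z : ℝ × Plane → ℝ) (p : ℝ × Plane) : ℝ :=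
  deriv (fun t => z (t, p.2)) p.1

/-- Spatial gradient `∇ z`. -/
def spaceGrad (z : ℝ × Plane → ℝ) (p : ℝ × Plane) : Plane :=
  gradient (fun x => z (p.1, x)) p.2

/-- Spatial Laplacian `Δ z`. -/
def spaceLaplacian (z : ℝ × Plane → ℝ) (p : ℝ × Plane) : ℝ :=
  Laplacian.laplacian (fun x => z (p.1, x)) p.2

/-- The operator `-σ ∂ₜ z - ν Δ z`. -/
def heatOp (σ : ℝ × Plane → ℝ) (ν : ℝ) (z : ℝ × Plane → ℝ) (p : ℝ × Plane) : ℝ :=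
  -σ p * timeDeriv z p - ν * spaceLaplacian z p

/-- The requirements on the space-time weight `ψ₀` (before the shift by `6m`): it is of class
`C²` up to the boundary with values in `[0,1]`, its normal derivative is nonpositive on
`(0,T) × ∂O`, for each `t` it is constant on `∂O` with value the infimum over `O`, and its
spatial gradient is bounded from below outside of `ω₀`. -/
structure IsSpaceWeight (T : ℝ) (O : Set Plane) (ρ : Plane → ℝ) (ω₀ : Set (ℝ × Plane))
    (ψ₀ : ℝ × Plane → ℝ) : Prop where
  contDiffOn : ContDiffOn ℝ 2 ψ₀ (closedCylinder T O)
  mem_Icc : ∀ p ∈ closedCylinder T O, ψ₀ p ∈ Icc (0 : ℝ) 1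
  normal_deriv_nonpos : ∀ t ∈ Ioo 0 T, ∀ x ∈ frontier O,
    fderivWithin ℝ (fun y => ψ₀ (t, y)) (closure O) x (outwardNormal ρ x) ≤ 0
  boundary_const_inf : ∀ t ∈ Icc 0 T, ∃ c : ℝ,
    (∀ x ∈ frontier O, ψ₀ (t, x) = c) ∧ IsGLB ((fun x => ψ₀ (t, x)) '' O) c
  gradient_lower : ∃ α : ℝ, 0 < α ∧ ∀ p ∈ cylinder T O \ ω₀, α ≤ ‖spaceGrad ψ₀ p‖

/-- The requirements on the weight in time `θ = θ_{m,μ}` on `[0,T)`. -/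
structure IsTimeWeight (T T₀ T₁ m μ : ℝ) (θ : ℝ → ℝ) : Prop where
  eq_initial : ∀ t ∈ Icc 0 T₀, θ t = 1 + (1 - t / T₀) ^ μ
  eq_one : ∀ t ∈ Icc T₀ (T - 2 * T₁), θ t = 1
  eq_final : ∀ t ∈ Ico (T - T₁) T, θ t = 1 / (T - t) ^ m
  monotoneOn : MonotoneOn θ (Icc (T - 2 * T₁) (T - T₁))
  contDiffOn : ContDiffOn ℝ 2 θ (Ico 0 T)

/-- A family `μ ↦ θ_{m,μ}` of weights in time, `μ > 2`, whose derivatives of order one and two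
on the transition interval `[T - 2T₁, T - T₁]` are bounded independently of `μ` (as for a
transition that does not depend on `μ`). -/
structure IsTimeWeightFamily (T T₀ T₁ m : ℝ) (θ : ℝ → ℝ → ℝ) : Prop where
  isTimeWeight : ∀ μ : ℝ, 2 < μ → IsTimeWeight T T₀ T₁ m μ (θ μ)
  transition_bound : ∃ K : ℝ, ∀ μ : ℝ, 2 < μ → ∀ t ∈ Icc (T - 2 * T₁) (T - T₁),
    |deriv (θ μ) t| ≤ K ∧ |iteratedDeriv 2 (θ μ) t| ≤ K

/-- The parameter `μ = s λ² e^{λ(6m-4)}`. -/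
def muParam (m s lam : ℝ) : ℝ := s * lam ^ 2 * Real.exp (lam * (6 * m - 4))

/-- `ψ = ψ₀ + 6m`. -/
def psi (m : ℝ) (ψ₀ : ℝ × Plane → ℝ) (p : ℝ × Plane) : ℝ := ψ₀ p + 6 * m

/-- `φ = θ (λ e^{6λ(m+1)} - e^{λψ})` with `θ = θ_{m,μ}`, `μ = s λ² e^{λ(6m-4)}`. -/
def phi (θ : ℝ → ℝ → ℝ) (ψ₀ : ℝ × Plane → ℝ) (m s lam : ℝ) (p : ℝ × Plane) : ℝ :=
  θ (muParam m s lam) p.1 *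
    (lam * Real.exp (6 * lam * (m + 1)) - Real.exp (lam * psi m ψ₀ p))

/-- `ξ = θ e^{λψ}` with `θ = θ_{m,μ}`, `μ = s λ² e^{λ(6m-4)}`. -/
def xi (θ : ℝ → ℝ → ℝ) (ψ₀ : ℝ × Plane → ℝ) (m s lam : ℝ) (p : ℝ × Plane) : ℝ :=
  θ (muParam m s lam) p.1 * Real.exp (lam * psi m ψ₀ p)

end CarlemanHeat

end

/-!
The inequality is obtained by conjugating the operator with `e^{-sφ}`. For `w = e^{-sφ} z`, which
vanishes on the lateral boundary, `e^{-sφ} (-σ ∂ₜ - ν Δ) z` is the sum of a formally self-adjoint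
part `A w`, a part `B w` that is skew-adjoint to leading order, and a term of lower order
(`exp_mul_heat_eq`). The square of the sum controls the product `A w · B w` and the square of `B w`.

The product equals a space-time divergence plus a quadratic form in `w`, `∂ₜw` and `∇w`
(`symmPart_mul_skewPart_eq`). Up to terms of lower order in `s` and `λ`, the form dominates
`s λ² ξ |∇w|² + s³ λ⁴ ξ³ w²` where `∇ψ` is not small; elsewhere only the term with `w²` has to be
compensated, which is the observation (`remainderForm_ge`, `pointwise_carleman`). To keep the
gradient term positive also where `∇ψ` is small, the zero-order coefficient of `B` is taken to be
`2|∇ψ|² + ε` in place of `|∇ψ|²`; hence no cutoff function is needed, and the observation set can be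
`ω₀` itself. The derivative of `θ` is bounded from above independently of `μ`, while its negative
part, which is of the size of `μ`, produces a term of the good sign.

After integration over `(0,T') × O`, the flux through the lateral boundary has a sign because
`∂ₙψ ≤ 0` (`fluxOf_boundary_nonneg`, `integral_spacetime_div_ge`). At the time `0` the weight `θ`
decreases at the rate `μ / T₀`, and since `μ` times `λ e^{6λ(m+1)}` is `s λ³ e^{2λ(6m+1)}` this
yields the two terms with `z(0)` (`energyOf_zero_le`). As `T' → T`, `θ → ∞` and the energy at `T'` is at
most of the order of `θ² e^{-2sφ}`, which tends to zero (`tendsto_integral_energyOf`).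

The analysis up to the boundary uses derivatives within `[0,T) × closure O`. The divergence theorem
for the domain is proved in the one-sided form that is needed, with cutoff functions of the defining
function `ρ` (`integral_div_nonneg`).
-/

namespace CarlemanHeat

open Filter Topology

/-! ### One-sided divergence theorem in the plane -/

/-- The `i`-th vector of the standard basis of the plane. -/
noncomputable abbrev ex (i : Fin 2) : Plane := EuclideanSpace.single i 1

theorem IsBoundedC2Domain.isOpen {O : Set Plane} {ρ : Plane → ℝ} (hO : IsBoundedC2Domain O ρ) :
    IsOpen O := by
  rw [hO.eq_sublevel]
  exact isOpen_lt hO.contDiff.continuous continuous_const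

theorem IsBoundedC2Domain.isCompact_closure {O : Set Plane} {ρ : Plane → ℝ}
    (hO : IsBoundedC2Domain O ρ) : IsCompact (closure O) :=
  hO.bounded.isCompact_closure

theorem IsBoundedC2Domain.nonpos_of_mem_closure {O : Set Plane} {ρ : Plane → ℝ}
    (hO : IsBoundedC2Domain O ρ) {x : Plane} (hx : x ∈ closure O) : ρ x ≤ 0 := by
  have : closure O ⊆ {x | ρ x ≤ 0} := by
    refine closure_minimal ?_ (isClosed_le hO.contDiff.continuous continuous_const)
    intro y hy
    rw [hO.eq_sublevel] at hy
    exact le_of_lt (show ρ y < 0 from hy)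
  exact this hx

theorem IsBoundedC2Domain.eq_zero_of_mem_frontier {O : Set Plane} {ρ : Plane → ℝ}
    (hO : IsBoundedC2Domain O ρ) {x : Plane} (hx : x ∈ frontier O) : ρ x = 0 := by
  refine le_antisymm (hO.nonpos_of_mem_closure hx.1) ?_
  have h := hx.2
  rw [hO.isOpen.interior_eq, hO.eq_sublevel] at h
  simpa using h

theorem IsBoundedC2Domain.mem_of_mem_closure_of_neg {O : Set Plane} {ρ : Plane → ℝ}
    (hO : IsBoundedC2Domain O ρ) {x : Plane} (h : ρ x < 0) : x ∈ O := by
  rw [hO.eq_sublevel]; exact h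

theorem IsBoundedC2Domain.exists_neg_bound {O : Set Plane} {ρ : Plane → ℝ}
    (hO : IsBoundedC2Domain O ρ) {K : Set Plane} (hK : IsCompact K) (hKO : K ⊆ O) :
    ∃ c : ℝ, 0 < c ∧ ∀ x ∈ K, ρ x < -c := by
  rcases K.eq_empty_or_nonempty with rfl | hne
  · exact ⟨1, one_pos, by simp⟩
  · obtain ⟨x, hx, hmax⟩ := hK.exists_isMaxOn hne hO.contDiff.continuous.continuousOn
    have hxO : ρ x < 0 := by
      have := hKO hx
      rwa [hO.eq_sublevel] at this
    refine ⟨-ρ x / 2, by linarith, fun y hy => ?_⟩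
    have : ρ y ≤ ρ x := hmax hy
    linarith

theorem integral_eq_zero_of_hasLineDerivAt {g g' : Plane → ℝ} {v : Plane}
    (hg : Integrable g) (hg' : Integrable g') (h : ∀ x, HasLineDerivAt ℝ g (g' x) x v) :
    ∫ x, g' x = 0 := by
  have := integral_bilinear_hasLineDerivAt_right_eq_neg_left_of_integrable
    (μ := (volume : Measure Plane)) (f := fun _ => (1 : ℝ)) (f' := fun _ => (0 : ℝ))
    (g := g) (g' := g') (v := v)
    (B := ContinuousLinearMap.mul ℝ ℝ) (by simp) (by simpa using hg') (by simpa using hg)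
    (fun x _ => by simpa [HasLineDerivAt] using hasDerivAt_const (0 : ℝ) (1 : ℝ))
    (fun x _ => h x)
  simpa using this

/-- On an open set, a directional derivative of a function that vanishes off a compact subset has
integral zero. -/
theorem setIntegral_eq_zero_of_hasLineDerivAt {O K : Set Plane} (hO : IsOpen O)
    (hK : IsCompact K) (hKO : K ⊆ O) {f f' : Plane → ℝ} {v : Plane}
    (hf : ContinuousOn f O) (hf' : ContinuousOn f' O)
    (hd : ∀ x ∈ O, HasLineDerivAt ℝ f (f' x) x v) (hz : ∀ x ∈ O \ K, f x = 0) :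
    ∫ x in O, f' x = 0 := by
  have hKm : MeasurableSet K := hK.measurableSet
  have hopen : IsOpen (O \ K) := hO.sdiff hK.isClosed
  have hz' : ∀ x ∈ O \ K, f' x = 0 := by
    intro x hx
    have h1 := hd x hx.1
    have h2 : HasLineDerivAt ℝ f 0 x v := by
      refine HasDerivAt.congr_of_eventuallyEq (hasDerivAt_const (0 : ℝ) (0 : ℝ)) ?_
      have hc : ContinuousAt (fun t : ℝ => x + t • v) 0 := by fun_prop
      have : ∀ᶠ t : ℝ in 𝓝 0, x + t • v ∈ O \ K :=
        hc.preimage_mem_nhds (by simpa using hopen.mem_nhds hx)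
      filter_upwards [this] with t ht using hz _ ht
    exact HasLineDerivAt.unique h1 h2
  have e1 : O.indicator f = K.indicator f := by
    ext x
    by_cases hx : x ∈ K
    · simp [hx, hKO hx]
    · by_cases hxO : x ∈ O
      · simp [hx, hxO, hz x ⟨hxO, hx⟩]
      · simp [hx, hxO]
  have e2 : O.indicator f' = K.indicator f' := by
    ext x
    by_cases hx : x ∈ K
    · simp [hx, hKO hx]
    · by_cases hxO : x ∈ O
      · simp [hx, hxO, hz' x ⟨hxO, hx⟩]
      · simp [hx, hxO]
  rw [← integral_indicator hO.measurableSet]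
  refine integral_eq_zero_of_hasLineDerivAt (g := O.indicator f) (v := v) ?_ ?_ ?_
  · rw [e1, integrable_indicator_iff hKm]
    exact (hf.mono hKO).integrableOn_compact hK
  · rw [e2, integrable_indicator_iff hKm]
    exact (hf'.mono hKO).integrableOn_compact hK
  · intro x
    have hc : ContinuousAt (fun t : ℝ => x + t • v) 0 := by fun_prop
    by_cases hxO : x ∈ O
    · rw [indicator_of_mem hxO]
      refine HasDerivAt.congr_of_eventuallyEq (hd x hxO) ?_
      have : ∀ᶠ t : ℝ in 𝓝 0, x + t • v ∈ O :=
        hc.preimage_mem_nhds (by simpa using hO.mem_nhds hxO)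
      filter_upwards [this] with t ht using indicator_of_mem ht f
    · have hxK : x ∉ K := fun h => hxO (hKO h)
      rw [indicator_of_notMem hxO, e1]
      refine HasDerivAt.congr_of_eventuallyEq (hasDerivAt_const (0 : ℝ) (0 : ℝ)) ?_
      have : ∀ᶠ t : ℝ in 𝓝 0, x + t • v ∈ Kᶜ :=
        hc.preimage_mem_nhds (by simpa using hK.isClosed.isOpen_compl.mem_nhds hxK)
      filter_upwards [this] with t ht using indicator_of_notMem ht f

theorem deriv_smoothTransition_nonneg (r : ℝ) : 0 ≤ deriv Real.smoothTransition r :=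
  Real.smoothTransition.monotone.deriv_nonneg

theorem deriv_smoothTransition_of_one_lt {r : ℝ} (hr : 1 < r) :
    deriv Real.smoothTransition r = 0 := by
  have : Real.smoothTransition =ᶠ[𝓝 r] fun _ => 1 := by
    filter_upwards [Ioi_mem_nhds hr] with y hy
    exact Real.smoothTransition.one_of_one_le (le_of_lt hy)
  rw [this.deriv_eq]; simp

/-- The inner product of the vector field with components `F i` with the gradient of `ρ`. -/
noncomputable def dotGrad (ρ : Plane → ℝ) (F : Fin 2 → Plane → ℝ) (x : Plane) : ℝ :=
  ∑ i, F i x * fderiv ℝ ρ x (ex i)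

/-- Integration by parts against a cutoff that is a function of `ρ`: it vanishes for `ρ ≥ -ε` and
equals `1` for `ρ ≤ -2ε`. Its gradient is a nonpositive multiple of `∇ρ`, supported where the field
points outward. -/
theorem integral_cutoff_mul_div_nonneg {O : Set Plane} {ρ : Plane → ℝ}
    (hO : IsBoundedC2Domain O ρ) {F F' : Fin 2 → Plane → ℝ}
    (hF : ∀ i, ContinuousOn (F i) (closure O)) (hF' : ∀ i, ContinuousOn (F' i) (closure O))
    (hd : ∀ i, ∀ x ∈ O, HasLineDerivAt ℝ (F i) (F' i x) x (ex i)) {ε : ℝ} (hε : 0 < ε)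
    (hb : ∀ x ∈ O, -2 * ε ≤ ρ x → 0 ≤ dotGrad ρ F x) :
    0 ≤ ∫ x in O, Real.smoothTransition ((-ρ x - ε) / ε) * ∑ i, F' i x := by
  set τ := Real.smoothTransition
  have hρc : Continuous ρ := hO.contDiff.continuous
  have hρd : Differentiable ℝ ρ := hO.contDiff.differentiable (by norm_num)
  have hρ' : Continuous (fderiv ℝ ρ) := hO.contDiff.continuous_fderiv (by norm_num)
  have hτ1 : ContDiff ℝ 1 τ := Real.smoothTransition.contDiff (n := 1)
  have hτc : Continuous τ := hτ1.continuous
  have hτ'c : Continuous (deriv τ) := hτ1.continuous_deriv le_rfl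
  set K : Set Plane := closure O ∩ {x | ρ x ≤ -ε} with hKdef
  have hK : IsCompact K := hO.isCompact_closure.inter_right
    (isClosed_le hρc continuous_const)
  have hKO : K ⊆ O := fun x hx => hO.mem_of_mem_closure_of_neg (by
    have := hx.2; simp at this; linarith)
  set χ' : Fin 2 → Plane → ℝ := fun i x =>
    deriv τ ((-ρ x - ε) / ε) * (-fderiv ℝ ρ x (ex i) / ε) with hχ'
  have hχ'c : ∀ i, Continuous (χ' i) := by
    intro i
    have : Continuous fun x => fderiv ℝ ρ x (ex i) := hρ'.clm_apply continuous_const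
    simp only [hχ']
    exact (hτ'c.comp (by fun_prop)).mul (by fun_prop)
  have hχc : Continuous fun x => τ ((-ρ x - ε) / ε) := hτc.comp (by fun_prop)
  have key : ∀ i, ∫ x in O, (χ' i x * F i x + τ ((-ρ x - ε) / ε) * F' i x) = 0 := by
    intro i
    refine setIntegral_eq_zero_of_hasLineDerivAt (f := fun x => τ ((-ρ x - ε) / ε) * F i x)
      (v := ex i) hO.isOpen hK hKO ?_ ?_ ?_ ?_
    · exact hχc.continuousOn.mul ((hF i).mono subset_closure)
    · exact ((hχ'c i).continuousOn.mul ((hF i).mono subset_closure)).add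
        (hχc.continuousOn.mul ((hF' i).mono subset_closure))
    · intro x hx
      have h1 : HasDerivAt (fun t : ℝ => ρ (x + t • ex i)) (fderiv ℝ ρ x (ex i)) 0 :=
        (hρd x).hasFDerivAt.hasLineDerivAt (ex i)
      have h2 : HasDerivAt (fun t : ℝ => (-ρ (x + t • ex i) - ε) / ε)
          (-fderiv ℝ ρ x (ex i) / ε) 0 := (h1.neg.sub_const ε).div_const ε
      have h3 : HasDerivAt τ (deriv τ ((-ρ (x + (0 : ℝ) • ex i) - ε) / ε))
          ((-ρ (x + (0 : ℝ) • ex i) - ε) / ε) :=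
        (hτ1.differentiable (by norm_num) _).hasDerivAt
      have h4 := (h3.comp (0 : ℝ) h2).mul (hd i x hx)
      simpa [HasLineDerivAt, hχ', Function.comp_def, Pi.mul_def] using h4
    · intro x hx
      have : -ε < ρ x := by
        by_contra h
        exact hx.2 ⟨subset_closure hx.1, by simpa using h⟩
      have h0 : τ ((-ρ x - ε) / ε) = 0 := by
        apply Real.smoothTransition.zero_of_nonpos
        apply div_nonpos_of_nonpos_of_nonneg _ hε.le
        linarith
      simp [h0]
  have hint : ∀ g : Plane → ℝ, ContinuousOn g (closure O) → IntegrableOn g O := fun g hg =>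
    (hg.integrableOn_compact hO.isCompact_closure).mono_set subset_closure
  have i1 : ∀ i, IntegrableOn (fun x => χ' i x * F i x) O := fun i =>
    hint _ ((hχ'c i).continuousOn.mul (hF i))
  have i2 : ∀ i, IntegrableOn (fun x => τ ((-ρ x - ε) / ε) * F' i x) O := fun i =>
    hint _ (hχc.continuousOn.mul (hF' i))
  have key2 : ∀ i, ∫ x in O, τ ((-ρ x - ε) / ε) * F' i x = -∫ x in O, χ' i x * F i x := by
    intro i
    have := key i
    rw [integral_add (i1 i) (i2 i)] at this
    linarith
  simp_rw [Finset.mul_sum]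
  rw [integral_finsetSum _ (fun i _ => i2 i)]
  simp_rw [key2]
  rw [Finset.sum_neg_distrib, ← integral_finsetSum _ (fun i _ => i1 i), ← integral_neg]
  refine setIntegral_nonneg hO.isOpen.measurableSet fun x hx => ?_
  have e : -∑ i, χ' i x * F i x = deriv τ ((-ρ x - ε) / ε) / ε * dotGrad ρ F x := by
    simp only [hχ', dotGrad, Finset.mul_sum, ← Finset.sum_neg_distrib]
    refine Finset.sum_congr rfl fun i _ => ?_
    ring
  rw [e]
  by_cases hr : -2 * ε ≤ ρ x
  · exact mul_nonneg (div_nonneg (deriv_smoothTransition_nonneg _) hε.le) (hb x hx hr)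
  · rw [deriv_smoothTransition_of_one_lt]
    · simp
    · rw [lt_div_iff₀ hε]; push Not at hr; linarith

/-- The case of a field that points strictly outward along the boundary, hence also near it. -/
theorem integral_div_nonneg_of_dotGrad_pos {O : Set Plane} {ρ : Plane → ℝ}
    (hO : IsBoundedC2Domain O ρ) {F F' : Fin 2 → Plane → ℝ}
    (hF : ∀ i, ContinuousOn (F i) (closure O)) (hF' : ∀ i, ContinuousOn (F' i) (closure O))
    (hd : ∀ i, ∀ x ∈ O, HasLineDerivAt ℝ (F i) (F' i x) x (ex i))
    (hb : ∀ x ∈ frontier O, 0 < dotGrad ρ F x) :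
    0 ≤ ∫ x in O, ∑ i, F' i x := by
  have hρc : Continuous ρ := hO.contDiff.continuous
  have hρ' : Continuous (fderiv ℝ ρ) := hO.contDiff.continuous_fderiv (by norm_num)
  have hdot : ContinuousOn (dotGrad ρ F) (closure O) := by
    unfold dotGrad
    exact continuousOn_finsetSum _ fun i _ =>
      (hF i).mul (hρ'.clm_apply continuous_const).continuousOn
  -- the set where the flux is nonpositive is a compact subset of the open set `O`
  set K : Set Plane := {x ∈ closure O | dotGrad ρ F x ≤ 0} with hKdef
  have hK : IsCompact K := by
    have : IsClosed K := by
      have := hdot.preimage_isClosed_of_isClosed isClosed_closure (isClosed_Iic (a := (0 : ℝ)))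
      exact this
    exact hO.isCompact_closure.of_isClosed_subset this (fun x hx => hx.1)
  have hKO : K ⊆ O := by
    intro x hx
    by_contra hxO
    have : x ∈ frontier O := ⟨hx.1, by rwa [hO.isOpen.interior_eq]⟩
    exact absurd (hb x this) (not_lt.mpr hx.2)
  obtain ⟨c, hc, hcK⟩ := hO.exists_neg_bound hK hKO
  have hpos : ∀ x ∈ O, -c ≤ ρ x → 0 ≤ dotGrad ρ F x := by
    intro x hx h
    by_contra hneg
    have := hcK x ⟨subset_closure hx, (not_le.mp hneg).le⟩
    linarith
  set ε : ℕ → ℝ := fun n => c / 2 / (n + 1) with hεdef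
  have hεpos : ∀ n, 0 < ε n := fun n => by positivity
  have hεle : ∀ n, 2 * ε n ≤ c := by
    intro n
    have : c / 2 / ((n : ℝ) + 1) ≤ c / 2 :=
      div_le_self (by positivity) (by linarith [n.cast_nonneg (α := ℝ)])
    simp only [hεdef]; linarith
  have hε0 : Tendsto ε atTop (𝓝 0) := by
    have := (tendsto_one_div_add_atTop_nhds_zero_nat (𝕜 := ℝ)).const_mul (c / 2)
    simpa [hεdef, div_eq_mul_inv] using this
  have hnn : ∀ n, 0 ≤ ∫ x in O, Real.smoothTransition ((-ρ x - ε n) / ε n) * ∑ i, F' i x := by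
    intro n
    exact integral_cutoff_mul_div_nonneg hO hF hF' hd (hεpos n)
      (fun x hx h => hpos x hx (by linarith [hεle n]))
  have hsum : ContinuousOn (fun x => ∑ i, F' i x) (closure O) :=
    continuousOn_finsetSum _ fun i _ => hF' i
  have hsumi : IntegrableOn (fun x => ∑ i, F' i x) O :=
    (hsum.integrableOn_compact hO.isCompact_closure).mono_set subset_closure
  have hlim : Tendsto (fun n => ∫ x in O, Real.smoothTransition ((-ρ x - ε n) / ε n) * ∑ i, F' i x)
      atTop (𝓝 (∫ x in O, ∑ i, F' i x)) := by
    refine tendsto_integral_of_dominated_convergence (fun x => ‖∑ i, F' i x‖) ?_ hsumi.norm ?_ ?_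
    · intro n
      refine (ContinuousOn.mul ?_ (hsum.mono subset_closure)).aestronglyMeasurable
        hO.isOpen.measurableSet
      exact (Real.smoothTransition.continuous.comp (by fun_prop)).continuousOn
    · intro n
      refine Eventually.of_forall fun x => ?_
      rw [norm_mul]
      refine mul_le_of_le_one_left (norm_nonneg _) ?_
      rw [Real.norm_of_nonneg (Real.smoothTransition.nonneg _)]
      exact Real.smoothTransition.le_one _
    · refine (ae_restrict_iff' hO.isOpen.measurableSet).mpr (Eventually.of_forall fun x hx => ?_)
      have hρx : ρ x < 0 := by rwa [hO.eq_sublevel] at hx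
      refine tendsto_const_nhds.congr' ?_
      have : ∀ᶠ n in atTop, ε n < -ρ x / 2 := hε0.eventually_lt_const (by linarith)
      filter_upwards [this] with n hn
      rw [Real.smoothTransition.one_of_one_le, one_mul]
      rw [le_div_iff₀ (hεpos n)]; linarith
  exact ge_of_tendsto' hlim hnn

theorem IsBoundedC2Domain.sum_fderiv_sq_pos {O : Set Plane} {ρ : Plane → ℝ}
    (hO : IsBoundedC2Domain O ρ) {x : Plane} (hx : x ∈ frontier O) :
    0 < ∑ i, fderiv ℝ ρ x (ex i) * fderiv ℝ ρ x (ex i) := by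
  refine lt_of_le_of_ne (Finset.sum_nonneg fun i _ => mul_self_nonneg _) fun h => ?_
  have h0 : ∀ i, fderiv ℝ ρ x (ex i) = 0 := by
    have := (Finset.sum_eq_zero_iff_of_nonneg (fun i _ => mul_self_nonneg _)).mp h.symm
    exact fun i => mul_self_eq_zero.mp (this i (Finset.mem_univ i))
  refine hO.gradient_ne_zero x hx ?_
  have : fderiv ℝ ρ x = 0 := by
    refine ContinuousLinearMap.coe_injective ?_
    refine (EuclideanSpace.basisFun (Fin 2) ℝ).toBasis.ext fun i => ?_
    simpa using h0 i
  simp [gradient, this]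

/-- One-sided divergence theorem: a vector field that points outward along the boundary has a
divergence with nonnegative integral. The strict case is applied to `F + δ ∇ρ`. -/
theorem integral_div_nonneg {O : Set Plane} {ρ : Plane → ℝ}
    (hO : IsBoundedC2Domain O ρ) {F F' : Fin 2 → Plane → ℝ}
    (hF : ∀ i, ContinuousOn (F i) (closure O)) (hF' : ∀ i, ContinuousOn (F' i) (closure O))
    (hd : ∀ i, ∀ x ∈ O, HasLineDerivAt ℝ (F i) (F' i x) x (ex i))
    (hb : ∀ x ∈ frontier O, 0 ≤ dotGrad ρ F x) :
    0 ≤ ∫ x in O, ∑ i, F' i x := by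
  have hg1 : ∀ i, ContDiff ℝ 1 (fun x => fderiv ℝ ρ x (ex i)) := fun i =>
    (hO.contDiff.fderiv_right (m := 1) (by norm_num)).clm_apply contDiff_const
  set g : Fin 2 → Plane → ℝ := fun i x => fderiv ℝ ρ x (ex i) with hg
  set g' : Fin 2 → Plane → ℝ := fun i x => fderiv ℝ (g i) x (ex i) with hg'
  have hg'c : ∀ i, Continuous (g' i) := fun i =>
    ((hg1 i).continuous_fderiv (by norm_num)).clm_apply continuous_const
  have hint : ∀ u : Plane → ℝ, ContinuousOn u (closure O) → IntegrableOn u O := fun u hu =>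
    (hu.integrableOn_compact hO.isCompact_closure).mono_set subset_closure
  have hstep : ∀ δ : ℝ, 0 < δ →
      0 ≤ (∫ x in O, ∑ i, F' i x) + δ * ∫ x in O, ∑ i, g' i x := by
    intro δ hδ
    have h := integral_div_nonneg_of_dotGrad_pos hO (F := fun i x => F i x + δ * g i x)
      (F' := fun i x => F' i x + δ * g' i x)
      (fun i => (hF i).add (continuousOn_const.mul (hg1 i).continuous.continuousOn))
      (fun i => (hF' i).add (continuousOn_const.mul (hg'c i).continuousOn))
      (fun i x hx => ?_) (fun x hx => ?_)
    · rw [← integral_const_mul, ← integral_add]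
      · refine h.trans_eq (integral_congr_ae (Eventually.of_forall fun x => ?_))
        simp only [Finset.sum_add_distrib, Finset.mul_sum]
      · exact hint _ (continuousOn_finsetSum _ fun i _ => hF' i)
      · exact (hint _ (continuousOn_finsetSum _ fun i _ => (hg'c i).continuousOn)).const_mul δ
    · have h2 : HasLineDerivAt ℝ (g i) (g' i x) x (ex i) :=
        ((hg1 i).differentiable (by norm_num) x).hasFDerivAt.hasLineDerivAt (ex i)
      exact HasDerivAt.add (hd i x hx) (HasDerivAt.const_mul δ h2)
    · have e : dotGrad ρ (fun i x => F i x + δ * g i x) x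
          = dotGrad ρ F x + δ * ∑ i, fderiv ℝ ρ x (ex i) * fderiv ℝ ρ x (ex i) := by
        simp only [dotGrad, hg, Finset.mul_sum, ← Finset.sum_add_distrib]
        refine Finset.sum_congr rfl fun i _ => ?_
        ring
      rw [e]
      have := mul_pos hδ (hO.sum_fderiv_sq_pos hx)
      linarith [hb x hx]
  have hlim : Tendsto (fun n : ℕ => (∫ x in O, ∑ i, F' i x) + 1 / ((n : ℝ) + 1) * ∫ x in O, ∑ i, g' i x)
      atTop (𝓝 ((∫ x in O, ∑ i, F' i x) + 0 * ∫ x in O, ∑ i, g' i x)) :=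
    tendsto_const_nhds.add (tendsto_one_div_add_atTop_nhds_zero_nat.mul_const _)
  have := ge_of_tendsto' hlim (fun n => hstep _ (by positivity))
  simpa using this

/-! ### Tangent directions at the boundary -/

theorem IsBoundedC2Domain.eventually_add_smul_neg {O : Set Plane} {ρ : Plane → ℝ}
    (hO : IsBoundedC2Domain O ρ) {x v : Plane} (hx : x ∈ frontier O) (hv : fderiv ℝ ρ x v < 0) :
    ∀ᶠ t : ℝ in 𝓝[>] 0, ρ (x + t • v) < 0 := by
  have hd : HasDerivAt (fun t : ℝ => ρ (x + t • v)) (fderiv ℝ ρ x v) 0 :=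
    (hO.contDiff.differentiable (by norm_num) x).hasFDerivAt.hasLineDerivAt v
  have h1 := hd.tendsto_slope.eventually_lt_const hv
  have h2 : ∀ᶠ t : ℝ in 𝓝[>] 0, slope (fun t : ℝ => ρ (x + t • v)) 0 t < 0 :=
    h1.filter_mono (nhdsWithin_mono _ fun t ht => ne_of_gt ht)
  filter_upwards [h2, self_mem_nhdsWithin] with t ht ht0
  have ht0 : 0 < t := ht0
  simp only [slope_def_field, zero_smul, add_zero, hO.eq_zero_of_mem_frontier hx, sub_zero] at ht
  by_contra hneg
  exact absurd ht (not_lt.mpr (div_nonneg (not_lt.mp hneg) ht0.le))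

theorem IsBoundedC2Domain.fderiv_ne_zero {O : Set Plane} {ρ : Plane → ℝ}
    (hO : IsBoundedC2Domain O ρ) {x : Plane} (hx : x ∈ frontier O) : fderiv ℝ ρ x ≠ 0 := by
  intro h
  exact hO.gradient_ne_zero x hx (by simp [gradient, h])

theorem IsBoundedC2Domain.exists_fderiv_neg {O : Set Plane} {ρ : Plane → ℝ}
    (hO : IsBoundedC2Domain O ρ) {x : Plane} (hx : x ∈ frontier O) :
    ∃ v, fderiv ℝ ρ x v < 0 := by
  by_contra! h
  refine hO.fderiv_ne_zero hx ?_
  ext v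
  have h1 := h v
  have h2 := h (-v)
  simp only [map_neg] at h2
  simp only [zero_apply]
  linarith

/-- Derivatives within `closure O` are unique: at a boundary point the tangent cone contains the
half-plane of the directions along which `ρ` decreases. -/
theorem IsBoundedC2Domain.uniqueDiffOn_closure {O : Set Plane} {ρ : Plane → ℝ}
    (hO : IsBoundedC2Domain O ρ) : UniqueDiffOn ℝ (closure O) := by
  intro x hx
  by_cases hxO : x ∈ O
  · exact uniqueDiffWithinAt_of_mem_nhds
      (mem_of_superset (hO.isOpen.mem_nhds hxO) subset_closure)
  have hxf : x ∈ frontier O := ⟨hx, by rwa [hO.isOpen.interior_eq]⟩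
  refine ⟨?_, subset_closure hx⟩
  have hsub : {v | fderiv ℝ ρ x v < 0} ⊆ tangentConeAt ℝ (closure O) x := by
    intro v hv
    refine mem_tangentConeAt_of_add_smul_mem (l := 𝓝[>] (0 : ℝ)) (c := id) ?_ ?_
    · exact tendsto_id.mono_left (nhdsWithin_mono _ fun t ht => ne_of_gt ht)
    · filter_upwards [hO.eventually_add_smul_neg hxf hv] with t ht
      exact subset_closure (hO.mem_of_mem_closure_of_neg ht)
  have hopen : IsOpen {v | fderiv ℝ ρ x v < 0} :=
    isOpen_lt (fderiv ℝ ρ x).continuous continuous_const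
  have htop : Submodule.span ℝ (tangentConeAt ℝ (closure O) x) = ⊤ := by
    apply Submodule.eq_top_of_nonempty_interior'
    obtain ⟨v, hv⟩ := hO.exists_fderiv_neg hxf
    exact ⟨v, interior_mono (hsub.trans Submodule.subset_span) (by rwa [hopen.interior_eq])⟩
  rw [htop]
  simp

/-- A direction on which `dρ` vanishes is tangent to the boundary, in the sense of the tangent
cone: nearby segments transverse to it join the inside to the outside of `O`. -/
theorem IsBoundedC2Domain.mem_tangentConeAt_frontier {O : Set Plane} {ρ : Plane → ℝ}
    (hO : IsBoundedC2Domain O ρ) {x v : Plane} (hx : x ∈ frontier O)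
    (hv : fderiv ℝ ρ x v = 0) : v ∈ tangentConeAt ℝ (frontier O) x := by
  obtain ⟨n, hn⟩ := hO.exists_fderiv_neg hx
  have key : ∀ k : ℕ, ∃ h r : ℝ, 0 < h ∧ h < 1 / ((k : ℝ) + 1) ∧ |r| ≤ 1 / ((k : ℝ) + 1) ∧
      x + h • (v + r • n) ∈ frontier O := by
    intro k
    set δ : ℝ := 1 / ((k : ℝ) + 1) with hδ
    have hδ0 : 0 < δ := by positivity
    have h1 := hO.eventually_add_smul_neg (v := v + δ • n) hx (by
      simp only [map_add, map_smul, hv, smul_eq_mul, zero_add]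
      exact mul_neg_of_pos_of_neg hδ0 hn)
    have h2 : ∀ᶠ t : ℝ in 𝓝[>] 0, 0 < ρ (x + t • (v + (-δ) • n)) := by
      have hd : HasDerivAt (fun t : ℝ => ρ (x + t • (v + (-δ) • n)))
          (fderiv ℝ ρ x (v + (-δ) • n)) 0 :=
        (hO.contDiff.differentiable (by norm_num) x).hasFDerivAt.hasLineDerivAt _
      have hp : 0 < fderiv ℝ ρ x (v + (-δ) • n) := by
        simp only [map_add, map_smul, hv, smul_eq_mul, zero_add]
        exact mul_pos_of_neg_of_neg (by linarith) hn
      have h3 : ∀ᶠ t : ℝ in 𝓝[>] 0, 0 < slope (fun t : ℝ => ρ (x + t • (v + (-δ) • n))) 0 t :=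
        (hd.tendsto_slope.eventually_const_lt hp).filter_mono
          (nhdsWithin_mono _ fun t ht => ne_of_gt ht)
      filter_upwards [h3, self_mem_nhdsWithin] with t ht ht0
      have ht0 : 0 < t := ht0
      simp only [slope_def_field, zero_smul, add_zero, hO.eq_zero_of_mem_frontier hx, sub_zero]
        at ht
      by_contra hneg
      exact absurd ht (not_lt.mpr (div_nonpos_of_nonpos_of_nonneg (not_lt.mp hneg) ht0.le))
    obtain ⟨h, ⟨⟨ha, hb⟩, hh0⟩, hhδ⟩ := ((h1.and h2).and self_mem_nhdsWithin).and
      (nhdsWithin_le_nhds (gt_mem_nhds hδ0)) |>.exists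
    have hc : Continuous fun r : ℝ => x + h • (v + r • n) := by fun_prop
    have hpre : IsPreconnected ((fun r : ℝ => x + h • (v + r • n)) '' Icc (-δ) δ) :=
      isPreconnected_Icc.image _ hc.continuousOn
    by_contra! hno
    have hcov : (fun r : ℝ => x + h • (v + r • n)) '' Icc (-δ) δ ⊆ O ∪ (closure O)ᶜ := by
      rintro _ ⟨r, hr, rfl⟩
      by_contra hmem
      rw [mem_union, not_or, notMem_compl_iff] at hmem
      refine hno h r hh0 hhδ (abs_le.mpr hr) ⟨hmem.2, ?_⟩
      rw [hO.isOpen.interior_eq]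
      exact hmem.1
    obtain ⟨y, -, hy1, hy2⟩ := hpre O (closure O)ᶜ hO.isOpen isClosed_closure.isOpen_compl hcov
      ⟨_, ⟨δ, ⟨by linarith, le_rfl⟩, rfl⟩, hO.mem_of_mem_closure_of_neg ha⟩
      ⟨_, ⟨-δ, ⟨le_rfl, by linarith⟩, rfl⟩, fun hmem =>
        absurd hb (not_lt.mpr (hO.nonpos_of_mem_closure hmem))⟩
    exact hy2 (subset_closure hy1)
  choose h r hh0 hhδ hr hmem using key
  have hlim := tendsto_one_div_add_atTop_nhds_zero_nat (𝕜 := ℝ)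
  have hh : Tendsto h atTop (𝓝 0) :=
    squeeze_zero (fun k => (hh0 k).le) (fun k => (hhδ k).le) hlim
  have hrl : Tendsto r atTop (𝓝 0) := squeeze_zero_norm hr hlim
  have hvr : Tendsto (fun k => v + r k • n) atTop (𝓝 v) := by
    simpa using (tendsto_const_nhds (x := v)).add (hrl.smul_const n)
  refine mem_tangentConeAt_of_seq atTop (fun k => (h k)⁻¹) (fun k => h k • (v + r k • n)) ?_
    (Eventually.of_forall hmem) ?_
  · simpa using hh.smul hvr
  · refine hvr.congr fun k => ?_
    rw [smul_smul, inv_mul_cancel₀ (hh0 k).ne', one_smul]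

/-- The derivative of a function that vanishes on the boundary is parallel to `dρ` there. -/
theorem IsBoundedC2Domain.fderivWithin_parallel {O : Set Plane} {ρ : Plane → ℝ}
    (hO : IsBoundedC2Domain O ρ) {x : Plane} (hx : x ∈ frontier O) {u : Plane → ℝ}
    {u' : Plane →L[ℝ] ℝ} (hu : HasFDerivWithinAt u u' (closure O) x)
    (h0 : ∀ y ∈ frontier O, u y = 0) :
    u' (ex 0) * fderiv ℝ ρ x (ex 1) = u' (ex 1) * fderiv ℝ ρ x (ex 0) := by
  set g := fderiv ℝ ρ x
  have hv : g (g (ex 1) • ex 0 - g (ex 0) • ex 1) = 0 := by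
    simp only [map_sub, map_smul, smul_eq_mul]; ring
  have h1 := hu.mono (frontier_subset_closure (s := O))
  have h2 : HasFDerivWithinAt u (0 : Plane →L[ℝ] ℝ) (frontier O) x :=
    (hasFDerivWithinAt_const (0 : ℝ) x (frontier O)).congr (fun y hy => h0 y hy) (h0 x hx)
  have := h1.unique_on h2 (hO.mem_tangentConeAt_frontier hx hv)
  simp only [map_sub, map_smul, smul_eq_mul, zero_apply] at this
  linarith

/-! ### Partial derivatives in space-time -/

/-- The unit vector of the time axis. -/
noncomputable abbrev et : ℝ × Plane := (1, 0)

/-- The `i`-th unit vector of the space axes. -/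
noncomputable abbrev es (i : Fin 2) : ℝ × Plane := (0, ex i)

/-- The partial derivative of `f` in the direction `v`, taken within `S`. -/
noncomputable def pd (S : Set (ℝ × Plane)) (v : ℝ × Plane) (f : ℝ × Plane → ℝ)
    (p : ℝ × Plane) : ℝ :=
  fderivWithin ℝ f S p v

/-- `f` is differentiable within `S` at `p`, with partial derivative `c` in the direction `v`. -/
def HasPD (S : Set (ℝ × Plane)) (v : ℝ × Plane) (f : ℝ × Plane → ℝ) (c : ℝ) (p : ℝ × Plane) :
    Prop :=
  ∃ f' : ℝ × Plane →L[ℝ] ℝ, HasFDerivWithinAt f f' S p ∧ f' v = c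

section HasPD

variable {S : Set (ℝ × Plane)} {v p : ℝ × Plane} {f g : ℝ × Plane → ℝ} {a b : ℝ}

theorem HasPD.congr_deriv (hf : HasPD S v f a p) (h : a = b) : HasPD S v f b p := h ▸ hf

theorem HasPD.add (hf : HasPD S v f a p) (hg : HasPD S v g b p) :
    HasPD S v (fun q => f q + g q) (a + b) p := by
  obtain ⟨f', hf, rfl⟩ := hf
  obtain ⟨g', hg, rfl⟩ := hg
  exact ⟨f' + g', hf.add hg, rfl⟩

theorem HasPD.sub (hf : HasPD S v f a p) (hg : HasPD S v g b p) :
    HasPD S v (fun q => f q - g q) (a - b) p := by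
  obtain ⟨f', hf, rfl⟩ := hf
  obtain ⟨g', hg, rfl⟩ := hg
  exact ⟨f' - g', hf.sub hg, rfl⟩

theorem HasPD.mul (hf : HasPD S v f a p) (hg : HasPD S v g b p) :
    HasPD S v (fun q => f q * g q) (a * g p + f p * b) p := by
  obtain ⟨f', hf, rfl⟩ := hf
  obtain ⟨g', hg, rfl⟩ := hg
  refine ⟨f p • g' + g p • f', hf.mul hg, ?_⟩
  simp only [add_apply, smul_apply, smul_eq_mul]
  ring

theorem hasPD_const (c : ℝ) : HasPD S v (fun _ => c) 0 p :=
  ⟨0, hasFDerivWithinAt_const c p S, rfl⟩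

theorem HasPD.const_mul (c : ℝ) (hf : HasPD S v f a p) : HasPD S v (fun q => c * f q) (c * a) p :=
  ((hasPD_const c).mul hf).congr_deriv (by ring)

theorem HasPD.sq (hf : HasPD S v f a p) : HasPD S v (fun q => f q ^ 2) (2 * f p * a) p := by
  simp only [pow_two]
  exact (hf.mul hf).congr_deriv (by ring)

theorem HasPD.exp (hf : HasPD S v f a p) :
    HasPD S v (fun q => Real.exp (f q)) (Real.exp (f p) * a) p := by
  obtain ⟨f', hf, rfl⟩ := hf
  exact ⟨Real.exp (f p) • f', hf.exp, rfl⟩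

theorem HasPD.pd_eq (hf : HasPD S v f a p) (hS : UniqueDiffOn ℝ S) (hp : p ∈ S) :
    pd S v f p = a := by
  obtain ⟨f', hf, rfl⟩ := hf
  rw [pd, hf.fderivWithin (hS p hp)]

theorem hasPD_pd {n : WithTop ℕ∞} (hf : ContDiffOn ℝ n f S) (hn : n ≠ 0) (hp : p ∈ S) :
    HasPD S v f (pd S v f p) p :=
  ⟨_, (hf.differentiableOn hn p hp).hasFDerivWithinAt, rfl⟩

theorem contDiffOn_pd {m n : WithTop ℕ∞} (hf : ContDiffOn ℝ n f S) (hS : UniqueDiffOn ℝ S)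
    (hmn : m + 1 ≤ n) : ContDiffOn ℝ m (pd S v f) S :=
  (hf.fderivWithin hS hmn).clm_apply contDiffOn_const

theorem continuousOn_pd {n : WithTop ℕ∞} (hf : ContDiffOn ℝ n f S) (hS : UniqueDiffOn ℝ S)
    (hn : 1 ≤ n) : ContinuousOn (pd S v f) S :=
  (contDiffOn_pd (m := 0) hf hS (by simpa using hn)).continuousOn

theorem pd_pd_eq {S : Set (ℝ × Plane)} {f : ℝ × Plane → ℝ} {p : ℝ × Plane}
    (hf : ContDiffOn ℝ 2 f S) (hS : UniqueDiffOn ℝ S) (hp : p ∈ S) (u v : ℝ × Plane) :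
    pd S u (pd S v f) p = fderivWithin ℝ (fderivWithin ℝ f S) S p u v := by
  have h1 : DifferentiableWithinAt ℝ (fderivWithin ℝ f S) S p :=
    (hf.fderivWithin (m := 1) hS (by norm_num)).differentiableOn (by norm_num) p hp
  have h2 : HasFDerivWithinAt (fun q => fderivWithin ℝ f S q v)
      ((ContinuousLinearMap.apply ℝ ℝ v).comp (fderivWithin ℝ (fderivWithin ℝ f S) S p)) S p :=
    (ContinuousLinearMap.apply ℝ ℝ v).hasFDerivAt.comp_hasFDerivWithinAt p
      h1.hasFDerivWithinAt
  change fderivWithin ℝ (fun q => fderivWithin ℝ f S q v) S p u = _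
  rw [h2.fderivWithin (hS p hp)]
  rfl

theorem pd_comm {u : ℝ × Plane} (hf : ContDiffOn ℝ 2 f S) (hS : UniqueDiffOn ℝ S) (hp : p ∈ S)
    (hpi : p ∈ closure (interior S)) : pd S u (pd S v f) p = pd S v (pd S u f) p := by
  rw [pd_pd_eq hf hS hp, pd_pd_eq hf hS hp]
  exact (hf p hp).isSymmSndFDerivWithinAt (by simp) hS hpi hp u v

theorem pd_congr_set {A : Set (ℝ × Plane)} (hA : A ∈ 𝓝 p) : pd (S ∩ A) v f p = pd S v f p := by
  rw [pd, pd, fderivWithin_inter hA]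

theorem pd_congr (h : ∀ q ∈ S, f q = g q) (hp : p ∈ S) : pd S v f p = pd S v g p := by
  rw [pd, pd, fderivWithin_congr h (h p hp)]

end HasPD

/-- The space-time cylinder `[0,T) × closure O`, without the final time. -/
def halfCylinder (T : ℝ) (O : Set Plane) : Set (ℝ × Plane) := Ico 0 T ×ˢ closure O

section Cylinder

variable {T : ℝ} {O : Set Plane} {ρ : Plane → ℝ}

theorem uniqueDiffOn_halfCylinder (hO : IsBoundedC2Domain O ρ) :
    UniqueDiffOn ℝ (halfCylinder T O) :=
  (uniqueDiffOn_Ico 0 T).prod hO.uniqueDiffOn_closure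

theorem cylinder_subset_halfCylinder : cylinder T O ⊆ halfCylinder T O :=
  prod_mono Ioo_subset_Ico_self subset_closure

theorem halfCylinder_subset_closedCylinder : halfCylinder T O ⊆ closedCylinder T O :=
  prod_mono Ico_subset_Icc_self le_rfl

theorem IsBoundedC2Domain.isOpen_cylinder (hO : IsBoundedC2Domain O ρ) (T : ℝ) :
    IsOpen (cylinder T O) := isOpen_Ioo.prod hO.isOpen

theorem hasFDerivWithinAt_space_slice {f : ℝ × Plane → ℝ} {f' : ℝ × Plane →L[ℝ] ℝ} {t : ℝ}
    {x : Plane} (ht : t ∈ Ico 0 T) (hf : HasFDerivWithinAt f f' (halfCylinder T O) (t, x)) :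
    HasFDerivWithinAt (fun y => f (t, y)) (f'.comp (ContinuousLinearMap.inr ℝ ℝ Plane))
      (closure O) x := by
  have h1 : HasFDerivWithinAt (fun y : Plane => (t, y)) (ContinuousLinearMap.inr ℝ ℝ Plane)
      (closure O) x := (hasFDerivAt_prodMk_right t x).hasFDerivWithinAt
  exact HasFDerivWithinAt.comp x (f := fun y : Plane => (t, y)) hf h1
    (fun y hy => ⟨ht, hy⟩)

theorem hasDerivWithinAt_time_slice {f : ℝ × Plane → ℝ} {f' : ℝ × Plane →L[ℝ] ℝ} {t : ℝ}
    {x : Plane} (hx : x ∈ closure O) (hf : HasFDerivWithinAt f f' (halfCylinder T O) (t, x)) :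
    HasDerivWithinAt (fun r => f (r, x)) (f' et) (Ico 0 T) t := by
  have h1 : HasFDerivWithinAt (fun r : ℝ => (r, x)) (ContinuousLinearMap.inl ℝ ℝ Plane)
      (Ico 0 T) t := (hasFDerivAt_prodMk_left t x).hasFDerivWithinAt
  have := HasFDerivWithinAt.comp t (f := fun r : ℝ => (r, x)) hf h1 (fun y hy => ⟨hy, hx⟩)
  refine this.hasDerivWithinAt.congr_deriv ?_
  simp

theorem HasPD.hasLineDerivAt (hO : IsBoundedC2Domain O ρ) {f : ℝ × Plane → ℝ} {a t : ℝ}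
    {x : Plane} {i : Fin 2} (ht : t ∈ Ico 0 T) (hx : x ∈ O)
    (hf : HasPD (halfCylinder T O) (es i) f a (t, x)) :
    HasLineDerivAt ℝ (fun y => f (t, y)) a x (ex i) := by
  obtain ⟨f', hf, rfl⟩ := hf
  have := (hasFDerivWithinAt_space_slice ht hf).hasFDerivAt
    (mem_of_superset (hO.isOpen.mem_nhds hx) subset_closure)
  simpa using this.hasLineDerivAt (ex i)

theorem HasPD.hasDerivAt_time {f : ℝ × Plane → ℝ} {a t : ℝ} {x : Plane} (ht : t ∈ Ioo 0 T)
    (hx : x ∈ closure O) (hf : HasPD (halfCylinder T O) et f a (t, x)) :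
    HasDerivAt (fun r => f (r, x)) a t := by
  obtain ⟨f', hf, rfl⟩ := hf
  exact (hasDerivWithinAt_time_slice hx hf).hasDerivAt (Ico_mem_nhds ht.1 ht.2)

theorem sub_cylinder_subset {T' : ℝ} (hT' : T' < T) :
    Icc 0 T' ×ˢ closure O ⊆ halfCylinder T O :=
  prod_mono (fun _ ht => ⟨ht.1, ht.2.trans_lt hT'⟩) le_rfl

theorem integrableOn_cylinder_of_continuousOn (hO : IsBoundedC2Domain O ρ) {T' : ℝ} (hT' : T' < T)
    {f : ℝ × Plane → ℝ} (hf : ContinuousOn f (halfCylinder T O)) :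
    IntegrableOn f (cylinder T' O) :=
  ((hf.mono (sub_cylinder_subset hT')).integrableOn_compact
    (isCompact_Icc.prod hO.isCompact_closure)).mono_set
      (prod_mono Ioo_subset_Icc_self subset_closure)

theorem integrableOn_slice_of_continuousOn (hO : IsBoundedC2Domain O ρ) {t : ℝ} (ht : t ∈ Ico 0 T)
    {f : ℝ × Plane → ℝ} (hf : ContinuousOn f (halfCylinder T O)) :
    IntegrableOn (fun x => f (t, x)) O :=
  (ContinuousOn.integrableOn_compact hO.isCompact_closure
    (hf.comp (by fun_prop) (fun x hx => ⟨ht, hx⟩))).mono_set subset_closure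

/-- One-sided divergence theorem in space-time: if the spatial field `F` points outward along the
lateral boundary, its flux can be dropped. -/
theorem integral_spacetime_div_ge (hO : IsBoundedC2Domain O ρ) {T' : ℝ} (h0 : 0 < T') (hT' : T' < T)
    {F : Fin 2 → ℝ × Plane → ℝ} {H : ℝ × Plane → ℝ}
    (hF : ∀ i, ContDiffOn ℝ 1 (F i) (halfCylinder T O)) (hH : ContDiffOn ℝ 1 H (halfCylinder T O))
    (hb : ∀ t ∈ Ioo 0 T, ∀ x ∈ frontier O, 0 ≤ ∑ i, F i (t, x) * fderiv ℝ ρ x (ex i)) :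
    (∫ x in O, H (T', x)) - ∫ x in O, H (0, x) ≤
      ∫ p in cylinder T' O, ((∑ i, pd (halfCylinder T O) (es i) (F i) p)
        + pd (halfCylinder T O) et H p) := by
  have hS : UniqueDiffOn ℝ (halfCylinder T O) := uniqueDiffOn_halfCylinder hO
  have hFc : ∀ i, ContinuousOn (pd (halfCylinder T O) (es i) (F i)) (halfCylinder T O) :=
    fun i => continuousOn_pd (hF i) hS le_rfl
  have hsum : ContinuousOn (fun p => ∑ i, pd (halfCylinder T O) (es i) (F i) p)
    (halfCylinder T O) := continuousOn_finsetSum _ fun i _ => hFc i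
  have hHc : ContinuousOn (pd (halfCylinder T O) et H) (halfCylinder T O) :=
    continuousOn_pd hH hS le_rfl
  have i1 := integrableOn_cylinder_of_continuousOn hO hT' hsum
  have i2 := integrableOn_cylinder_of_continuousOn hO hT' hHc
  rw [integral_add i1 i2]
  have hA : 0 ≤ ∫ p in cylinder T' O, ∑ i, pd (halfCylinder T O) (es i) (F i) p := by
    unfold cylinder at i1 ⊢
    rw [Measure.volume_eq_prod] at i1 ⊢
    rw [setIntegral_prod _ i1]
    refine setIntegral_nonneg measurableSet_Ioo fun t ht => ?_
    have htT : t ∈ Ico 0 T := ⟨ht.1.le, ht.2.trans hT'⟩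
    have hmap : MapsTo (fun x : Plane => (t, x)) (closure O) (halfCylinder T O) :=
      fun x hx => ⟨htT, hx⟩
    refine integral_div_nonneg hO (F := fun i x => F i (t, x))
      (F' := fun i x => pd (halfCylinder T O) (es i) (F i) (t, x))
      (fun i => (hF i).continuousOn.comp (by fun_prop) hmap)
      (fun i => (hFc i).comp (by fun_prop) hmap) (fun i x hx => ?_)
      (fun x hx => hb t ⟨ht.1, ht.2.trans hT'⟩ x hx)
    exact (hasPD_pd (hF i) one_ne_zero ⟨htT, subset_closure hx⟩).hasLineDerivAt hO htT hx
  have hB : ∫ p in cylinder T' O, pd (halfCylinder T O) et H p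
      = (∫ x in O, H (T', x)) - ∫ x in O, H (0, x) := by
    unfold cylinder at i2 ⊢
    rw [Measure.volume_eq_prod] at i2 ⊢
    rw [setIntegral_prod _ i2, integral_integral_swap (by
      rw [Measure.prod_restrict]; exact i2), ← integral_sub
      (integrableOn_slice_of_continuousOn hO ⟨h0.le, hT'⟩ hH.continuousOn)
      (integrableOn_slice_of_continuousOn hO ⟨le_rfl, h0.trans hT'⟩ hH.continuousOn)]
    refine setIntegral_congr_fun hO.isOpen.measurableSet fun x hx => ?_
    have hx' : x ∈ closure O := subset_closure hx
    have hmap : MapsTo (fun r : ℝ => (r, x)) (Icc 0 T') (halfCylinder T O) :=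
      fun r hr => ⟨⟨hr.1, hr.2.trans_lt hT'⟩, hx'⟩
    rw [← integral_Ioc_eq_integral_Ioo, ← intervalIntegral.integral_of_le h0.le]
    refine intervalIntegral.integral_eq_sub_of_hasDerivAt_of_le h0.le
      (f := fun r => H (r, x)) (hH.continuousOn.comp (by fun_prop) hmap) (fun t ht => ?_) ?_
    · have htT : t ∈ Ioo 0 T := ⟨ht.1, ht.2.trans hT'⟩
      exact (hasPD_pd hH one_ne_zero
        ⟨Ioo_subset_Ico_self htT, hx'⟩).hasDerivAt_time htT hx'
    · refine ContinuousOn.intervalIntegrable ?_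
      rw [uIcc_of_le h0.le]
      exact hHc.comp (by fun_prop) hmap
  rw [hB]
  linarith

end Cylinder

/-! ### The conjugated operator: a product identity -/

/-- The component of the spatial flux along the axis on which `ψ` and `w` have the partial
derivatives `ψi` and `wi`. -/
def flux (ν s lam ε : ℝ) (σ ξ q ψ₁ ψ₂ w wt w₁ w₂ ψi wi : ℝ × Plane → ℝ) (p : ℝ × Plane) : ℝ :=
  ν * σ p * wt p * wi p
  - 2 * (s * ν ^ 2 * lam) * ξ p * (ψ₁ p * w₁ p + ψ₂ p * w₂ p) * wi p
  + (s * ν ^ 2 * lam) * ξ p * (w₁ p ^ 2 + w₂ p ^ 2) * ψi p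
  - (s * ν ^ 2 * lam) * lam * ξ p * (2 * (ψ₁ p ^ 2 + ψ₂ p ^ 2) + ε) * w p * wi p
  - s ^ 3 * ν ^ 2 * lam ^ 3 * ξ p ^ 2 * ξ p * (ψ₁ p ^ 2 + ψ₂ p ^ 2) * ψi p * w p ^ 2
  - s ^ 2 * ν * lam * σ p * q p * ξ p * ψi p * w p ^ 2

/-- The density whose time derivative appears in the product of the two parts of the conjugated
operator. -/
noncomputable def energy (ν s lam : ℝ) (σ ξ q ψ₁ ψ₂ w w₁ w₂ : ℝ × Plane → ℝ) (p : ℝ × Plane) : ℝ :=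
  -(ν / 2) * σ p * (w₁ p ^ 2 + w₂ p ^ 2)
  + s ^ 2 * ν * lam ^ 2 / 2 * σ p * ξ p ^ 2 * (ψ₁ p ^ 2 + ψ₂ p ^ 2) * w p ^ 2
  + s / 2 * σ p ^ 2 * q p * w p ^ 2

section

variable {S : Set (ℝ × Plane)} {v p : ℝ × Plane}
  {σ ξ q ψ₁ ψ₂ w wt w₁ w₂ ψi wi : ℝ × Plane → ℝ}
  {σv ξv qv ψ₁v ψ₂v wv wtv w₁v w₂v ψiv wiv : ℝ}

theorem hasPD_flux (ν s lam ε : ℝ) (hσ : HasPD S v σ σv p) (hξ : HasPD S v ξ ξv p)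
    (hq : HasPD S v q qv p) (h1 : HasPD S v ψ₁ ψ₁v p) (h2 : HasPD S v ψ₂ ψ₂v p)
    (hw : HasPD S v w wv p) (hwt : HasPD S v wt wtv p) (hw1 : HasPD S v w₁ w₁v p)
    (hw2 : HasPD S v w₂ w₂v p) (hψi : HasPD S v ψi ψiv p) (hwi : HasPD S v wi wiv p) :
    HasPD S v (flux ν s lam ε σ ξ q ψ₁ ψ₂ w wt w₁ w₂ ψi wi)
      (ν * (σv * wt p * wi p + σ p * wtv * wi p + σ p * wt p * wiv)
      - 2 * (s * ν ^ 2 * lam) * (ξv * (ψ₁ p * w₁ p + ψ₂ p * w₂ p) * wi p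
        + ξ p * (ψ₁v * w₁ p + ψ₁ p * w₁v + ψ₂v * w₂ p + ψ₂ p * w₂v) * wi p
        + ξ p * (ψ₁ p * w₁ p + ψ₂ p * w₂ p) * wiv)
      + (s * ν ^ 2 * lam) * (ξv * (w₁ p ^ 2 + w₂ p ^ 2) * ψi p
        + ξ p * (2 * w₁ p * w₁v + 2 * w₂ p * w₂v) * ψi p
        + ξ p * (w₁ p ^ 2 + w₂ p ^ 2) * ψiv)
      - (s * ν ^ 2 * lam) * lam * (ξv * (2 * (ψ₁ p ^ 2 + ψ₂ p ^ 2) + ε) * w p * wi p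
        + ξ p * (4 * (ψ₁ p * ψ₁v + ψ₂ p * ψ₂v)) * w p * wi p
        + ξ p * (2 * (ψ₁ p ^ 2 + ψ₂ p ^ 2) + ε) * (wv * wi p + w p * wiv))
      - s ^ 3 * ν ^ 2 * lam ^ 3 * (3 * ξ p ^ 2 * ξv * (ψ₁ p ^ 2 + ψ₂ p ^ 2) * ψi p * w p ^ 2
        + ξ p ^ 3 * (2 * (ψ₁ p * ψ₁v + ψ₂ p * ψ₂v)) * ψi p * w p ^ 2
        + ξ p ^ 3 * (ψ₁ p ^ 2 + ψ₂ p ^ 2) * (ψiv * w p ^ 2 + ψi p * (2 * w p * wv)))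
      - s ^ 2 * ν * lam * (σv * q p * ξ p * ψi p * w p ^ 2 + σ p * qv * ξ p * ψi p * w p ^ 2
        + σ p * q p * ξv * ψi p * w p ^ 2
        + σ p * q p * ξ p * (ψiv * w p ^ 2 + ψi p * (2 * w p * wv)))) p := by
  have hgs := h1.sq.add h2.sq
  have t1 := ((hσ.const_mul ν).mul hwt).mul hwi
  have t2 := ((hξ.const_mul (2 * (s * ν ^ 2 * lam))).mul ((h1.mul hw1).add (h2.mul hw2))).mul hwi
  have t3 := ((hξ.const_mul (s * ν ^ 2 * lam)).mul (hw1.sq.add hw2.sq)).mul hψi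
  have t4 := (((hξ.const_mul ((s * ν ^ 2 * lam) * lam)).mul
    ((hgs.const_mul 2).add (hasPD_const ε))).mul hw).mul hwi
  have t5 := ((((hξ.sq.const_mul (s ^ 3 * ν ^ 2 * lam ^ 3)).mul hξ).mul hgs).mul hψi).mul hw.sq
  have t6 := ((((hσ.const_mul (s ^ 2 * ν * lam)).mul hq).mul hξ).mul hψi).mul hw.sq
  exact (((((t1.sub t2).add t3).sub t4).sub t5).sub t6).congr_deriv (by ring)

theorem hasPD_energy (ν s lam : ℝ) (hσ : HasPD S v σ σv p) (hξ : HasPD S v ξ ξv p)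
    (hq : HasPD S v q qv p) (h1 : HasPD S v ψ₁ ψ₁v p) (h2 : HasPD S v ψ₂ ψ₂v p)
    (hw : HasPD S v w wv p) (hw1 : HasPD S v w₁ w₁v p) (hw2 : HasPD S v w₂ w₂v p) :
    HasPD S v (energy ν s lam σ ξ q ψ₁ ψ₂ w w₁ w₂)
      (-(ν / 2) * (σv * (w₁ p ^ 2 + w₂ p ^ 2) + σ p * (2 * w₁ p * w₁v + 2 * w₂ p * w₂v))
      + s ^ 2 * ν * lam ^ 2 / 2 * (σv * ξ p ^ 2 * (ψ₁ p ^ 2 + ψ₂ p ^ 2) * w p ^ 2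
        + σ p * (2 * ξ p * ξv) * (ψ₁ p ^ 2 + ψ₂ p ^ 2) * w p ^ 2
        + σ p * ξ p ^ 2 * (2 * (ψ₁ p * ψ₁v + ψ₂ p * ψ₂v)) * w p ^ 2
        + σ p * ξ p ^ 2 * (ψ₁ p ^ 2 + ψ₂ p ^ 2) * (2 * w p * wv))
      + s / 2 * (2 * σ p * σv * q p * w p ^ 2 + σ p ^ 2 * qv * w p ^ 2
        + σ p ^ 2 * q p * (2 * w p * wv))) p := by
  have hgs := h1.sq.add h2.sq
  have t1 := (hσ.const_mul (-(ν / 2))).mul (hw1.sq.add hw2.sq)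
  have t2 := (((hσ.const_mul (s ^ 2 * ν * lam ^ 2 / 2)).mul hξ.sq).mul hgs).mul hw.sq
  have t3 := ((hσ.sq.const_mul (s / 2)).mul hq).mul hw.sq
  exact ((t1.add t2).add t3).congr_deriv (by ring)

end

/-- The quadratic form left over when the product of the two parts of the conjugated operator is
written as a space-time divergence. The suffixes `t`, `₁`, `₂` mark partial derivatives. -/
noncomputable def remainderForm (ν s lam ε ξ ξt q qt q₁ q₂ σ σt σ₁ σ₂ ψ₁ ψ₂ ψ₁₁ ψ₁₂ ψ₂₂ ψt₁ ψt₂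
    w wt w₁ w₂ : ℝ) : ℝ :=
  (-ν * wt * (σ₁ * w₁ + σ₂ * w₂) + ν / 2 * σt * (w₁ ^ 2 + w₂ ^ 2))
  + (s * ν ^ 2 * lam) * (2 * lam * ξ * (ψ₁ * w₁ + ψ₂ * w₂) ^ 2
      + lam * ξ * (ψ₁ ^ 2 + ψ₂ ^ 2 + ε) * (w₁ ^ 2 + w₂ ^ 2))
  + (s * ν ^ 2 * lam) * ξ * (2 * (ψ₁₁ * w₁ ^ 2 + 2 * ψ₁₂ * (w₁ * w₂) + ψ₂₂ * w₂ ^ 2)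
      - (ψ₁₁ + ψ₂₂) * (w₁ ^ 2 + w₂ ^ 2))
  + (s * ν ^ 2 * lam) * lam * ξ * w * (lam * (2 * (ψ₁ ^ 2 + ψ₂ ^ 2) + ε) * (ψ₁ * w₁ + ψ₂ * w₂)
      + 4 * ((ψ₁ * ψ₁₁ + ψ₂ * ψ₁₂) * w₁ + (ψ₁ * ψ₁₂ + ψ₂ * ψ₂₂) * w₂))
  - s ^ 2 * ν * lam ^ 2 / 2 * (σt * ξ ^ 2 * (ψ₁ ^ 2 + ψ₂ ^ 2) + 2 * σ * ξ * ξt * (ψ₁ ^ 2 + ψ₂ ^ 2)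
      + σ * ξ ^ 2 * (2 * (ψ₁ * ψt₁ + ψ₂ * ψt₂))) * w ^ 2
  + s ^ 3 * ν ^ 2 * lam ^ 4 * ξ ^ 3 * (ψ₁ ^ 2 + ψ₂ ^ 2) * (ψ₁ ^ 2 + ψ₂ ^ 2 - ε) * w ^ 2
  + s ^ 3 * ν ^ 2 * lam ^ 3 * ξ ^ 3 * (2 * (ψ₁ * ψ₁₁ + ψ₂ * ψ₁₂) * ψ₁
      + 2 * (ψ₁ * ψ₁₂ + ψ₂ * ψ₂₂) * ψ₂ + (ψ₁ ^ 2 + ψ₂ ^ 2) * (ψ₁₁ + ψ₂₂)) * w ^ 2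
  - s / 2 * (2 * σ * σt * q + σ ^ 2 * qt) * w ^ 2
  + s ^ 2 * ν * lam * ξ * (-(lam * σ * q * (ψ₁ ^ 2 + ψ₂ ^ 2 + ε)) + σ * q * (ψ₁₁ + ψ₂₂)
      + q * (σ₁ * ψ₁ + σ₂ * ψ₂) + σ * (q₁ * ψ₁ + q₂ * ψ₂)) * w ^ 2

/-- The formally self-adjoint part `-ν Δw - s² ν λ² ξ² |∇ψ|² w - s σ q w` of the conjugated
operator; `q` stands for `∂ₜφ` and `lapw` for `Δw`. -/
def symmPart (ν s lam ξ q σ ψ₁ ψ₂ w lapw : ℝ) : ℝ :=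
  -ν * lapw - s ^ 2 * ν * lam ^ 2 * ξ ^ 2 * (ψ₁ ^ 2 + ψ₂ ^ 2) * w - s * σ * q * w

/-- The part `-σ ∂ₜw + 2 s ν λ ξ ∇ψ·∇w + s ν λ² ξ (2|∇ψ|² + ε) w` of the conjugated operator,
formally skew-adjoint to leading order. Conjugation gives the zero-order coefficient `|∇ψ|²` instead of
`2|∇ψ|² + ε`; the difference has lower order, and with this choice the coefficient of `|∇w|²` in
`remainderForm` is positive everywhere, also where `∇ψ` vanishes. -/
def skewPart (ν s lam ε ξ σ ψ₁ ψ₂ w wt w₁ w₂ : ℝ) : ℝ :=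
  -σ * wt + 2 * s * ν * lam * ξ * (ψ₁ * w₁ + ψ₂ * w₂)
    + s * ν * lam ^ 2 * ξ * (2 * (ψ₁ ^ 2 + ψ₂ ^ 2) + ε) * w

section

variable {S : Set (ℝ × Plane)} {p : ℝ × Plane}
  {σ ξ q ψ₁ ψ₂ w wt w₁ w₂ : ℝ × Plane → ℝ}
  {σt σ₁ σ₂ ξt qt q₁ q₂ ψ₁₁ ψ₁₂ ψ₂₂ ψt₁ ψt₂ wt₁ wt₂ w₁₁ w₁₂ w₂₂ lam : ℝ}

/-- The product of the two parts of the conjugated operator is a space-time divergence plus a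
quadratic form in `w` and its first derivatives. -/
theorem symmPart_mul_skewPart_eq (ν s ε : ℝ) (hS : UniqueDiffOn ℝ S) (hp : p ∈ S)
    (hσt : HasPD S et σ σt p) (hσ1 : HasPD S (es 0) σ σ₁ p) (hσ2 : HasPD S (es 1) σ σ₂ p)
    (hξt : HasPD S et ξ ξt p) (hξ1 : HasPD S (es 0) ξ (lam * ξ p * ψ₁ p) p)
    (hξ2 : HasPD S (es 1) ξ (lam * ξ p * ψ₂ p) p)
    (hqt : HasPD S et q qt p) (hq1 : HasPD S (es 0) q q₁ p) (hq2 : HasPD S (es 1) q q₂ p)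
    (hψ1t : HasPD S et ψ₁ ψt₁ p) (hψ11 : HasPD S (es 0) ψ₁ ψ₁₁ p) (hψ12 : HasPD S (es 1) ψ₁ ψ₁₂ p)
    (hψ2t : HasPD S et ψ₂ ψt₂ p) (hψ21 : HasPD S (es 0) ψ₂ ψ₁₂ p) (hψ22 : HasPD S (es 1) ψ₂ ψ₂₂ p)
    (hwt : HasPD S et w (wt p) p) (hw1 : HasPD S (es 0) w (w₁ p) p)
    (hw2 : HasPD S (es 1) w (w₂ p) p)
    (hwt1 : HasPD S (es 0) wt wt₁ p) (hwt2 : HasPD S (es 1) wt wt₂ p)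
    (hw1t : HasPD S et w₁ wt₁ p) (hw11 : HasPD S (es 0) w₁ w₁₁ p) (hw12 : HasPD S (es 1) w₁ w₁₂ p)
    (hw2t : HasPD S et w₂ wt₂ p) (hw21 : HasPD S (es 0) w₂ w₁₂ p) (hw22 : HasPD S (es 1) w₂ w₂₂ p) :
    symmPart ν s lam (ξ p) (q p) (σ p) (ψ₁ p) (ψ₂ p) (w p) (w₁₁ + w₂₂)
      * skewPart ν s lam ε (ξ p) (σ p) (ψ₁ p) (ψ₂ p) (w p) (wt p) (w₁ p) (w₂ p)
    = pd S (es 0) (flux ν s lam ε σ ξ q ψ₁ ψ₂ w wt w₁ w₂ ψ₁ w₁) p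
      + pd S (es 1) (flux ν s lam ε σ ξ q ψ₁ ψ₂ w wt w₁ w₂ ψ₂ w₂) p
      + pd S et (energy ν s lam σ ξ q ψ₁ ψ₂ w w₁ w₂) p
      + remainderForm ν s lam ε (ξ p) ξt (q p) qt q₁ q₂ (σ p) σt σ₁ σ₂ (ψ₁ p) (ψ₂ p)
          ψ₁₁ ψ₁₂ ψ₂₂ ψt₁ ψt₂ (w p) (wt p) (w₁ p) (w₂ p) := by
  rw [(hasPD_flux ν s lam ε hσ1 hξ1 hq1 hψ11 hψ21 hw1 hwt1 hw11 hw21 hψ11 hw11).pd_eq hS hp,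
    (hasPD_flux ν s lam ε hσ2 hξ2 hq2 hψ12 hψ22 hw2 hwt2 hw12 hw22 hψ22 hw22).pd_eq hS hp,
    (hasPD_energy ν s lam hσt hξt hqt hψ1t hψ2t hwt hw1t hw2t).pd_eq hS hp]
  simp only [symmPart, skewPart, remainderForm]
  ring

end

/-! ### Coercivity of the remainder form -/

theorem abs_mul_le_mul {x y A B : ℝ} (hx : |x| ≤ A) (hy : |y| ≤ B) : |x * y| ≤ A * B := by
  rw [abs_mul]
  exact mul_le_mul hx hy (abs_nonneg _) ((abs_nonneg _).trans hx)

theorem abs_add_le_add {x y A B : ℝ} (hx : |x| ≤ A) (hy : |y| ≤ B) : |x + y| ≤ A + B :=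
  (abs_add_le x y).trans (add_le_add hx hy)

/-- Quantities of lower order in `s` and `λ` are small compared with the dominant ones: they carry a
factor `1/r` once `s, λ ≥ r`. -/
theorem lower_order_le {r s lam ξ a b N : ℝ} (hr : 1 ≤ r) (hs : r ≤ s) (hl : r ≤ lam)
    (hξ : 1 ≤ ξ) (ha : 0 ≤ a) (hb : 0 ≤ b) (hN : 0 ≤ N) {D : ℝ}
    (hD : D = (s * lam ^ 2 * ξ * a ^ 2 + s ^ 3 * lam ^ 4 * ξ ^ 3 * b ^ 2
      + s ^ 2 * lam ^ 2 * ξ * N * b ^ 2) / r) :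
    s * lam * ξ * a ^ 2 ≤ D ∧ s * lam ^ 3 * ξ * (a * b) ≤ D ∧ s ^ 3 * lam ^ 3 * ξ ^ 3 * b ^ 2 ≤ D ∧
      s ^ 2 * lam ^ 4 * ξ ^ 3 * b ^ 2 ≤ D ∧ s ^ 2 * lam * ξ * N * b ^ 2 ≤ D := by
  have hr0 : 0 < r := by linarith
  have hs1 : 1 ≤ s := hr.trans hs
  have hl1 : 1 ≤ lam := hr.trans hl
  have hX : 0 ≤ s * lam ^ 2 * ξ * a ^ 2 := by positivity
  have hY : 0 ≤ s ^ 3 * lam ^ 4 * ξ ^ 3 * b ^ 2 := by positivity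
  have hZ : 0 ≤ s ^ 2 * lam ^ 2 * ξ * N * b ^ 2 := by positivity
  subst hD
  refine ⟨?_, ?_, ?_, ?_, ?_⟩ <;> rw [le_div_iff₀ hr0]
  · have : s * lam * ξ * a ^ 2 * r ≤ s * lam * ξ * a ^ 2 * lam := by gcongr
    nlinarith
  · have h1 : s * lam ^ 3 * ξ * (a * b) * r ≤ s * lam ^ 3 * ξ * (a * b) * (s * ξ) := by
      have : r ≤ s * ξ := by nlinarith
      gcongr
    have h2 : 0 ≤ s * lam ^ 2 * ξ * (a - s * lam * ξ * b) ^ 2 := by positivity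
    nlinarith
  · have : s ^ 3 * lam ^ 3 * ξ ^ 3 * b ^ 2 * r ≤ s ^ 3 * lam ^ 3 * ξ ^ 3 * b ^ 2 * lam := by gcongr
    nlinarith
  · have : s ^ 2 * lam ^ 4 * ξ ^ 3 * b ^ 2 * r ≤ s ^ 2 * lam ^ 4 * ξ ^ 3 * b ^ 2 * s := by gcongr
    nlinarith
  · have : s ^ 2 * lam * ξ * N * b ^ 2 * r ≤ s ^ 2 * lam * ξ * N * b ^ 2 * lam := by gcongr
    nlinarith

section

variable {M ν s lam ξ a b D ε : ℝ}

/-- The term with the spatial gradient of `σ`: the time derivative of `w` is recovered from the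
first-order part `B` of the operator. -/
theorem abs_time_term_le {B σ σt w wt gs dw sw : ℝ}
    (hM : 1 ≤ M) (hs1 : 1 ≤ s) (hl1 : 1 ≤ lam) (hξ : 1 ≤ ξ) (hν0 : 0 < ν) (hν : ν ≤ M)
    (hD0 : 0 ≤ D) (hε0 : 0 < ε) (hε : ε ≤ 1) (ha0 : 0 ≤ a) (hb0 : 0 ≤ b) (hwb : |w| ≤ b)
    (hσ0 : 0 < σ) (hσ1 : 1 ≤ M * σ) (hσt : |σt| ≤ M) (hgs0 : 0 ≤ gs) (hgsM : gs ≤ 2 * M ^ 2)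
    (hdwM : |dw| ≤ 2 * M * a) (hswM : |sw| ≤ 2 * M * a)
    (hσwt : σ * wt = -B + 2 * s * ν * lam * ξ * dw + s * ν * lam ^ 2 * ξ * (2 * gs + ε) * w)
    (B1 : s * lam * ξ * a ^ 2 ≤ D) (B2 : s * lam ^ 3 * ξ * (a * b) ≤ D) :
    |-ν * wt * sw + ν / 2 * σt * a ^ 2| ≤ B ^ 2 / 2 + 21 * M ^ 8 * D := by
  have hM0 : 0 < M := by linarith
  have hs0 : 0 < s := by linarith
  have hl0 : 0 < lam := by linarith
  have hξ0 : 0 < ξ := by linarith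
  have hMD : ∀ k : ℕ, k ≤ 8 → M ^ k * D ≤ M ^ 8 * D := fun k hk =>
    mul_le_mul_of_nonneg_right (pow_le_pow_right₀ hM hk) hD0
  have hνabs : |ν| ≤ M := by rwa [abs_of_pos hν0]
  have hM2 : 1 ≤ M ^ 2 := one_le_pow₀ hM
  have h1 : |σ * wt| ≤ |B| + 4 * M ^ 2 * (s * lam * ξ * a)
      + 5 * M ^ 3 * (s * lam ^ 2 * ξ * b) := by
    rw [hσwt]
    refine abs_add_le_add (abs_add_le_add (abs_neg B).le ?_) ?_
    · have : |2 * s * lam * ξ * (ν * dw)| ≤ 2 * s * lam * ξ * (M * (2 * M * a)) := by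
        rw [abs_mul, abs_of_nonneg (by positivity : 0 ≤ 2 * s * lam * ξ)]
        gcongr
        exact abs_mul_le_mul hνabs hdwM
      calc |2 * s * ν * lam * ξ * dw| = |2 * s * lam * ξ * (ν * dw)| := by ring_nf
        _ ≤ _ := this
        _ = _ := by ring
    · have hG : |2 * gs + ε| ≤ 5 * M ^ 2 := by
        rw [abs_of_nonneg (by positivity)]; linarith
      have : |s * lam ^ 2 * ξ * (ν * (2 * gs + ε) * w)|
          ≤ s * lam ^ 2 * ξ * (M * (5 * M ^ 2) * b) := by
        rw [abs_mul, abs_of_nonneg (by positivity : 0 ≤ s * lam ^ 2 * ξ)]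
        gcongr
        exact abs_mul_le_mul (abs_mul_le_mul hνabs hG) hwb
      calc |s * ν * lam ^ 2 * ξ * (2 * gs + ε) * w|
          = |s * lam ^ 2 * ξ * (ν * (2 * gs + ε) * w)| := by ring_nf
        _ ≤ _ := this
        _ = _ := by ring
  have h2 : |wt| ≤ M * |σ * wt| := by
    rw [abs_mul, abs_of_pos hσ0, ← mul_assoc]
    exact le_mul_of_one_le_left (abs_nonneg _) hσ1
  have h3 : |wt| ≤ M * (|B| + 4 * M ^ 2 * (s * lam * ξ * a)
      + 5 * M ^ 3 * (s * lam ^ 2 * ξ * b)) := h2.trans (by gcongr)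
  have h4 : |ν * wt * sw| ≤ M * (M * (|B| + 4 * M ^ 2 * (s * lam * ξ * a)
      + 5 * M ^ 3 * (s * lam ^ 2 * ξ * b))) * (2 * M * a) :=
    abs_mul_le_mul (abs_mul_le_mul hνabs h3) hswM
  have h5 : |ν / 2 * σt * a ^ 2| ≤ M / 2 * M * a ^ 2 := by
    refine abs_mul_le_mul (abs_mul_le_mul ?_ hσt) (by rw [abs_of_nonneg (by positivity)])
    rw [abs_of_pos (by positivity)]; linarith
  have h6 : a ^ 2 ≤ D := by
    refine le_trans ?_ B1
    refine le_mul_of_one_le_left (by positivity) ?_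
    exact one_le_mul_of_one_le_of_one_le (one_le_mul_of_one_le_of_one_le hs1 hl1) hξ
  have h7 : s * lam ^ 2 * ξ * (a * b) ≤ D := by
    refine le_trans ?_ B2
    have : lam ^ 2 ≤ lam ^ 3 := pow_le_pow_right₀ hl1 (by norm_num)
    gcongr
  have h8 : 2 * M ^ 3 * a * |B| ≤ B ^ 2 / 2 + 2 * M ^ 6 * a ^ 2 := by
    have := sq_nonneg (|B| - 2 * M ^ 3 * a)
    nlinarith [sq_abs B]
  have e1 : -ν * wt * sw = -(ν * wt * sw) := by ring
  have h9 : |-ν * wt * sw| ≤ M * (M * (|B| + 4 * M ^ 2 * (s * lam * ξ * a)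
      + 5 * M ^ 3 * (s * lam ^ 2 * ξ * b))) * (2 * M * a) := by
    rw [e1, abs_neg]; exact h4
  refine (abs_add_le_add h9 h5).trans ?_
  have e2 : M * (M * (|B| + 4 * M ^ 2 * (s * lam * ξ * a)
      + 5 * M ^ 3 * (s * lam ^ 2 * ξ * b))) * (2 * M * a) + M / 2 * M * a ^ 2
      = 2 * M ^ 3 * a * |B| + 8 * (M ^ 5 * (s * lam * ξ * a ^ 2))
        + 10 * (M ^ 6 * (s * lam ^ 2 * ξ * (a * b))) + (M ^ 2 * a ^ 2) / 2 := by ring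
  rw [e2]
  have g1 : M ^ 5 * (s * lam * ξ * a ^ 2) ≤ M ^ 8 * D :=
    (mul_le_mul_of_nonneg_left B1 (by positivity)).trans (hMD 5 (by norm_num))
  have g2 : M ^ 6 * (s * lam ^ 2 * ξ * (a * b)) ≤ M ^ 8 * D :=
    (mul_le_mul_of_nonneg_left h7 (by positivity)).trans (hMD 6 (by norm_num))
  have g3 : M ^ 2 * a ^ 2 ≤ M ^ 8 * D :=
    (mul_le_mul_of_nonneg_left h6 (by positivity)).trans (hMD 2 (by norm_num))
  have g4 : M ^ 6 * a ^ 2 ≤ M ^ 8 * D :=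
    (mul_le_mul_of_nonneg_left h6 (by positivity)).trans (hMD 6 (by norm_num))
  have g5 : 0 ≤ M ^ 8 * D := by positivity
  linarith only [h8, g1, g2, g3, g4, g5]

/-- The term with the second derivatives of `ψ` applied to `∇w`. -/
theorem abs_hessian_term_le {hess lap : ℝ}
    (hM : 1 ≤ M) (hs1 : 1 ≤ s) (hl1 : 1 ≤ lam) (hξ : 1 ≤ ξ) (hν0 : 0 < ν) (hν : ν ≤ M)
    (hD0 : 0 ≤ D) (hhessM : |hess| ≤ 4 * M * a ^ 2) (hlapM : |lap| ≤ 2 * M)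
    (B1 : s * lam * ξ * a ^ 2 ≤ D) :
    |(s * ν ^ 2 * lam) * ξ * (2 * hess - lap * a ^ 2)| ≤ 10 * M ^ 8 * D := by
  have hM0 : 0 < M := by linarith
  have hs0 : 0 < s := by linarith
  have hl0 : 0 < lam := by linarith
  have hξ0 : 0 < ξ := by linarith
  have hMD : ∀ k : ℕ, k ≤ 8 → M ^ k * D ≤ M ^ 8 * D := fun k hk =>
    mul_le_mul_of_nonneg_right (pow_le_pow_right₀ hM hk) hD0
  have hν2 : ν ^ 2 ≤ M ^ 2 := by gcongr
  have htwo : |(2 : ℝ)| ≤ 2 := by norm_num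
  have h1 : |2 * hess - lap * a ^ 2| ≤ 10 * M * a ^ 2 := by
    rw [sub_eq_add_neg]
    refine (abs_add_le_add (abs_mul_le_mul htwo hhessM) (B := 2 * M * a ^ 2) ?_).trans_eq (by ring)
    rw [abs_neg]
    exact abs_mul_le_mul hlapM (by rw [abs_of_nonneg (by positivity)])
  have h2 : |(s * ν ^ 2 * lam) * ξ * (2 * hess - lap * a ^ 2)|
      ≤ (s * M ^ 2 * lam) * ξ * (10 * M * a ^ 2) := by
    refine abs_mul_le_mul ?_ h1
    rw [abs_of_nonneg (by positivity)]
    gcongr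
  refine h2.trans ?_
  have g1 : M ^ 3 * (s * lam * ξ * a ^ 2) ≤ M ^ 8 * D :=
    (mul_le_mul_of_nonneg_left B1 (by positivity)).trans (hMD 3 (by norm_num))
  linarith only [g1]

/-- The term that is bilinear in `w` and `∇w`. -/
theorem abs_mixed_term_le {w w₁ w₂ gs dw k₁ k₂ : ℝ}
    (hM : 1 ≤ M) (hs1 : 1 ≤ s) (hl1 : 1 ≤ lam) (hξ : 1 ≤ ξ) (hν0 : 0 < ν) (hν : ν ≤ M)
    (hD0 : 0 ≤ D) (hε0 : 0 < ε) (hε : ε ≤ 1) (ha0 : 0 ≤ a) (hwb : |w| ≤ b)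
    (hw1 : |w₁| ≤ a) (hw2 : |w₂| ≤ a) (hgs0 : 0 ≤ gs) (hgsM : gs ≤ 2 * M ^ 2)
    (hdwM : |dw| ≤ 2 * M * a) (hk₁M : |k₁| ≤ 2 * M ^ 2)
    (hk₂M : |k₂| ≤ 2 * M ^ 2) (B2 : s * lam ^ 3 * ξ * (a * b) ≤ D) :
    |(s * ν ^ 2 * lam) * lam * ξ * w * (lam * (2 * gs + ε) * dw
      + 4 * (k₁ * w₁ + k₂ * w₂))| ≤ 26 * M ^ 8 * D := by
  have hM0 : 0 < M := by linarith
  have hs0 : 0 < s := by linarith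
  have hl0 : 0 < lam := by linarith
  have hξ0 : 0 < ξ := by linarith
  have hMD : ∀ k : ℕ, k ≤ 8 → M ^ k * D ≤ M ^ 8 * D := fun k hk =>
    mul_le_mul_of_nonneg_right (pow_le_pow_right₀ hM hk) hD0
  have hν2 : ν ^ 2 ≤ M ^ 2 := by gcongr
  have hM2 : 1 ≤ M ^ 2 := one_le_pow₀ hM
  have hG : |2 * gs + ε| ≤ 5 * M ^ 2 := by
    rw [abs_of_nonneg (by positivity)]; linarith
  have hlabs : |lam| ≤ lam := by rw [abs_of_pos hl0]
  have h1 : |lam * (2 * gs + ε) * dw + 4 * (k₁ * w₁ + k₂ * w₂)| ≤ 26 * M ^ 3 * (lam * a) := by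
    refine (abs_add_le_add (abs_mul_le_mul (abs_mul_le_mul hlabs hG) hdwM)
      (abs_mul_le_mul (by norm_num : |(4 : ℝ)| ≤ 4)
        (abs_add_le_add (abs_mul_le_mul hk₁M hw1) (abs_mul_le_mul hk₂M hw2)))).trans ?_
    have g : M ^ 2 * a ≤ M ^ 3 * (lam * a) := by
      have g1 : M ^ 2 ≤ M ^ 3 := pow_le_pow_right₀ hM (by norm_num)
      have g2 : a ≤ lam * a := le_mul_of_one_le_left ha0 hl1
      gcongr
    linarith only [g]
  have h2 : |(s * ν ^ 2 * lam) * lam * ξ * w * (lam * (2 * gs + ε) * dw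
      + 4 * (k₁ * w₁ + k₂ * w₂))| ≤ (s * M ^ 2 * lam) * lam * ξ * b * (26 * M ^ 3 * (lam * a)) := by
    refine abs_mul_le_mul (abs_mul_le_mul ?_ hwb) h1
    rw [abs_of_nonneg (by positivity)]
    gcongr
  refine h2.trans ?_
  have g1 : M ^ 5 * (s * lam ^ 3 * ξ * (a * b)) ≤ M ^ 8 * D :=
    (mul_le_mul_of_nonneg_left B2 (by positivity)).trans (hMD 5 (by norm_num))
  linarith only [g1]

/-- The term with the time derivative of `σ ξ² |∇ψ|²`. Only the upper bound for `t₁ = θ' e^{λψ}` is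
used: a large negative `θ'` is harmless here. -/
theorem time_weight_term_le {σ σt ψt t₁ gs pt : ℝ}
    (hM : 1 ≤ M) (hs1 : 1 ≤ s) (hl1 : 1 ≤ lam) (hξ : 1 ≤ ξ) (hν0 : 0 < ν) (hν : ν ≤ M)
    (hD0 : 0 ≤ D) (hσ0 : 0 < σ) (hσM : |σ| ≤ M) (hσt : |σt| ≤ M) (hψt : |ψt| ≤ M)
    (ht₁ : t₁ ≤ M * ξ ^ 2)
    (hgs0 : 0 ≤ gs) (hgsM : gs ≤ 2 * M ^ 2) (hptM : |pt| ≤ 2 * M ^ 2)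
    (hB3 : s ^ 2 * lam ^ 3 * ξ ^ 3 * b ^ 2 ≤ D) :
    s ^ 2 * ν * lam ^ 2 / 2 * (σt * ξ ^ 2 * gs + 2 * σ * ξ * (t₁ + lam * ξ * ψt) * gs
      + σ * ξ ^ 2 * (2 * pt)) * b ^ 2 ≤ 7 * M ^ 8 * D := by
  have hM0 : 0 < M := by linarith
  have hs0 : 0 < s := by linarith
  have hl0 : 0 < lam := by linarith
  have hξ0 : 0 < ξ := by linarith
  have hMD : ∀ k : ℕ, k ≤ 8 → M ^ k * D ≤ M ^ 8 * D := fun k hk =>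
    mul_le_mul_of_nonneg_right (pow_le_pow_right₀ hM hk) hD0
  have hσle : σ ≤ M := (le_abs_self _).trans hσM
  have htwo : |(2 : ℝ)| ≤ 2 := by norm_num
  have hgsabs : |gs| ≤ 2 * M ^ 2 := by rwa [abs_of_nonneg hgs0]
  have hξ23 : ξ ^ 2 ≤ lam * ξ ^ 3 := by
    have : ξ ^ 2 ≤ ξ ^ 3 := pow_le_pow_right₀ hξ (by norm_num)
    exact this.trans (le_mul_of_one_le_left (by positivity) hl1)
  have h1 : σt * ξ ^ 2 * gs ≤ M * ξ ^ 2 * (2 * M ^ 2) := by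
    refine (le_abs_self _).trans (abs_mul_le_mul (abs_mul_le_mul hσt ?_) hgsabs)
    rw [abs_of_nonneg (by positivity)]
  have h2 : t₁ + lam * ξ * ψt ≤ 2 * M * (lam * ξ ^ 2) := by
    have g1 : lam * ξ * ψt ≤ lam * ξ * M := by gcongr; exact (le_abs_self _).trans hψt
    have g2 : lam * ξ * M ≤ M * (lam * ξ ^ 2) := by
      have : ξ ≤ ξ ^ 2 := le_self_pow₀ hξ (by norm_num)
      have : lam * ξ ≤ lam * ξ ^ 2 := by gcongr
      have := mul_le_mul_of_nonneg_left this hM0.le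
      linarith only [this]
    have g3 : M * ξ ^ 2 ≤ M * (lam * ξ ^ 2) := by
      gcongr; exact le_mul_of_one_le_left (by positivity) hl1
    linarith only [g1, g2, g3, ht₁]
  have h3 : 2 * σ * ξ * (t₁ + lam * ξ * ψt) * gs ≤ 2 * M * ξ * (2 * M * (lam * ξ ^ 2)) * (2 * M ^ 2) := by
    have g1 : 2 * σ * ξ * (t₁ + lam * ξ * ψt) ≤ 2 * M * ξ * (2 * M * (lam * ξ ^ 2)) := by
      refine (mul_le_mul_of_nonneg_left h2 (by positivity)).trans ?_
      gcongr
    refine (mul_le_mul_of_nonneg_right g1 hgs0).trans ?_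
    gcongr
  have h4 : σ * ξ ^ 2 * (2 * pt) ≤ M * ξ ^ 2 * (2 * (2 * M ^ 2)) := by
    refine (le_abs_self _).trans (abs_mul_le_mul (abs_mul_le_mul hσM ?_)
      (abs_mul_le_mul htwo hptM))
    rw [abs_of_nonneg (by positivity)]
  have h5 : σt * ξ ^ 2 * gs + 2 * σ * ξ * (t₁ + lam * ξ * ψt) * gs + σ * ξ ^ 2 * (2 * pt)
      ≤ 14 * M ^ 4 * (lam * ξ ^ 3) := by
    have g1 : M ^ 3 * ξ ^ 2 ≤ M ^ 4 * (lam * ξ ^ 3) := by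
      have : M ^ 3 ≤ M ^ 4 := pow_le_pow_right₀ hM (by norm_num)
      gcongr
    linarith only [h1, h3, h4, g1]
  calc _ ≤ s ^ 2 * ν * lam ^ 2 / 2 * (14 * M ^ 4 * (lam * ξ ^ 3)) * b ^ 2 := by gcongr
    _ ≤ s ^ 2 * M * lam ^ 2 / 2 * (14 * M ^ 4 * (lam * ξ ^ 3)) * b ^ 2 := by gcongr
    _ = 7 * (M ^ 5 * (s ^ 2 * lam ^ 3 * ξ ^ 3 * b ^ 2)) := by ring
    _ ≤ 7 * (M ^ 8 * D) := by
      have := (mul_le_mul_of_nonneg_left hB3 (by positivity : 0 ≤ M ^ 5)).trans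
        (hMD 5 (by norm_num))
      linarith only [this]
    _ = _ := by ring

/-- The terms of order `s³λ³`, with second derivatives of `ψ`. -/
theorem abs_cubic_term_le {ψ₁ ψ₂ k₁ k₂ gs lap : ℝ}
    (hM : 1 ≤ M) (hs1 : 1 ≤ s) (hl1 : 1 ≤ lam) (hξ : 1 ≤ ξ) (hν0 : 0 < ν) (hν : ν ≤ M)
    (hD0 : 0 ≤ D) (hψ₁ : |ψ₁| ≤ M) (hψ₂ : |ψ₂| ≤ M) (hk₁M : |k₁| ≤ 2 * M ^ 2)
    (hk₂M : |k₂| ≤ 2 * M ^ 2) (hgs0 : 0 ≤ gs) (hgsM : gs ≤ 2 * M ^ 2) (hlapM : |lap| ≤ 2 * M)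
    (B4 : s ^ 3 * lam ^ 3 * ξ ^ 3 * b ^ 2 ≤ D) :
    |s ^ 3 * ν ^ 2 * lam ^ 3 * ξ ^ 3 * (2 * k₁ * ψ₁ + 2 * k₂ * ψ₂ + gs * lap) * b ^ 2|
      ≤ 12 * M ^ 8 * D := by
  have hM0 : 0 < M := by linarith
  have hs0 : 0 < s := by linarith
  have hl0 : 0 < lam := by linarith
  have hξ0 : 0 < ξ := by linarith
  have hMD : ∀ k : ℕ, k ≤ 8 → M ^ k * D ≤ M ^ 8 * D := fun k hk =>
    mul_le_mul_of_nonneg_right (pow_le_pow_right₀ hM hk) hD0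
  have hν2 : ν ^ 2 ≤ M ^ 2 := by gcongr
  have htwo : |(2 : ℝ)| ≤ 2 := by norm_num
  have hgsabs : |gs| ≤ 2 * M ^ 2 := by rwa [abs_of_nonneg hgs0]
  have h1 : |2 * k₁ * ψ₁ + 2 * k₂ * ψ₂ + gs * lap| ≤ 12 * M ^ 3 :=
    (abs_add_le_add (abs_add_le_add (abs_mul_le_mul (abs_mul_le_mul htwo hk₁M) hψ₁)
      (abs_mul_le_mul (abs_mul_le_mul htwo hk₂M) hψ₂)) (abs_mul_le_mul hgsabs hlapM)).trans_eq
      (by ring)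
  have h2 : |s ^ 3 * ν ^ 2 * lam ^ 3 * ξ ^ 3 * (2 * k₁ * ψ₁ + 2 * k₂ * ψ₂ + gs * lap) * b ^ 2|
      ≤ s ^ 3 * M ^ 2 * lam ^ 3 * ξ ^ 3 * (12 * M ^ 3) * b ^ 2 := by
    refine abs_mul_le_mul (abs_mul_le_mul ?_ h1) (by rw [abs_of_nonneg (by positivity)])
    rw [abs_of_nonneg (by positivity)]
    gcongr
  refine h2.trans ?_
  have g1 : M ^ 5 * (s ^ 3 * lam ^ 3 * ξ ^ 3 * b ^ 2) ≤ M ^ 8 * D :=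
    (mul_le_mul_of_nonneg_left B4 (by positivity)).trans (hMD 5 (by norm_num))
  linarith only [g1]

theorem abs_phi_time_deriv_le {N P ψt : ℝ} (hM : 1 ≤ M) (hl1 : 1 ≤ lam) (hξ : 1 ≤ ξ)
    (hψt : |ψt| ≤ M) (hN : 0 ≤ N) (hP : 0 ≤ P) (hP' : P ≤ M * (lam * ξ ^ 2)) :
    |-N + P - lam * ξ * ψt| ≤ N + 2 * M * (lam * ξ ^ 2) := by
  have hM0 : 0 < M := by linarith
  have hl0 : 0 < lam := by linarith
  have hξ0 : 0 < ξ := by linarith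
  have h1 : |lam * ξ * ψt| ≤ M * (lam * ξ ^ 2) := by
    rw [abs_mul, abs_of_nonneg (by positivity : 0 ≤ lam * ξ)]
    have : ξ ≤ ξ ^ 2 := le_self_pow₀ hξ (by norm_num)
    calc lam * ξ * |ψt| ≤ lam * ξ ^ 2 * M := by gcongr
      _ = _ := by ring
  have h2 := abs_le.mp h1
  rw [abs_le]
  constructor <;> linarith only [h2.1, h2.2, hN, hP, hP']

/-- The term with the time derivative of `σ² ∂ₜφ`. -/
theorem abs_second_time_term_le {N ψt ψtt σ σt t₁ T₂ q : ℝ}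
    (hM : 1 ≤ M) (hs1 : 1 ≤ s) (hl1 : 1 ≤ lam) (hξ : 1 ≤ ξ) (hD0 : 0 ≤ D)
    (hσM : |σ| ≤ M) (hσt : |σt| ≤ M) (hψt : |ψt| ≤ M) (hψtt : |ψtt| ≤ M)
    (ht₁' : |t₁| ≤ M * (s * lam ^ 2 * ξ ^ 2)) (hN : 0 ≤ N)
    (hT₂ : |T₂| ≤ M * (s ^ 2 * lam ^ 3 * ξ ^ 3)) (hq : |q| ≤ N + 2 * M * (lam * ξ ^ 2))
    (B4 : s ^ 3 * lam ^ 3 * ξ ^ 3 * b ^ 2 ≤ D) (B6 : s ^ 2 * lam * ξ * N * b ^ 2 ≤ D) :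
    |s / 2 * (2 * σ * σt * q + σ ^ 2 *
      (T₂ - 2 * lam * t₁ * ψt - lam ^ 2 * ξ * ψt ^ 2 - lam * ξ * ψtt)) * b ^ 2|
      ≤ 6 * M ^ 8 * D := by
  have hM0 : 0 < M := by linarith
  have hs0 : 0 < s := by linarith
  have hl0 : 0 < lam := by linarith
  have hξ0 : 0 < ξ := by linarith
  have hMD : ∀ k : ℕ, k ≤ 8 → M ^ k * D ≤ M ^ 8 * D := fun k hk =>
    mul_le_mul_of_nonneg_right (pow_le_pow_right₀ hM hk) hD0
  have htwo : |(2 : ℝ)| ≤ 2 := by norm_num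
  have hNb : s * N * b ^ 2 ≤ D := by
    refine le_trans ?_ B6
    have : s ≤ s ^ 2 * lam * ξ := by
      have h1 : s ≤ s ^ 2 := le_self_pow₀ hs1 (by norm_num)
      have h2 : s ^ 2 ≤ s ^ 2 * (lam * ξ) :=
        le_mul_of_one_le_right (by positivity) (one_le_mul_of_one_le_of_one_le hl1 hξ)
      linarith
    gcongr
  have hlabs : |lam| ≤ lam := by rw [abs_of_pos hl0]
  have hqt : |T₂ - 2 * lam * t₁ * ψt - lam ^ 2 * ξ * ψt ^ 2 - lam * ξ * ψtt|
      ≤ 5 * M ^ 2 * (s ^ 2 * lam ^ 3 * ξ ^ 3) := by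
    have g1 : |2 * lam * t₁ * ψt| ≤ 2 * lam * (M * (s * lam ^ 2 * ξ ^ 2)) * M :=
      abs_mul_le_mul (abs_mul_le_mul (abs_mul_le_mul htwo hlabs) ht₁') hψt
    have g2 : |lam ^ 2 * ξ * ψt ^ 2| ≤ lam ^ 2 * ξ * M ^ 2 := by
      refine abs_mul_le_mul (by rw [abs_of_nonneg (by positivity)]) ?_
      rw [abs_pow]; gcongr
    have g3 : |lam * ξ * ψtt| ≤ lam * ξ * M :=
      abs_mul_le_mul (by rw [abs_of_nonneg (by positivity)]) hψtt
    have c1 : s * lam ^ 3 * ξ ^ 2 ≤ s ^ 2 * lam ^ 3 * ξ ^ 3 := by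
      have : s ≤ s ^ 2 := le_self_pow₀ hs1 (by norm_num)
      gcongr; norm_num
    have c2 : lam ^ 2 * ξ ≤ s ^ 2 * lam ^ 3 * ξ ^ 3 := by
      have h1 : 1 ≤ s ^ 2 := one_le_pow₀ hs1
      have h2 : lam ^ 2 ≤ lam ^ 3 := pow_le_pow_right₀ hl1 (by norm_num)
      have h3 : ξ ≤ ξ ^ 3 := le_self_pow₀ hξ (by norm_num)
      calc lam ^ 2 * ξ = 1 * lam ^ 2 * ξ := by ring
        _ ≤ _ := by gcongr
    have c3 : lam * ξ ≤ s ^ 2 * lam ^ 3 * ξ ^ 3 := by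
      refine le_trans ?_ c2
      have : lam ≤ lam ^ 2 := le_self_pow₀ hl1 (by norm_num)
      gcongr
    have c0 : M ≤ M ^ 2 := le_self_pow₀ hM (by norm_num)
    have d0 := mul_le_mul_of_nonneg_right c0 (by positivity : 0 ≤ s ^ 2 * lam ^ 3 * ξ ^ 3)
    have d1 := mul_le_mul_of_nonneg_left c1 (by positivity : 0 ≤ M ^ 2)
    have d2 := mul_le_mul_of_nonneg_left c2 (by positivity : 0 ≤ M ^ 2)
    have d3 := mul_le_mul_of_nonneg_left c3 (by positivity : 0 ≤ M)
    have a0 := abs_le.mp hT₂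
    have a1 := abs_le.mp g1
    have a2 := abs_le.mp g2
    have a3 := abs_le.mp g3
    rw [abs_le]
    constructor <;> linarith only [a0.1, a0.2, a1.1, a1.2, a2.1, a2.2, a3.1, a3.2, d0, d1, d2, d3]
  have h1 : |2 * σ * σt * q + σ ^ 2 *
    (T₂ - 2 * lam * t₁ * ψt - lam ^ 2 * ξ * ψt ^ 2 - lam * ξ * ψtt)|
      ≤ 2 * M * M * (N + 2 * M * (lam * ξ ^ 2)) + M ^ 2 * (5 * M ^ 2 * (s ^ 2 * lam ^ 3 * ξ ^ 3)) := by
    refine abs_add_le_add (abs_mul_le_mul (abs_mul_le_mul (abs_mul_le_mul htwo hσM) hσt) hq)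
      (abs_mul_le_mul ?_ hqt)
    rw [abs_pow]; gcongr
  have h2 := abs_mul_le_mul (abs_mul_le_mul (A := s / 2) (x := s / 2)
    (by rw [abs_of_nonneg (by positivity)]) h1) (x := _) (y := b ^ 2) (B := b ^ 2)
    (by rw [abs_of_nonneg (by positivity)])
  refine h2.trans ?_
  have c1 : s * lam * ξ ^ 2 * b ^ 2 ≤ D := by
    refine le_trans ?_ B4
    have h1 : s ≤ s ^ 3 := le_self_pow₀ hs1 (by norm_num)
    have h2 : lam ≤ lam ^ 3 := le_self_pow₀ hl1 (by norm_num)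
    have h3 : ξ ^ 2 ≤ ξ ^ 3 := pow_le_pow_right₀ hξ (by norm_num)
    gcongr
  have g1 := (mul_le_mul_of_nonneg_left hNb (by positivity : 0 ≤ M ^ 2)).trans
    (hMD 2 (by norm_num))
  have g2 := (mul_le_mul_of_nonneg_left c1 (by positivity : 0 ≤ M ^ 3)).trans
    (hMD 3 (by norm_num))
  have g3 := (mul_le_mul_of_nonneg_left B4 (by positivity : 0 ≤ M ^ 4)).trans
    (hMD 4 (by norm_num))
  have g4 : 0 ≤ M ^ 8 * D := by positivity
  linarith only [g1, g2, g3, g4]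

/-- The terms with `∂ₜφ` and its gradient. The negative part `N` of `θ' E` enters with a favourable
sign, and this good term absorbs the other occurrences of `N`. -/
theorem phi_time_deriv_term_ge {N P ψt σ t₁ ψ₁ ψ₂ ψt₁ ψt₂ gs lap sp pt : ℝ}
    (hM : 1 ≤ M) (hs1 : 1 ≤ s) (hl1 : 1 ≤ lam) (hξ : 1 ≤ ξ) (hν0 : 0 < ν) (hν : ν ≤ M)
    (hD0 : 0 ≤ D) (hε0 : 0 < ε) (hε : ε ≤ 1) (hσ0 : 0 < σ) (hσM : |σ| ≤ M) (hψt : |ψt| ≤ M)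
    (ht₁ : t₁ ≤ M * ξ ^ 2) (hN : 0 ≤ N) (hP' : P ≤ M * (lam * ξ ^ 2))
    (hq : |-N + P - lam * ξ * ψt| ≤ N + 2 * M * (lam * ξ ^ 2))
    (hgs : gs = ψ₁ ^ 2 + ψ₂ ^ 2) (hpt : pt = ψ₁ * ψt₁ + ψ₂ * ψt₂) (hgsM : gs ≤ 2 * M ^ 2)
    (hlapM : |lap| ≤ 2 * M) (hspM : |sp| ≤ 2 * M ^ 2) (hptM : |pt| ≤ 2 * M ^ 2)
    (hB3 : s ^ 2 * lam ^ 3 * ξ ^ 3 * b ^ 2 ≤ D) (B6 : s ^ 2 * lam * ξ * N * b ^ 2 ≤ D) :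
    ν * σ * ε * (s ^ 2 * lam ^ 2 * ξ * N * b ^ 2) - 24 * M ^ 8 * D ≤
      s ^ 2 * ν * lam * ξ * (-(lam * σ * (-N + P - lam * ξ * ψt) * (gs + ε))
        + σ * (-N + P - lam * ξ * ψt) * lap + (-N + P - lam * ξ * ψt) * sp
        + σ * ((-(lam * t₁ * ψ₁) - lam * (lam * ξ * ψ₁ * ψt + ξ * ψt₁)) * ψ₁
          + (-(lam * t₁ * ψ₂) - lam * (lam * ξ * ψ₂ * ψt + ξ * ψt₂)) * ψ₂)) * b ^ 2 := by
  have hM0 : 0 < M := by linarith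
  have hs0 : 0 < s := by linarith
  have hl0 : 0 < lam := by linarith
  have hξ0 : 0 < ξ := by linarith
  have hMD : ∀ k : ℕ, k ≤ 8 → M ^ k * D ≤ M ^ 8 * D := fun k hk =>
    mul_le_mul_of_nonneg_right (pow_le_pow_right₀ hM hk) hD0
  have hM2 : 1 ≤ M ^ 2 := one_le_pow₀ hM
  have hσle : σ ≤ M := (le_abs_self _).trans hσM
  have hgs0 : 0 ≤ gs := by rw [hgs]; positivity
  have hgsabs : |gs| ≤ 2 * M ^ 2 := by rwa [abs_of_nonneg hgs0]
  set qq := -N + P - lam * ξ * ψt with hqq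
  have hξξ : ξ ≤ ξ ^ 2 := le_self_pow₀ hξ (by norm_num)
  have h1 : lam * σ * N * ε - 6 * M ^ 4 * (lam ^ 2 * ξ ^ 2) ≤ -(lam * σ * qq * (gs + ε)) := by
    have hr0 : P - lam * ξ * ψt ≤ 2 * M * (lam * ξ ^ 2) := by
      have g1 : -(lam * ξ * ψt) ≤ lam * ξ ^ 2 * M := by
        have : -(lam * ξ * ψt) = lam * ξ * (-ψt) := by ring
        rw [this]
        have g : -ψt ≤ M := by linarith [(abs_le.mp hψt).1]
        calc lam * ξ * (-ψt) ≤ lam * ξ * M := by gcongr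
          _ ≤ _ := by gcongr
      linarith only [g1, hP']
    have g2 : lam * σ * (P - lam * ξ * ψt) * (gs + ε)
        ≤ lam * M * (2 * M * (lam * ξ ^ 2)) * (3 * M ^ 2) := by
      have g3 : lam * σ * (P - lam * ξ * ψt) ≤ lam * M * (2 * M * (lam * ξ ^ 2)) := by
        refine (mul_le_mul_of_nonneg_left hr0 (by positivity)).trans ?_
        gcongr
      refine (mul_le_mul_of_nonneg_right g3 (by positivity)).trans ?_
      have : gs + ε ≤ 3 * M ^ 2 := by linarith
      gcongr
    have g4 : 0 ≤ lam * σ * N * gs := by positivity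
    rw [hqq]
    linarith only [g2, g4]
  have h2 : |σ * qq * lap + qq * sp| ≤ 4 * M ^ 2 * (N + 2 * M * (lam * ξ ^ 2)) :=
    (abs_add_le_add (abs_mul_le_mul (abs_mul_le_mul hσM hq) hlapM)
      (abs_mul_le_mul hq hspM)).trans_eq (by ring)
  have h3 : -(6 * M ^ 4 * (lam ^ 2 * ξ ^ 2)) ≤
      σ * ((-(lam * t₁ * ψ₁) - lam * (lam * ξ * ψ₁ * ψt + ξ * ψt₁)) * ψ₁
        + (-(lam * t₁ * ψ₂) - lam * (lam * ξ * ψ₂ * ψt + ξ * ψt₂)) * ψ₂) := by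
    have e : (-(lam * t₁ * ψ₁) - lam * (lam * ξ * ψ₁ * ψt + ξ * ψt₁)) * ψ₁
        + (-(lam * t₁ * ψ₂) - lam * (lam * ξ * ψ₂ * ψt + ξ * ψt₂)) * ψ₂
        = -(lam * gs * t₁ + lam ^ 2 * ξ * (gs * ψt) + lam * ξ * pt) := by
      rw [hgs, hpt]; ring
    rw [e]
    have g1 : lam * gs * t₁ ≤ 2 * M ^ 3 * (lam ^ 2 * ξ ^ 2) := by
      have c1 : lam * gs * t₁ ≤ lam * gs * (M * ξ ^ 2) := by gcongr
      have c2 : lam * gs * (M * ξ ^ 2) ≤ lam * (2 * M ^ 2) * (M * ξ ^ 2) := by gcongr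
      have c3 : lam ≤ lam ^ 2 := le_self_pow₀ hl1 (by norm_num)
      have c4 : lam * ξ ^ 2 ≤ lam ^ 2 * ξ ^ 2 := by gcongr
      have c5 := mul_le_mul_of_nonneg_left c4 (by positivity : 0 ≤ M ^ 3)
      linarith only [c1, c2, c5]
    have g2 : lam ^ 2 * ξ * (gs * ψt) ≤ 2 * M ^ 3 * (lam ^ 2 * ξ ^ 2) := by
      have c1 := (le_abs_self _).trans (abs_mul_le_mul hgsabs hψt)
      calc lam ^ 2 * ξ * (gs * ψt) ≤ lam ^ 2 * ξ * (2 * M ^ 2 * M) := by gcongr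
        _ ≤ lam ^ 2 * ξ ^ 2 * (2 * M ^ 2 * M) := by gcongr
        _ = _ := by ring
    have g3 : lam * ξ * pt ≤ 2 * M ^ 3 * (lam ^ 2 * ξ ^ 2) := by
      have c1 := (le_abs_self _).trans hptM
      have c3 : lam ≤ lam ^ 2 := le_self_pow₀ hl1 (by norm_num)
      have c4 : M ^ 2 ≤ M ^ 3 := pow_le_pow_right₀ hM (by norm_num)
      calc lam * ξ * pt ≤ lam * ξ * (2 * M ^ 2) := by gcongr
        _ ≤ lam ^ 2 * ξ ^ 2 * (2 * M ^ 3) := by gcongr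
        _ = _ := by ring
    have g4 : lam * gs * t₁ + lam ^ 2 * ξ * (gs * ψt) + lam * ξ * pt
        ≤ 6 * M ^ 3 * (lam ^ 2 * ξ ^ 2) := by linarith only [g1, g2, g3]
    have g5 : σ * (lam * gs * t₁ + lam ^ 2 * ξ * (gs * ψt) + lam * ξ * pt)
        ≤ M * (6 * M ^ 3 * (lam ^ 2 * ξ ^ 2)) := by
      refine (mul_le_mul_of_nonneg_left g4 hσ0.le).trans ?_
      gcongr
    linarith only [g5]
  have h4 : lam * σ * N * ε - 12 * M ^ 4 * (lam ^ 2 * ξ ^ 2)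
      - 4 * M ^ 2 * (N + 2 * M * (lam * ξ ^ 2)) ≤
      -(lam * σ * qq * (gs + ε)) + σ * qq * lap + qq * sp
      + σ * ((-(lam * t₁ * ψ₁) - lam * (lam * ξ * ψ₁ * ψt + ξ * ψt₁)) * ψ₁
        + (-(lam * t₁ * ψ₂) - lam * (lam * ξ * ψ₂ * ψt + ξ * ψt₂)) * ψ₂) := by
    have := (abs_le.mp h2).1
    linarith only [this, h1, h3]
  have hpos : 0 ≤ s ^ 2 * ν * lam * ξ * b ^ 2 := by positivity
  have h5 := mul_le_mul_of_nonneg_left h4 hpos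
  have c0 : s ^ 2 * lam ^ 2 * ξ ^ 3 * b ^ 2 ≤ D := by
    refine le_trans ?_ hB3
    gcongr
    norm_num
  have h6 : ν * (12 * M ^ 4 * (s ^ 2 * lam ^ 3 * ξ ^ 3 * b ^ 2)
      + 4 * M ^ 2 * (s ^ 2 * lam * ξ * N * b ^ 2) + 8 * M ^ 3 * (s ^ 2 * lam ^ 2 * ξ ^ 3 * b ^ 2))
      ≤ M * (12 * M ^ 4 * D + 4 * M ^ 2 * D + 8 * M ^ 3 * D) := by
    gcongr
  have g1 := hMD 5 (by norm_num)
  have g2 := hMD 3 (by norm_num)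
  have g3 := hMD 4 (by norm_num)
  linarith only [h5, h6, g1, g2, g3]

end

set_option maxHeartbeats 800000 in
/-- Coercivity of the remainder form up to lower-order terms. Here `t₁ = θ' e^{λψ}`,
`-N + P = θ' E` is the splitting into negative and positive part, and `T₂ = θ'' E`, where
`E = λ e^{6λ(m+1)} - e^{λψ}`. -/
theorem remainderForm_ge {M r ν s lam ε ξ t₁ N P T₂ σ σt σ₁ σ₂ ψt ψtt ψ₁ ψ₂ ψ₁₁ ψ₁₂ ψ₂₂ ψt₁ ψt₂
      w wt w₁ w₂ : ℝ}
    (hM : 1 ≤ M) (hr : 1 ≤ r) (hs : r ≤ s) (hl : r ≤ lam) (hξ : 1 ≤ ξ)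
    (hν0 : 0 < ν) (hν : ν ≤ M) (hε0 : 0 < ε) (hε : ε ≤ 1)
    (hσM : |σ| ≤ M) (hσ1 : 1 ≤ M * σ) (hσt : |σt| ≤ M) (hσ₁ : |σ₁| ≤ M) (hσ₂ : |σ₂| ≤ M)
    (hψt : |ψt| ≤ M) (hψtt : |ψtt| ≤ M) (hψ₁ : |ψ₁| ≤ M) (hψ₂ : |ψ₂| ≤ M)
    (hψ₁₁ : |ψ₁₁| ≤ M) (hψ₁₂ : |ψ₁₂| ≤ M) (hψ₂₂ : |ψ₂₂| ≤ M) (hψt₁ : |ψt₁| ≤ M) (hψt₂ : |ψt₂| ≤ M)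
    (ht₁ : t₁ ≤ M * ξ ^ 2) (ht₁' : |t₁| ≤ M * (s * lam ^ 2 * ξ ^ 2))
    (hN : 0 ≤ N) (hP : 0 ≤ P) (hP' : P ≤ M * (lam * ξ ^ 2))
    (hT₂ : |T₂| ≤ M * (s ^ 2 * lam ^ 3 * ξ ^ 3)) :
    ν ^ 2 * ε * (s * lam ^ 2 * ξ * (w₁ ^ 2 + w₂ ^ 2))
      + ν ^ 2 * ((ψ₁ ^ 2 + ψ₂ ^ 2) * (ψ₁ ^ 2 + ψ₂ ^ 2 - ε)) * (s ^ 3 * lam ^ 4 * ξ ^ 3 * w ^ 2)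
      + ν * σ * ε * (s ^ 2 * lam ^ 2 * ξ * N * w ^ 2)
      - 110 * M ^ 8 * ((s * lam ^ 2 * ξ * (w₁ ^ 2 + w₂ ^ 2) + s ^ 3 * lam ^ 4 * ξ ^ 3 * w ^ 2
        + s ^ 2 * lam ^ 2 * ξ * N * w ^ 2) / r)
    ≤ remainderForm ν s lam ε ξ (t₁ + lam * ξ * ψt) (-N + P - lam * ξ * ψt)
        (T₂ - 2 * lam * t₁ * ψt - lam ^ 2 * ξ * ψt ^ 2 - lam * ξ * ψtt)
        (-(lam * t₁ * ψ₁) - lam * (lam * ξ * ψ₁ * ψt + ξ * ψt₁))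
        (-(lam * t₁ * ψ₂) - lam * (lam * ξ * ψ₂ * ψt + ξ * ψt₂))
        σ σt σ₁ σ₂ ψ₁ ψ₂ ψ₁₁ ψ₁₂ ψ₂₂ ψt₁ ψt₂ w wt w₁ w₂
      + skewPart ν s lam ε ξ σ ψ₁ ψ₂ w wt w₁ w₂ ^ 2 / 2 := by
  have hs1 : 1 ≤ s := hr.trans hs
  have hl1 : 1 ≤ lam := hr.trans hl
  have hM0 : 0 < M := by linarith
  have hs0 : 0 < s := by linarith
  have hl0 : 0 < lam := by linarith
  have hξ0 : 0 < ξ := by linarith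
  obtain ⟨a, ha0, ha⟩ : ∃ a : ℝ, 0 ≤ a ∧ w₁ ^ 2 + w₂ ^ 2 = a ^ 2 :=
    ⟨√(w₁ ^ 2 + w₂ ^ 2), Real.sqrt_nonneg _, (Real.sq_sqrt (by positivity)).symm⟩
  obtain ⟨b, hb0, hwb, hb⟩ : ∃ b : ℝ, 0 ≤ b ∧ |w| ≤ b ∧ w ^ 2 = b ^ 2 :=
    ⟨|w|, abs_nonneg _, le_rfl, (sq_abs w).symm⟩
  have hw1 : |w₁| ≤ a := abs_le_of_sq_le_sq (by nlinarith) ha0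
  have hw2 : |w₂| ≤ a := abs_le_of_sq_le_sq (by nlinarith) ha0
  set B := skewPart ν s lam ε ξ σ ψ₁ ψ₂ w wt w₁ w₂ with hBdef
  set D := (s * lam ^ 2 * ξ * (w₁ ^ 2 + w₂ ^ 2) + s ^ 3 * lam ^ 4 * ξ ^ 3 * w ^ 2
        + s ^ 2 * lam ^ 2 * ξ * N * w ^ 2) / r with hD
  obtain ⟨B1, B2, B4, B5, B6⟩ := lower_order_le hr hs hl hξ ha0 hb0 hN (D := D) (by
    rw [hD, ha, hb])
  have hMp : ∀ k : ℕ, k ≤ 8 → M ^ k ≤ M ^ 8 := fun k hk => pow_le_pow_right₀ hM hk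
  have hD0 : 0 ≤ D := le_trans (by positivity) B1
  have hMD : ∀ k : ℕ, k ≤ 8 → M ^ k * D ≤ M ^ 8 * D := fun k hk =>
    mul_le_mul_of_nonneg_right (hMp k hk) hD0
  -- bounds for the coefficients
  set gs := ψ₁ ^ 2 + ψ₂ ^ 2 with hgs
  have hgs0 : 0 ≤ gs := by positivity
  have hgsM : gs ≤ 2 * M ^ 2 := by
    have h1 := sq_le_sq' (abs_le.mp hψ₁).1 (abs_le.mp hψ₁).2
    have h2 := sq_le_sq' (abs_le.mp hψ₂).1 (abs_le.mp hψ₂).2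
    linarith
  have hM2 : 1 ≤ M ^ 2 := one_le_pow₀ hM
  have hσ0 : 0 < σ := by
    by_contra h
    have : M * σ ≤ 0 := mul_nonpos_of_nonneg_of_nonpos hM0.le (not_lt.mp h)
    linarith
  set dw := ψ₁ * w₁ + ψ₂ * w₂ with hdw
  have hdwM : |dw| ≤ 2 * M * a :=
    (abs_add_le_add (abs_mul_le_mul hψ₁ hw1) (abs_mul_le_mul hψ₂ hw2)).trans_eq (by ring)
  set sw := σ₁ * w₁ + σ₂ * w₂ with hsw
  have hswM : |sw| ≤ 2 * M * a :=
    (abs_add_le_add (abs_mul_le_mul hσ₁ hw1) (abs_mul_le_mul hσ₂ hw2)).trans_eq (by ring)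
  set lap := ψ₁₁ + ψ₂₂ with hlap
  have hlapM : |lap| ≤ 2 * M := (abs_add_le_add hψ₁₁ hψ₂₂).trans_eq (by ring)
  have hw11 : |w₁ ^ 2| ≤ a ^ 2 := by rw [abs_pow]; gcongr
  have hw22 : |w₂ ^ 2| ≤ a ^ 2 := by rw [abs_pow]; gcongr
  have hw12 : |w₁ * w₂| ≤ a * a := abs_mul_le_mul hw1 hw2
  set hess := ψ₁₁ * w₁ ^ 2 + 2 * ψ₁₂ * (w₁ * w₂) + ψ₂₂ * w₂ ^ 2 with hhess
  have htwo : |(2 : ℝ)| ≤ 2 := by norm_num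
  have hhessM : |hess| ≤ 4 * M * a ^ 2 :=
    (abs_add_le_add (abs_add_le_add (abs_mul_le_mul hψ₁₁ hw11)
      (abs_mul_le_mul (abs_mul_le_mul htwo hψ₁₂) hw12)) (abs_mul_le_mul hψ₂₂ hw22)).trans_eq
      (by ring)
  set k₁ := ψ₁ * ψ₁₁ + ψ₂ * ψ₁₂ with hk₁
  set k₂ := ψ₁ * ψ₁₂ + ψ₂ * ψ₂₂ with hk₂
  have hk₁M : |k₁| ≤ 2 * M ^ 2 :=
    (abs_add_le_add (abs_mul_le_mul hψ₁ hψ₁₁) (abs_mul_le_mul hψ₂ hψ₁₂)).trans_eq (by ring)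
  have hk₂M : |k₂| ≤ 2 * M ^ 2 :=
    (abs_add_le_add (abs_mul_le_mul hψ₁ hψ₁₂) (abs_mul_le_mul hψ₂ hψ₂₂)).trans_eq (by ring)
  set sp := σ₁ * ψ₁ + σ₂ * ψ₂ with hsp
  have hspM : |sp| ≤ 2 * M ^ 2 :=
    (abs_add_le_add (abs_mul_le_mul hσ₁ hψ₁) (abs_mul_le_mul hσ₂ hψ₂)).trans_eq (by ring)
  set pt := ψ₁ * ψt₁ + ψ₂ * ψt₂ with hpt
  have hptM : |pt| ≤ 2 * M ^ 2 :=
    (abs_add_le_add (abs_mul_le_mul hψ₁ hψt₁) (abs_mul_le_mul hψ₂ hψt₂)).trans_eq (by ring)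
  have hE1 := abs_time_term_le (B := B) hM hs1 hl1 hξ hν0 hν hD0 hε0 hε ha0 hb0 hwb hσ0 hσ1 hσt
    hgs0 hgsM hdwM hswM (wt := wt) (by rw [hBdef]; simp only [skewPart, hdw, hgs]; ring) B1 B2
  have hE2 : ν ^ 2 * ε * (s * lam ^ 2 * ξ * a ^ 2) ≤
      (s * ν ^ 2 * lam) * (2 * lam * ξ * dw ^ 2 + lam * ξ * (gs + ε) * a ^ 2) := by
    have h1 : 0 ≤ (s * ν ^ 2 * lam) * (2 * lam * ξ * dw ^ 2 + lam * ξ * gs * a ^ 2) := by positivity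
    linarith only [h1]
  have hE3 := abs_hessian_term_le hM hs1 hl1 hξ hν0 hν hD0 hhessM hlapM B1
  have hE4 := abs_mixed_term_le hM hs1 hl1 hξ hν0 hν hD0 hε0 hε ha0 hwb hw1 hw2 hgs0 hgsM hdwM
    hk₁M hk₂M B2
  have hB3 : s ^ 2 * lam ^ 3 * ξ ^ 3 * b ^ 2 ≤ D := by
    refine le_trans ?_ B4
    gcongr
    norm_num
  have hE5 := time_weight_term_le hM hs1 hl1 hξ hν0 hν hD0 hσ0 hσM hσt hψt ht₁ hgs0 hgsM hptM hB3
  have hE7 := abs_cubic_term_le hM hs1 hl1 hξ hν0 hν hD0 hψ₁ hψ₂ hk₁M hk₂M hgs0 hgsM hlapM B4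
  have hq := abs_phi_time_deriv_le hM hl1 hξ hψt hN hP hP'
  have hE8 := abs_second_time_term_le hM hs1 hl1 hξ hD0 hσM hσt hψt hψtt ht₁' hN hT₂ hq B4 B6
  have hE9 := phi_time_deriv_term_ge hM hs1 hl1 hξ hν0 hν hD0 hε0 hε hσ0 hσM hψt ht₁ hN hP' hq hgs
    hpt hgsM hlapM hspM hptM hB3 B6
  have hfin : remainderForm ν s lam ε ξ (t₁ + lam * ξ * ψt) (-N + P - lam * ξ * ψt)
        (T₂ - 2 * lam * t₁ * ψt - lam ^ 2 * ξ * ψt ^ 2 - lam * ξ * ψtt)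
        (-(lam * t₁ * ψ₁) - lam * (lam * ξ * ψ₁ * ψt + ξ * ψt₁))
        (-(lam * t₁ * ψ₂) - lam * (lam * ξ * ψ₂ * ψt + ξ * ψt₂))
        σ σt σ₁ σ₂ ψ₁ ψ₂ ψ₁₁ ψ₁₂ ψ₂₂ ψt₁ ψt₂ w wt w₁ w₂ =
      (-ν * wt * sw + ν / 2 * σt * a ^ 2)
      + (s * ν ^ 2 * lam) * (2 * lam * ξ * dw ^ 2 + lam * ξ * (gs + ε) * a ^ 2)
      + (s * ν ^ 2 * lam) * ξ * (2 * hess - lap * a ^ 2)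
      + (s * ν ^ 2 * lam) * lam * ξ * w * (lam * (2 * gs + ε) * dw + 4 * (k₁ * w₁ + k₂ * w₂))
      - s ^ 2 * ν * lam ^ 2 / 2 * (σt * ξ ^ 2 * gs + 2 * σ * ξ * (t₁ + lam * ξ * ψt) * gs
        + σ * ξ ^ 2 * (2 * pt)) * b ^ 2
      + s ^ 3 * ν ^ 2 * lam ^ 4 * ξ ^ 3 * gs * (gs - ε) * b ^ 2
      + s ^ 3 * ν ^ 2 * lam ^ 3 * ξ ^ 3 * (2 * k₁ * ψ₁ + 2 * k₂ * ψ₂ + gs * lap) * b ^ 2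
      - s / 2 * (2 * σ * σt * (-N + P - lam * ξ * ψt) + σ ^ 2 *
        (T₂ - 2 * lam * t₁ * ψt - lam ^ 2 * ξ * ψt ^ 2 - lam * ξ * ψtt)) * b ^ 2
      + s ^ 2 * ν * lam * ξ * (-(lam * σ * (-N + P - lam * ξ * ψt) * (gs + ε))
        + σ * (-N + P - lam * ξ * ψt) * lap + (-N + P - lam * ξ * ψt) * sp
        + σ * ((-(lam * t₁ * ψ₁) - lam * (lam * ξ * ψ₁ * ψt + ξ * ψt₁)) * ψ₁
          + (-(lam * t₁ * ψ₂) - lam * (lam * ξ * ψ₂ * ψt + ξ * ψt₂)) * ψ₂)) * b ^ 2 := by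
    rw [← ha, ← hb]
    rfl
  rw [hfin, ha, hb]
  have a1 := (abs_le.mp hE1).1
  have a3 := (abs_le.mp hE3).1
  have a4 := (abs_le.mp hE4).1
  have a7 := (abs_le.mp hE7).1
  have a8 := (abs_le.mp hE8).2
  have hpos : 0 ≤ M ^ 8 * D := by positivity
  linarith only [a1, a3, a4, a7, a8, hE2, hE5, hE9, hpos]

/-! ### Pointwise Carleman inequality -/

/-- The scales of the weights: this is where the choice `μ = s λ² e^{λ(6m-4)}` and the constant
`e^{6λ(m+1)}` enter, through `6(m+1) ≤ 12m` and `2(6m-4) + 6(m+1) = 18m - 2`. -/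
theorem weight_scales {K M m s lam θ θ₁ θ₂ ψ : ℝ} (hK : 0 ≤ K) (hKM : K ≤ M) (hm : 1 ≤ m)
    (hs : 1 ≤ s) (hl : 1 ≤ lam) (hθ : 1 ≤ θ)
    (hψ : 6 * m ≤ ψ) (hψ' : ψ ≤ 6 * m + 1) (h1 : θ₁ ≤ K * θ ^ 2)
    (h1' : |θ₁| ≤ K * muParam m s lam * θ ^ 2) (h2 : |θ₂| ≤ K * muParam m s lam ^ 2 * θ ^ 3) :
    1 ≤ θ * Real.exp (lam * ψ) ∧
    θ₁ * Real.exp (lam * ψ) ≤ M * (θ * Real.exp (lam * ψ)) ^ 2 ∧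
    |θ₁ * Real.exp (lam * ψ)| ≤ M * (s * lam ^ 2 * (θ * Real.exp (lam * ψ)) ^ 2) ∧
    max (θ₁ * (lam * Real.exp (6 * lam * (m + 1)) - Real.exp (lam * ψ))) 0
      ≤ M * (lam * (θ * Real.exp (lam * ψ)) ^ 2) ∧
    |θ₂ * (lam * Real.exp (6 * lam * (m + 1)) - Real.exp (lam * ψ))|
      ≤ M * (s ^ 2 * lam ^ 3 * (θ * Real.exp (lam * ψ)) ^ 3) := by
  have hM : 0 ≤ M := hK.trans hKM
  have hl0 : 0 < lam := by linarith
  have hs0 : 0 < s := by linarith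
  have hθ0 : 0 < θ := by linarith
  set η := Real.exp (lam * ψ) with hη
  set L := lam * Real.exp (6 * lam * (m + 1)) with hL
  have hη0 : 0 < η := Real.exp_pos _
  have hlψ : 0 ≤ lam * ψ := mul_nonneg hl0.le (by linarith)
  have hη1 : 1 ≤ η := Real.one_le_exp hlψ
  have hηη : η ≤ η ^ 2 := le_self_pow₀ hη1 (by norm_num)
  have hexp : Real.exp (6 * lam * (m + 1)) ≤ η ^ 2 := by
    rw [hη, ← Real.exp_nat_mul]
    apply Real.exp_le_exp.mpr
    push_cast
    nlinarith [mul_le_mul_of_nonneg_left hψ hl0.le, mul_le_mul_of_nonneg_left hm hl0.le]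
  have hηL : η ≤ L := by
    have h : η ≤ Real.exp (6 * lam * (m + 1)) := by
      apply Real.exp_le_exp.mpr
      nlinarith [mul_le_mul_of_nonneg_left hψ' hl0.le]
    exact h.trans (le_mul_of_one_le_left (Real.exp_pos _).le hl)
  have hE0 : 0 ≤ L - η := by linarith
  have hEL : L - η ≤ lam * η ^ 2 := by
    have : L ≤ lam * η ^ 2 := mul_le_mul_of_nonneg_left hexp hl0.le
    linarith
  have hμη : Real.exp (lam * (6 * m - 4)) ≤ η := by
    apply Real.exp_le_exp.mpr
    exact mul_le_mul_of_nonneg_left (by linarith) hl0.le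
  refine ⟨?_, ?_, ?_, ?_, ?_⟩
  · exact one_le_mul_of_one_le_of_one_le hθ hη1
  · calc θ₁ * η ≤ K * θ ^ 2 * η := by gcongr
      _ ≤ M * θ ^ 2 * η ^ 2 := by gcongr
      _ = _ := by ring
  · rw [abs_mul, abs_of_pos hη0]
    have hμ : muParam m s lam ≤ s * lam ^ 2 * η := by
      unfold muParam; gcongr
    have hμ0 : 0 ≤ muParam m s lam := by unfold muParam; positivity
    calc |θ₁| * η ≤ K * muParam m s lam * θ ^ 2 * η := by gcongr
      _ ≤ M * (s * lam ^ 2 * η) * θ ^ 2 * η := by gcongr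
      _ = _ := by ring
  · refine max_le ?_ (by positivity)
    calc θ₁ * (L - η) ≤ K * θ ^ 2 * (L - η) := by gcongr
      _ ≤ M * θ ^ 2 * (lam * η ^ 2) := by gcongr
      _ = _ := by ring
  · rw [abs_mul, abs_of_nonneg hE0]
    have hkey : muParam m s lam ^ 2 * L ≤ s ^ 2 * lam ^ 3 * η ^ 3 := by
      have e : muParam m s lam ^ 2 * L = s ^ 2 * lam ^ 3 *
          (lam ^ 2 * Real.exp (-(2 * lam))) * Real.exp (18 * m * lam) := by
        have : Real.exp (lam * (6 * m - 4)) ^ 2 * Real.exp (6 * lam * (m + 1))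
            = Real.exp (-(2 * lam)) * Real.exp (18 * m * lam) := by
          rw [← Real.exp_nat_mul, ← Real.exp_add, ← Real.exp_add]
          congr 1; push_cast; ring
        rw [hL, muParam]
        linear_combination s ^ 2 * lam ^ 5 * this
      have h3 : Real.exp (18 * m * lam) ≤ η ^ 3 := by
        rw [hη, ← Real.exp_nat_mul]
        apply Real.exp_le_exp.mpr
        push_cast
        nlinarith [mul_le_mul_of_nonneg_left hψ hl0.le]
      have h4 : lam ^ 2 * Real.exp (-(2 * lam)) ≤ 1 := by
        have h5 : lam ≤ Real.exp lam := by linarith [Real.add_one_le_exp lam]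
        have h6 : lam ^ 2 ≤ Real.exp (2 * lam) := by
          calc lam ^ 2 ≤ Real.exp lam ^ 2 := by gcongr
            _ = _ := by rw [← Real.exp_nat_mul]; norm_num
        rw [Real.exp_neg, ← div_eq_mul_inv, div_le_one (Real.exp_pos _)]
        exact h6
      rw [e]
      calc _ ≤ s ^ 2 * lam ^ 3 * 1 * η ^ 3 := by gcongr
        _ = _ := by ring
    calc |θ₂| * (L - η) ≤ K * muParam m s lam ^ 2 * θ ^ 3 * L := by gcongr; linarith
      _ = K * θ ^ 3 * (muParam m s lam ^ 2 * L) := by ring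
      _ ≤ M * θ ^ 3 * (s ^ 2 * lam ^ 3 * η ^ 3) := by gcongr
      _ = _ := by ring

set_option maxHeartbeats 1000000 in
/-- Pointwise Carleman inequality. With `w = e z`, `wᵢ = e (zᵢ + s λ ξ ψᵢ z)`, `f` the conjugated
operator applied to `w` and `d` the divergence found in `symmPart_mul_skewPart_eq`, the weighted
squares of `z` and of its gradient are controlled by `f²`, the divergence, and an observation where the
gradient of `ψ` may be small. -/
theorem pointwise_carleman {M c r ν s lam ε ξ t₁ N P T₂ σ σt σ₁ σ₂ ψt ψtt ψ₁ ψ₂ ψ₁₁ ψ₁₂ ψ₂₂ ψt₁ ψt₂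
      w wt w₁ w₂ lapw e z z₁ z₂ f d χ : ℝ}
    (hM : 1 ≤ M) (hr : 1 ≤ r) (hs : r ≤ s) (hl : r ≤ lam) (hξ : 1 ≤ ξ)
    (hν0 : 0 < ν) (hν : ν ≤ M) (hε0 : 0 < ε) (hε : ε ≤ 1)
    (hσM : |σ| ≤ M) (hσ1 : 1 ≤ M * σ) (hσt : |σt| ≤ M) (hσ₁ : |σ₁| ≤ M) (hσ₂ : |σ₂| ≤ M)
    (hψt : |ψt| ≤ M) (hψtt : |ψtt| ≤ M) (hψ₁ : |ψ₁| ≤ M) (hψ₂ : |ψ₂| ≤ M)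
    (hψ₁₁ : |ψ₁₁| ≤ M) (hψ₁₂ : |ψ₁₂| ≤ M) (hψ₂₂ : |ψ₂₂| ≤ M) (hψt₁ : |ψt₁| ≤ M) (hψt₂ : |ψt₂| ≤ M)
    (ht₁ : t₁ ≤ M * ξ ^ 2) (ht₁' : |t₁| ≤ M * (s * lam ^ 2 * ξ ^ 2))
    (hN : 0 ≤ N) (hP : 0 ≤ P) (hP' : P ≤ M * (lam * ξ ^ 2))
    (hT₂ : |T₂| ≤ M * (s ^ 2 * lam ^ 3 * ξ ^ 3))
    (hc0 : 0 < c) (hc1 : c ≤ ν ^ 2 * ε) (hc2 : c ≤ 2 * ν ^ 2 * ε ^ 2) (hc3 : c * M ≤ ν * ε)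
    (hrc : 270 * M ^ 8 ≤ c * r)
    (hχ : 0 ≤ χ) (hχ' : χ = 1 ∨ 2 * ε ≤ ψ₁ ^ 2 + ψ₂ ^ 2)
    (hw : w = e * z) (hw₁ : w₁ = e * (z₁ + s * lam * ξ * ψ₁ * z))
    (hw₂ : w₂ = e * (z₂ + s * lam * ξ * ψ₂ * z))
    (hid : symmPart ν s lam ξ (-N + P - lam * ξ * ψt) σ ψ₁ ψ₂ w lapw
        * skewPart ν s lam ε ξ σ ψ₁ ψ₂ w wt w₁ w₂ = d +
      remainderForm ν s lam ε ξ (t₁ + lam * ξ * ψt) (-N + P - lam * ξ * ψt)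
        (T₂ - 2 * lam * t₁ * ψt - lam ^ 2 * ξ * ψt ^ 2 - lam * ξ * ψtt)
        (-(lam * t₁ * ψ₁) - lam * (lam * ξ * ψ₁ * ψt + ξ * ψt₁))
        (-(lam * t₁ * ψ₂) - lam * (lam * ξ * ψ₂ * ψt + ξ * ψt₂))
        σ σt σ₁ σ₂ ψ₁ ψ₂ ψ₁₁ ψ₁₂ ψ₂₂ ψt₁ ψt₂ w wt w₁ w₂)
    (hf : f = symmPart ν s lam ξ (-N + P - lam * ξ * ψt) σ ψ₁ ψ₂ w lapw
        + skewPart ν s lam ε ξ σ ψ₁ ψ₂ w wt w₁ w₂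
        + s * ν * lam * ξ * ((ψ₁₁ + ψ₂₂) - lam * (ψ₁ ^ 2 + ψ₂ ^ 2 + ε)) * w) :
    d + c / (10 * M ^ 2) * (s * lam ^ 2 * (ξ * (z₁ ^ 2 + z₂ ^ 2) * e ^ 2)
        + s ^ 3 * lam ^ 4 * (ξ ^ 3 * z ^ 2 * e ^ 2))
      ≤ f ^ 2 + 2 * M ^ 2 * (χ * (s ^ 3 * lam ^ 4 * (ξ ^ 3 * z ^ 2 * e ^ 2))) := by
  have hs1 : 1 ≤ s := hr.trans hs
  have hl1 : 1 ≤ lam := hr.trans hl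
  have hM0 : 0 < M := by linarith
  have hs0 : 0 < s := by linarith
  have hl0 : 0 < lam := by linarith
  have hξ0 : 0 < ξ := by linarith
  have hr0 : 0 < r := by linarith
  have hrem := remainderForm_ge (wt := wt) (w := w) (w₁ := w₁) (w₂ := w₂) hM hr hs hl hξ hν0 hν
    hε0 hε hσM hσ1 hσt hσ₁ hσ₂ hψt hψtt hψ₁ hψ₂
    hψ₁₁ hψ₁₂ hψ₂₂ hψt₁ hψt₂ ht₁ ht₁' hN hP hP' hT₂
  set A := symmPart ν s lam ξ (-N + P - lam * ξ * ψt) σ ψ₁ ψ₂ w lapw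
  set B := skewPart ν s lam ε ξ σ ψ₁ ψ₂ w wt w₁ w₂
  set X := s * lam ^ 2 * ξ * (w₁ ^ 2 + w₂ ^ 2) with hX
  set Y := s ^ 3 * lam ^ 4 * ξ ^ 3 * w ^ 2 with hY
  set Z := s ^ 2 * lam ^ 2 * ξ * N * w ^ 2 with hZ
  have hX0 : 0 ≤ X := by positivity
  have hY0 : 0 ≤ Y := by positivity
  have hZ0 : 0 ≤ Z := by positivity
  set gs := ψ₁ ^ 2 + ψ₂ ^ 2 with hgs
  have hgs0 : 0 ≤ gs := by positivity
  have hgsM : gs ≤ 2 * M ^ 2 := by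
    have h1 := sq_le_sq' (abs_le.mp hψ₁).1 (abs_le.mp hψ₁).2
    have h2 := sq_le_sq' (abs_le.mp hψ₂).1 (abs_le.mp hψ₂).2
    linarith
  have hM2 : 1 ≤ M ^ 2 := one_le_pow₀ hM
  set R := s * ν * lam * ξ * ((ψ₁₁ + ψ₂₂) - lam * (gs + ε)) * w with hR
  set D := (X + Y + Z) / r with hD
  have hD0 : 0 ≤ D := by positivity
  -- the lower-order part of the conjugated operator
  have hR2 : R ^ 2 ≤ 25 * M ^ 8 * D := by
    have h1 : |(ψ₁₁ + ψ₂₂) - lam * (gs + ε)| ≤ 5 * M ^ 2 * lam := by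
      have g1 := abs_le.mp (abs_add_le_add hψ₁₁ hψ₂₂)
      have g2 : lam * (gs + ε) ≤ lam * (3 * M ^ 2) := by gcongr; linarith
      have g3 : 0 ≤ lam * (gs + ε) := by positivity
      have g4 : M ≤ M ^ 2 * lam := by
        calc M ≤ M ^ 2 := le_self_pow₀ hM (by norm_num)
          _ ≤ _ := le_mul_of_one_le_right (by positivity) hl1
      rw [abs_le]
      constructor <;> linarith only [g1.1, g1.2, g2, g3, g4, hM0]
    have h2 : ((ψ₁₁ + ψ₂₂) - lam * (gs + ε)) ^ 2 ≤ (5 * M ^ 2 * lam) ^ 2 := by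
      rw [← sq_abs]; gcongr
    have h3 : R ^ 2 ≤ 25 * M ^ 6 * (s ^ 2 * lam ^ 4 * ξ ^ 3 * w ^ 2) := by
      calc R ^ 2 = s ^ 2 * ν ^ 2 * lam ^ 2 * ξ ^ 2 * ((ψ₁₁ + ψ₂₂) - lam * (gs + ε)) ^ 2 * w ^ 2 := by
            rw [hR]; ring
        _ ≤ s ^ 2 * M ^ 2 * lam ^ 2 * ξ ^ 3 * (5 * M ^ 2 * lam) ^ 2 * w ^ 2 := by
            have : ξ ^ 2 ≤ ξ ^ 3 := pow_le_pow_right₀ hξ (by norm_num)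
            gcongr
        _ = _ := by ring
    have h4 : s ^ 2 * lam ^ 4 * ξ ^ 3 * w ^ 2 ≤ D := by
      rw [hD, le_div_iff₀ hr0]
      have : s ^ 2 * lam ^ 4 * ξ ^ 3 * w ^ 2 * r ≤ s ^ 2 * lam ^ 4 * ξ ^ 3 * w ^ 2 * s := by gcongr
      linarith
    have h5 : M ^ 6 * (s ^ 2 * lam ^ 4 * ξ ^ 3 * w ^ 2) ≤ M ^ 8 * D := by
      have : M ^ 6 ≤ M ^ 8 := pow_le_pow_right₀ hM (by norm_num)
      gcongr
    linarith only [h3, h5]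
  have hAB : A * B + B ^ 2 / 2 ≤ f ^ 2 + R ^ 2 := by
    have h1 : A + B = f - R := by rw [hf]; ring
    have h2 : A * B + B ^ 2 / 2 ≤ (A + B) ^ 2 / 2 := by linarith only [sq_nonneg A]
    rw [h1] at h2
    linarith only [h2, sq_nonneg (f + R)]
  have hDc : 135 * M ^ 8 * D ≤ c / 2 * (X + Y + Z) := by
    rw [hD, mul_div_assoc', div_le_iff₀ hr0]
    have := mul_le_mul_of_nonneg_right hrc (by positivity : 0 ≤ X + Y + Z)
    linarith only [this]
  have hcX : c * X ≤ ν ^ 2 * ε * X := by gcongr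
  have hcZ : c * Z ≤ ν * σ * ε * Z := by
    have h1 : c ≤ ν * σ * ε := by
      have h2 : c * 1 ≤ c * (M * σ) := by gcongr
      have hσ0 : 0 ≤ σ := by
        by_contra h
        have : M * σ ≤ 0 := mul_nonpos_of_nonneg_of_nonpos hM0.le (not_le.mp h).le
        linarith
      have h3 := mul_le_mul_of_nonneg_right hc3 hσ0
      linarith only [h2, h3]
    gcongr
  have hcY : c * Y - 2 * M ^ 2 * (χ * Y) ≤ ν ^ 2 * (gs * (gs - ε)) * Y := by
    have hνM : ν ^ 2 ≤ M ^ 2 := by gcongr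
    rcases hχ' with hχ1 | hgs2
    · have h1 : -(ε ^ 2) ≤ gs * (gs - ε) := by
        linarith only [sq_nonneg (gs - ε / 2), sq_nonneg ε]
      have h2 : -(M ^ 2) ≤ ν ^ 2 * (gs * (gs - ε)) := by
        have h3 := mul_le_mul_of_nonneg_left h1 (sq_nonneg ν)
        have h4 : ν ^ 2 * ε ^ 2 ≤ M ^ 2 * 1 := by
          gcongr
          exact pow_le_one₀ hε0.le hε
        linarith only [h3, h4]
      have h3 : c ≤ M ^ 2 := by
        have h4 : ν ^ 2 * ε ≤ M ^ 2 * 1 := by gcongr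
        linarith only [h4, hc1]
      have h4 := mul_le_mul_of_nonneg_right h2 hY0
      have h5 := mul_le_mul_of_nonneg_right h3 hY0
      rw [hχ1]
      linarith only [h4, h5]
    · have h1 : 2 * ε ^ 2 ≤ gs * (gs - ε) := by
        linarith only [mul_nonneg (sub_nonneg.mpr hgs2) (add_nonneg hgs0 hε0.le)]
      have h2 : c ≤ ν ^ 2 * (gs * (gs - ε)) := by
        have := mul_le_mul_of_nonneg_left h1 (sq_nonneg ν)
        linarith only [this, hc2]
      have h3 := mul_le_mul_of_nonneg_right h2 hY0
      have h4 : 0 ≤ 2 * M ^ 2 * (χ * Y) := by positivity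
      linarith only [h3, h4]
  have hmain : d + c / 2 * (X + Y) ≤ f ^ 2 + 2 * M ^ 2 * (χ * Y) := by
    have hcZ0 : 0 ≤ c * Z := by positivity
    linarith only [hrem, hid, hAB, hR2, hDc, hcX, hcY, hcZ, hcZ0]
  -- back to `z`
  have hYz : s ^ 3 * lam ^ 4 * (ξ ^ 3 * z ^ 2 * e ^ 2) = Y := by rw [hY, hw]; ring
  have hXz : s * lam ^ 2 * (ξ * (z₁ ^ 2 + z₂ ^ 2) * e ^ 2) ≤ 2 * X + 4 * M ^ 2 * Y := by
    have h1 : (e * z₁) ^ 2 ≤ 2 * w₁ ^ 2 + 2 * (s ^ 2 * lam ^ 2 * ξ ^ 2 * ψ₁ ^ 2 * w ^ 2) := by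
      have : e * z₁ = w₁ - s * lam * ξ * ψ₁ * w := by rw [hw₁, hw]; ring
      rw [this]
      linarith only [sq_nonneg (w₁ + s * lam * ξ * ψ₁ * w)]
    have h2 : (e * z₂) ^ 2 ≤ 2 * w₂ ^ 2 + 2 * (s ^ 2 * lam ^ 2 * ξ ^ 2 * ψ₂ ^ 2 * w ^ 2) := by
      have : e * z₂ = w₂ - s * lam * ξ * ψ₂ * w := by rw [hw₂, hw]; ring
      rw [this]
      linarith only [sq_nonneg (w₂ + s * lam * ξ * ψ₂ * w)]
    calc s * lam ^ 2 * (ξ * (z₁ ^ 2 + z₂ ^ 2) * e ^ 2)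
        = s * lam ^ 2 * ξ * ((e * z₁) ^ 2 + (e * z₂) ^ 2) := by ring
      _ ≤ s * lam ^ 2 * ξ * (2 * (w₁ ^ 2 + w₂ ^ 2) + 2 * (s ^ 2 * lam ^ 2 * ξ ^ 2 * gs * w ^ 2)) := by
          refine mul_le_mul_of_nonneg_left ?_ (by positivity)
          rw [hgs]; linarith only [h1, h2]
      _ = 2 * X + 2 * gs * Y := by rw [hX, hY]; ring
      _ ≤ 2 * X + 2 * (2 * M ^ 2) * Y := by gcongr
      _ = _ := by ring
  have hback : c / (10 * M ^ 2) * (s * lam ^ 2 * (ξ * (z₁ ^ 2 + z₂ ^ 2) * e ^ 2) + Y)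
      ≤ c / 2 * (X + Y) := by
    have h1 : s * lam ^ 2 * (ξ * (z₁ ^ 2 + z₂ ^ 2) * e ^ 2) + Y ≤ 5 * M ^ 2 * (X + Y) := by
      have g1 := mul_le_mul_of_nonneg_right hM2 hX0
      have g2 := mul_le_mul_of_nonneg_right hM2 hY0
      have g3 : 0 ≤ M ^ 2 * X := by positivity
      linarith only [hXz, g1, g2, g3, hX0]
    have hk : c / (10 * M ^ 2) * (5 * M ^ 2) = c / 2 := by
      field_simp
      norm_num
    calc _ ≤ c / (10 * M ^ 2) * (5 * M ^ 2 * (X + Y)) := by gcongr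
      _ = c / (10 * M ^ 2) * (5 * M ^ 2) * (X + Y) := by ring
      _ = _ := by rw [hk]
  rw [hYz]
  linarith only [hmain, hback]

/-! ### Bounds for the weight in time -/

theorem derivWithin_eq_of_eqOn {f g : ℝ → ℝ} {I J : Set ℝ} {t g' : ℝ} (hJI : J ⊆ I)
    (hJ : UniqueDiffOn ℝ J) (hf : DifferentiableOn ℝ f I) (ht : t ∈ J) (hfg : EqOn f g J)
    (hg : HasDerivWithinAt g g' J t) : derivWithin f I t = g' :=
  (hJ t ht).eq_deriv _ ((hf t (hJI ht)).hasDerivWithinAt.mono hJI) (hg.congr hfg (hfg ht))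

theorem hasDerivAt_one_sub_div_rpow {a p t : ℝ} (hp : 1 ≤ p) :
    HasDerivAt (fun r : ℝ => (1 - r / a) ^ p) (-(p / a) * (1 - t / a) ^ (p - 1)) t := by
  have h1 : HasDerivAt (fun r : ℝ => 1 - r / a) (-(1 / a)) t := by
    simpa using ((hasDerivAt_id t).div_const a).const_sub 1
  exact (h1.rpow_const (Or.inr hp)).congr_deriv (by ring)

theorem hasDerivAt_sub_rpow {a p t : ℝ} (ht : t < a) :
    HasDerivAt (fun r : ℝ => (a - r) ^ p) (-p * (a - t) ^ (p - 1)) t := by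
  have h1 : HasDerivAt (fun r : ℝ => a - r) (-1) t := by
    simpa using (hasDerivAt_id t).const_sub a
  exact (h1.rpow_const (Or.inl (by linarith))).congr_deriv (by ring)

section

variable {T T₀ T₁ m μ : ℝ} {θ : ℝ → ℝ}

theorem IsTimeWeight.contDiffOn_derivWithin (h : IsTimeWeight T T₀ T₁ m μ θ) :
    ContDiffOn ℝ 1 (derivWithin θ (Ico 0 T)) (Ico 0 T) :=
  h.contDiffOn.derivWithin (uniqueDiffOn_Ico 0 T) (by norm_num)

theorem IsTimeWeight.derivWithin_initial (h : IsTimeWeight T T₀ T₁ m μ θ) (hT₀ : 0 < T₀)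
    (hT₀T : T₀ < T) (hμ : 2 < μ) {t : ℝ} (ht : t ∈ Icc 0 T₀) :
    derivWithin θ (Ico 0 T) t = -(μ / T₀) * (1 - t / T₀) ^ (μ - 1) ∧
    derivWithin (derivWithin θ (Ico 0 T)) (Ico 0 T) t
      = μ / T₀ * ((μ - 1) / T₀) * (1 - t / T₀) ^ (μ - 2) := by
  have hJI : Icc 0 T₀ ⊆ Ico 0 T := fun t ht => ⟨ht.1, ht.2.trans_lt hT₀T⟩
  have hJ := uniqueDiffOn_Icc hT₀
  have h1 : EqOn (derivWithin θ (Ico 0 T)) (fun r => -(μ / T₀) * (1 - r / T₀) ^ (μ - 1))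
      (Icc 0 T₀) := fun t ht =>
    derivWithin_eq_of_eqOn hJI hJ (h.contDiffOn.differentiableOn (by norm_num)) ht
      (fun r hr => h.eq_initial r hr)
      ((hasDerivAt_one_sub_div_rpow (by linarith)).const_add 1).hasDerivWithinAt
  refine ⟨h1 ht, ?_⟩
  refine derivWithin_eq_of_eqOn hJI hJ
    (h.contDiffOn_derivWithin.differentiableOn (by norm_num)) ht h1 ?_
  refine HasDerivAt.hasDerivWithinAt ?_
  refine ((hasDerivAt_one_sub_div_rpow (by linarith)).const_mul (-(μ / T₀))).congr_deriv ?_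
  rw [show μ - 1 - 1 = μ - 2 by ring]
  ring

theorem IsTimeWeight.derivWithin_middle (h : IsTimeWeight T T₀ T₁ m μ θ) (hT₀ : 0 < T₀)
    (hT₁ : 0 < T₁) (hT : T₀ + 2 * T₁ < T) {t : ℝ} (ht : t ∈ Icc T₀ (T - 2 * T₁)) :
    derivWithin θ (Ico 0 T) t = 0 ∧ derivWithin (derivWithin θ (Ico 0 T)) (Ico 0 T) t = 0 := by
  have hJI : Icc T₀ (T - 2 * T₁) ⊆ Ico 0 T := fun t ht =>
    ⟨hT₀.le.trans ht.1, by linarith [ht.2]⟩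
  have hJ := uniqueDiffOn_Icc (show T₀ < T - 2 * T₁ by linarith)
  have h1 : EqOn (derivWithin θ (Ico 0 T)) (fun _ => 0) (Icc T₀ (T - 2 * T₁)) := fun t ht =>
    derivWithin_eq_of_eqOn hJI hJ (h.contDiffOn.differentiableOn (by norm_num)) ht
      (g := fun _ => 1) (fun r hr => h.eq_one r hr) (hasDerivWithinAt_const _ _ _)
  exact ⟨h1 ht, derivWithin_eq_of_eqOn hJI hJ
    (h.contDiffOn_derivWithin.differentiableOn (by norm_num)) ht h1 (hasDerivWithinAt_const _ _ _)⟩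

theorem IsTimeWeight.derivWithin_interior {t : ℝ} (ht : t ∈ Ioo 0 T) :
    derivWithin θ (Ico 0 T) t = deriv θ t ∧
    derivWithin (derivWithin θ (Ico 0 T)) (Ico 0 T) t = iteratedDeriv 2 θ t := by
  have h1 : ∀ r ∈ Ioo 0 T, derivWithin θ (Ico 0 T) r = deriv θ r := fun r hr =>
    derivWithin_of_mem_nhds (Ico_mem_nhds hr.1 hr.2)
  refine ⟨h1 t ht, ?_⟩
  rw [derivWithin_of_mem_nhds (Ico_mem_nhds ht.1 ht.2), iteratedDeriv_succ, iteratedDeriv_one]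
  refine Filter.EventuallyEq.deriv_eq ?_
  filter_upwards [Ioo_mem_nhds ht.1 ht.2] with r hr using h1 r hr

theorem IsTimeWeight.derivWithin_final (h : IsTimeWeight T T₀ T₁ m μ θ)
    (hT₁T : T₁ < T) {t : ℝ} (ht : t ∈ Ico (T - T₁) T) :
    derivWithin θ (Ico 0 T) t = m * (T - t) ^ (-m - 1) ∧
    derivWithin (derivWithin θ (Ico 0 T)) (Ico 0 T) t = m * (m + 1) * (T - t) ^ (-m - 2) := by
  have hJI : Ico (T - T₁) T ⊆ Ico 0 T := fun t ht => ⟨by linarith [ht.1], ht.2⟩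
  have hJ := uniqueDiffOn_Ico (T - T₁) T
  have h1 : EqOn (derivWithin θ (Ico 0 T)) (fun r => m * (T - r) ^ (-m - 1)) (Ico (T - T₁) T) := by
    intro t ht
    refine derivWithin_eq_of_eqOn hJI hJ (h.contDiffOn.differentiableOn (by norm_num)) ht
      (g := fun r => (T - r) ^ (-m)) (fun r hr => ?_) ?_
    · change θ r = (T - r) ^ (-m)
      rw [h.eq_final r hr, Real.rpow_neg (by linarith [hr.2]), one_div]
    · exact ((hasDerivAt_sub_rpow ht.2).congr_deriv (by ring)).hasDerivWithinAt
  refine ⟨h1 ht, ?_⟩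
  refine derivWithin_eq_of_eqOn hJI hJ
    (h.contDiffOn_derivWithin.differentiableOn (by norm_num)) ht h1 ?_
  refine HasDerivAt.hasDerivWithinAt ?_
  refine ((hasDerivAt_sub_rpow ht.2).const_mul m).congr_deriv ?_
  rw [show -m - 1 - 1 = -m - 2 by ring]
  ring

theorem IsTimeWeight.one_le (h : IsTimeWeight T T₀ T₁ m μ θ) (hT₀ : 0 < T₀)
    (hT₁ : 0 < T₁) (hT₁' : T₁ ≤ 1 / 4) (hT : T₀ + 2 * T₁ < T) (hm : 1 ≤ m) {t : ℝ}
    (ht : t ∈ Ico 0 T) : 1 ≤ θ t := by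
  rcases le_total t T₀ with h1 | h1
  · rw [h.eq_initial t ⟨ht.1, h1⟩]
    have : 0 ≤ 1 - t / T₀ := by rw [sub_nonneg, div_le_one hT₀]; exact h1
    linarith [Real.rpow_nonneg this μ]
  rcases le_total t (T - 2 * T₁) with h2 | h2
  · rw [h.eq_one t ⟨h1, h2⟩]
  rcases le_or_gt (T - T₁) t with h3 | h3
  · rw [h.eq_final t ⟨h3, ht.2⟩]
    have hpos : 0 < T - t := by linarith [ht.2]
    rw [le_div_iff₀ (Real.rpow_pos_of_pos hpos m), one_mul]
    exact Real.rpow_le_one hpos.le (by linarith) (by linarith)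
  · have h4 := h.eq_one (T - 2 * T₁) ⟨by linarith, le_rfl⟩
    rw [← h4]
    exact h.monotoneOn ⟨le_rfl, by linarith⟩ ⟨h2, h3.le⟩ h2

end

/-- Bounds for the time weight and its derivatives, uniform in `μ` up to explicit powers of `μ`. -/
theorem IsTimeWeightFamily.exists_bound {T T₀ T₁ m : ℝ} {θ : ℝ → ℝ → ℝ}
    (h : IsTimeWeightFamily T T₀ T₁ m θ) (hT₀ : 0 < T₀)
    (hT₁ : 0 < T₁) (hT₁' : T₁ ≤ 1 / 4) (hT : T₀ + 2 * T₁ < T) (hm : 1 ≤ m) :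
    ∃ K : ℝ, 0 ≤ K ∧ ∀ μ, 2 < μ → ∀ t ∈ Ico 0 T,
      derivWithin (θ μ) (Ico 0 T) t ≤ K * θ μ t ^ 2 ∧
      |derivWithin (θ μ) (Ico 0 T) t| ≤ K * μ * θ μ t ^ 2 ∧
      |derivWithin (derivWithin (θ μ) (Ico 0 T)) (Ico 0 T) t| ≤ K * μ ^ 2 * θ μ t ^ 3 := by
  obtain ⟨K₀, hK₀⟩ := h.transition_bound
  have hfac : 0 ≤ 1 / T₀ := by positivity
  refine ⟨1 / T₀ + 1 / T₀ ^ 2 + |K₀| + m * (m + 1), by positivity, fun μ hμ t ht => ?_⟩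
  set K := 1 / T₀ + 1 / T₀ ^ 2 + |K₀| + m * (m + 1) with hK
  have hK1 : 1 / T₀ ≤ K := by
    have : 0 ≤ 1 / T₀ ^ 2 + |K₀| + m * (m + 1) := by positivity
    linarith
  have hK2 : 1 / T₀ ^ 2 ≤ K := by
    have : 0 ≤ 1 / T₀ + |K₀| + m * (m + 1) := by positivity
    linarith
  have hK3 : K₀ ≤ K := by
    have : 0 ≤ 1 / T₀ + 1 / T₀ ^ 2 + m * (m + 1) := by positivity
    linarith [le_abs_self K₀]
  have hK4 : m * (m + 1) ≤ K := by
    have : 0 ≤ 1 / T₀ + 1 / T₀ ^ 2 + |K₀| := by positivity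
    linarith
  have hK0 : 0 ≤ K := hfac.trans hK1
  have hw := h.isTimeWeight μ hμ
  have hθ : 1 ≤ θ μ t := hw.one_le hT₀ hT₁ hT₁' hT hm ht
  have hθ0 : 0 ≤ θ μ t := by linarith
  have hθ2 : 1 ≤ θ μ t ^ 2 := one_le_pow₀ hθ
  have hθ3 : 1 ≤ θ μ t ^ 3 := one_le_pow₀ hθ
  have hμ0 : 0 < μ := by linarith
  have hμ1 : 1 ≤ μ := by linarith
  have hμ2 : 1 ≤ μ ^ 2 := one_le_pow₀ hμ1
  have fromPos : ∀ d₁ d₂ c : ℝ, 0 ≤ c → c ≤ K → |d₁| ≤ c * θ μ t ^ 2 → |d₂| ≤ c * θ μ t ^ 3 →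
      d₁ ≤ K * θ μ t ^ 2 ∧ |d₁| ≤ K * μ * θ μ t ^ 2 ∧ |d₂| ≤ K * μ ^ 2 * θ μ t ^ 3 := by
    intro d₁ d₂ c hc0 hc h1 h2
    refine ⟨(le_abs_self _).trans (h1.trans (by gcongr)), h1.trans ?_, h2.trans ?_⟩
    · gcongr
      exact hc.trans (le_mul_of_one_le_right hK0 hμ1)
    · gcongr
      exact hc.trans (le_mul_of_one_le_right hK0 hμ2)
  rcases le_total t T₀ with h1 | h1
  · obtain ⟨e1, e2⟩ := hw.derivWithin_initial hT₀ (by linarith) hμ ⟨ht.1, h1⟩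
    rw [e1, e2]
    have hb0 : 0 ≤ 1 - t / T₀ := by rw [sub_nonneg, div_le_one hT₀]; exact h1
    have hb1 : 1 - t / T₀ ≤ 1 := by linarith [div_nonneg ht.1 hT₀.le]
    have p0 := Real.rpow_nonneg hb0 (μ - 1)
    have p1 := Real.rpow_le_one hb0 hb1 (show 0 ≤ μ - 1 by linarith)
    have q0 := Real.rpow_nonneg hb0 (μ - 2)
    have q1 := Real.rpow_le_one hb0 hb1 (show 0 ≤ μ - 2 by linarith)
    refine ⟨?_, ?_, ?_⟩
    · have g1 : 0 ≤ μ / T₀ * (1 - t / T₀) ^ (μ - 1) := by positivity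
      have g2 : 0 ≤ K * θ μ t ^ 2 := by positivity
      linarith
    · rw [abs_mul, abs_neg, abs_of_nonneg (by positivity : 0 ≤ μ / T₀), abs_of_nonneg p0]
      calc μ / T₀ * (1 - t / T₀) ^ (μ - 1) ≤ μ / T₀ * 1 := by gcongr
        _ = 1 / T₀ * μ * 1 := by ring
        _ ≤ K * μ * θ μ t ^ 2 := by gcongr
    · have hμ1' : 0 ≤ μ - 1 := by linarith
      rw [abs_of_nonneg (by positivity)]
      calc μ / T₀ * ((μ - 1) / T₀) * (1 - t / T₀) ^ (μ - 2) ≤ μ / T₀ * (μ / T₀) * 1 := by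
            gcongr; linarith
        _ = 1 / T₀ ^ 2 * μ ^ 2 * 1 := by field_simp
        _ ≤ K * μ ^ 2 * θ μ t ^ 3 := by gcongr
  rcases le_total t (T - 2 * T₁) with h2 | h2
  · obtain ⟨e1, e2⟩ := hw.derivWithin_middle hT₀ hT₁ hT ⟨h1, h2⟩
    rw [e1, e2]
    exact fromPos 0 0 0 le_rfl hK0 (by simp) (by simp)
  rcases le_or_gt (T - T₁) t with h3 | h3
  · obtain ⟨e1, e2⟩ := hw.derivWithin_final (by linarith) ⟨h3, ht.2⟩
    have hx0 : 0 < T - t := by linarith [ht.2]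
    have hx1 : T - t ≤ 1 := by linarith
    have eθ : θ μ t = (T - t) ^ (-m) := by
      rw [hw.eq_final t ⟨h3, ht.2⟩, Real.rpow_neg hx0.le, one_div]
    have k1 : (T - t) ^ (-m - 1) ≤ θ μ t ^ 2 := by
      rw [eθ, ← Real.rpow_natCast, ← Real.rpow_mul hx0.le]
      exact Real.rpow_le_rpow_of_exponent_ge hx0 hx1 (by push_cast; linarith)
    have k2 : (T - t) ^ (-m - 2) ≤ θ μ t ^ 3 := by
      rw [eθ, ← Real.rpow_natCast, ← Real.rpow_mul hx0.le]
      exact Real.rpow_le_rpow_of_exponent_ge hx0 hx1 (by push_cast; linarith)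
    rw [e1, e2]
    have hm0 : 0 < m := by linarith
    refine fromPos _ _ (m * (m + 1)) (by positivity) hK4 ?_ ?_
    · rw [abs_of_nonneg (by positivity)]
      have : m ≤ m * (m + 1) := by nlinarith
      gcongr
    · rw [abs_of_nonneg (by positivity)]
      gcongr
  · obtain ⟨e1, e2⟩ := IsTimeWeight.derivWithin_interior (θ := θ μ) (T := T) (t := t)
      ⟨by linarith, ht.2⟩
    obtain ⟨b1, b2⟩ := hK₀ μ hμ t ⟨h2, h3.le⟩
    rw [e1, e2]
    have hK₀0 : 0 ≤ K₀ := (abs_nonneg _).trans b1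
    exact fromPos _ _ K₀ hK₀0 hK3 (b1.trans (le_mul_of_one_le_right hK₀0 hθ2))
      (b2.trans (le_mul_of_one_le_right hK₀0 hθ3))

theorem IsTimeWeight.apply_zero {T T₀ T₁ m μ : ℝ} {θ : ℝ → ℝ} (h : IsTimeWeight T T₀ T₁ m μ θ)
    (hT₀ : 0 < T₀) : θ 0 = 2 := by
  rw [h.eq_initial 0 ⟨le_rfl, hT₀.le⟩]
  norm_num

theorem IsTimeWeight.derivWithin_zero {T T₀ T₁ m μ : ℝ} {θ : ℝ → ℝ}
    (h : IsTimeWeight T T₀ T₁ m μ θ) (hT₀ : 0 < T₀) (hT₀T : T₀ < T) (hμ : 2 < μ) :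
    derivWithin θ (Ico 0 T) 0 = -(μ / T₀) := by
  rw [(h.derivWithin_initial hT₀ hT₀T hμ ⟨le_rfl, hT₀.le⟩).1]
  norm_num

theorem IsTimeWeight.tendsto_atTop {T T₀ T₁ m μ : ℝ} {θ : ℝ → ℝ}
    (h : IsTimeWeight T T₀ T₁ m μ θ) (hT₁ : 0 < T₁) (hm : 1 ≤ m) :
    Tendsto θ (𝓝[<] T) atTop := by
  have h1 : Tendsto (fun t => (T - t) ^ (-m)) (𝓝[<] T) atTop := by
    have h2 : Tendsto (fun t : ℝ => T - t) (𝓝[<] T) (𝓝[>] 0) := by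
      refine tendsto_nhdsWithin_iff.mpr ⟨?_, ?_⟩
      · have : Tendsto (fun t : ℝ => T - t) (𝓝 T) (𝓝 (T - T)) := tendsto_const_nhds.sub tendsto_id
        rw [sub_self] at this
        exact this.mono_left nhdsWithin_le_nhds
      · filter_upwards [self_mem_nhdsWithin] with t ht
        have : t < T := ht
        exact sub_pos.mpr this
    exact (tendsto_rpow_neg_nhdsGT_zero (by linarith)).comp h2
  refine h1.congr' ?_
  have : Ico (T - T₁) T ∈ 𝓝[<] T := Ico_mem_nhdsLT (by linarith)
  filter_upwards [this] with t ht
  rw [h.eq_final t ht, Real.rpow_neg (by linarith [ht.2]), one_div]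

/-! ### The weights and the conjugated function -/

/-- `f` and its partial derivatives of order at most two are bounded by `M` on `S`. -/
def BoundedC2 (S : Set (ℝ × Plane)) (M : ℝ) (f : ℝ × Plane → ℝ) : Prop :=
  ∀ p ∈ S, |f p| ≤ M ∧ ∀ u v : ℝ × Plane, ‖u‖ ≤ 1 → ‖v‖ ≤ 1 →
    |pd S u f p| ≤ M ∧ |pd S u (pd S v f) p| ≤ M

theorem BoundedC2.mono {S : Set (ℝ × Plane)} {M M' : ℝ} {f : ℝ × Plane → ℝ}
    (h : BoundedC2 S M f) (hM : M ≤ M') : BoundedC2 S M' f := fun p hp =>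
  ⟨(h p hp).1.trans hM, fun u v hu hv =>
    ⟨((h p hp).2 u v hu hv).1.trans hM, ((h p hp).2 u v hu hv).2.trans hM⟩⟩

theorem norm_et_le : ‖et‖ ≤ 1 := by simp [et, Prod.norm_def]

theorem norm_es_le (i : Fin 2) : ‖es i‖ ≤ 1 := by simp [es, ex, Prod.norm_def]

section

variable {T : ℝ} {O : Set Plane} {ρ : Plane → ℝ}

theorem halfCylinder_eq_inter :
    halfCylinder T O = closedCylinder T O ∩ {p : ℝ × Plane | p.1 < T} := by
  ext ⟨t, x⟩
  simp only [halfCylinder, closedCylinder, mem_prod, mem_Ico, mem_Icc, mem_inter_iff, mem_ofPred_eq]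
  constructor
  · rintro ⟨⟨h1, h2⟩, h3⟩; exact ⟨⟨⟨h1, h2.le⟩, h3⟩, h2⟩
  · rintro ⟨⟨⟨h1, h2⟩, h3⟩, h4⟩; exact ⟨⟨h1, h4⟩, h3⟩

theorem pd_halfCylinder_eq {f : ℝ × Plane → ℝ} {v p : ℝ × Plane} (hp : p ∈ halfCylinder T O) :
    pd (halfCylinder T O) v f p = pd (closedCylinder T O) v f p := by
  rw [halfCylinder_eq_inter]
  exact pd_congr_set ((isOpen_lt continuous_fst continuous_const).mem_nhds hp.1.2)

theorem exists_boundedC2 (hO : IsBoundedC2Domain O ρ) (hT : 0 < T) {f : ℝ × Plane → ℝ}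
    (hf : ContDiffOn ℝ 2 f (closedCylinder T O)) :
    ∃ M, BoundedC2 (halfCylinder T O) M f := by
  have hD : UniqueDiffOn ℝ (closedCylinder T O) :=
    (uniqueDiffOn_Icc hT).prod hO.uniqueDiffOn_closure
  have hcomp : IsCompact (closedCylinder T O) := isCompact_Icc.prod hO.isCompact_closure
  have hf1 : ContDiffOn ℝ 1 (fderivWithin ℝ f (closedCylinder T O)) (closedCylinder T O) :=
    hf.fderivWithin hD (by norm_num)
  have hf2 : ContinuousOn (fderivWithin ℝ (fderivWithin ℝ f (closedCylinder T O))
      (closedCylinder T O)) (closedCylinder T O) :=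
    (hf1.fderivWithin (m := 0) hD (by norm_num)).continuousOn
  obtain ⟨M₀, h₀⟩ := hcomp.exists_bound_of_continuousOn hf.continuousOn
  obtain ⟨M₁, h₁⟩ := hcomp.exists_bound_of_continuousOn hf1.continuousOn
  -- continuity on the compact set of all `(p, u, v)` with `‖u‖, ‖v‖ ≤ 1`
  have hB := isCompact_closedBall (0 : ℝ × Plane) 1
  have hf3 : ContinuousOn (fun q : (ℝ × Plane) × (ℝ × Plane) × (ℝ × Plane) =>
      fderivWithin ℝ (fderivWithin ℝ f (closedCylinder T O)) (closedCylinder T O) q.1 q.2.1 q.2.2)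
      (closedCylinder T O ×ˢ Metric.closedBall 0 1 ×ˢ Metric.closedBall 0 1) :=
    ((hf2.comp continuousOn_fst (fun _ hq => hq.1)).clm_apply
      (continuousOn_fst.comp continuousOn_snd (mapsTo_univ _ _))).clm_apply
      (continuousOn_snd.comp continuousOn_snd (mapsTo_univ _ _))
  obtain ⟨M₂, h₂⟩ := (hcomp.prod (hB.prod hB)).exists_bound_of_continuousOn hf3
  refine ⟨max M₀ (max M₁ M₂), fun p hp => ?_⟩
  have hpD := halfCylinder_subset_closedCylinder hp
  refine ⟨(h₀ p hpD).trans (le_max_left _ _), fun u v hu hv => ⟨?_, ?_⟩⟩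
  · rw [pd_halfCylinder_eq hp]
    refine ((fderivWithin ℝ f (closedCylinder T O) p).le_opNorm u).trans ?_
    refine (mul_le_of_le_one_right (norm_nonneg _) hu).trans ?_
    exact (h₁ p hpD).trans ((le_max_left _ _).trans (le_max_right _ _))
  · rw [pd_congr (g := pd (closedCylinder T O) v f) (fun q hq => pd_halfCylinder_eq hq) hp,
      pd_halfCylinder_eq hp, pd_pd_eq hf hD hpD]
    exact (h₂ (p, u, v) ⟨hpD, by simpa using hu, by simpa using hv⟩).trans
      ((le_max_right _ _).trans (le_max_right _ _))

theorem cylinder_subset_interior_halfCylinder (hO : IsBoundedC2Domain O ρ) :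
    cylinder T O ⊆ interior (halfCylinder T O) :=
  interior_maximal cylinder_subset_halfCylinder (hO.isOpen_cylinder T)

theorem hasPD_time {g : ℝ → ℝ} {g' : ℝ} {p v : ℝ × Plane}
    (hg : HasDerivWithinAt g g' (Ico 0 T) p.1) :
    HasPD (halfCylinder T O) v (fun q => g q.1) (g' * v.1) p := by
  have h := hg.hasFDerivWithinAt.comp p (hasFDerivWithinAt_fst (s := halfCylinder T O))
    (fun _ hq => hq.1)
  refine ⟨_, h, ?_⟩
  simp [mul_comm]

/-- The weight `ξ = Θ e^{λψ}` for a general time profile `Θ`. -/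
noncomputable def xiOf (lam : ℝ) (Θ : ℝ → ℝ) (ψ : ℝ × Plane → ℝ) (p : ℝ × Plane) : ℝ :=
  Θ p.1 * Real.exp (lam * ψ p)

/-- The weight `φ = Θ (L - e^{λψ})`; the constant `L` is `λ e^{6λ(m+1)}` in the application. -/
noncomputable def phiOf (lam L : ℝ) (Θ : ℝ → ℝ) (ψ : ℝ × Plane → ℝ) (p : ℝ × Plane) : ℝ :=
  Θ p.1 * (L - Real.exp (lam * ψ p))

/-- The time derivative `∂ₜφ = Θ' (L - e^{λψ}) - λ ξ ∂ₜψ`. -/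
noncomputable def phiTOf (T : ℝ) (O : Set Plane) (lam L : ℝ) (Θ : ℝ → ℝ) (ψ : ℝ × Plane → ℝ)
    (p : ℝ × Plane) : ℝ :=
  derivWithin Θ (Ico 0 T) p.1 * (L - Real.exp (lam * ψ p))
    - lam * xiOf lam Θ ψ p * pd (halfCylinder T O) et ψ p

/-- The conjugated function `w = e^{-sφ} z`. -/
noncomputable def conjOf (s lam L : ℝ) (Θ : ℝ → ℝ) (ψ z : ℝ × Plane → ℝ) (p : ℝ × Plane) : ℝ :=
  Real.exp (-s * phiOf lam L Θ ψ p) * z p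

section Weights

variable {Θ : ℝ → ℝ} {ψ z : ℝ × Plane → ℝ} {s lam L : ℝ} {p : ℝ × Plane}

local notation "S" => halfCylinder T O

theorem hasPD_exp_weight (lam : ℝ) (hψ : ContDiffOn ℝ 2 ψ S) (hp : p ∈ S) (v : ℝ × Plane) :
    HasPD S v (fun q => Real.exp (lam * ψ q)) (lam * Real.exp (lam * ψ p) * pd S v ψ p) p :=
  (((hasPD_pd hψ two_ne_zero hp).const_mul lam).exp).congr_deriv (by ring)

theorem hasPD_xiOf (lam : ℝ) (hΘ : ContDiffOn ℝ 2 Θ (Ico 0 T)) (hψ : ContDiffOn ℝ 2 ψ S)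
    (hp : p ∈ S) (v : ℝ × Plane) :
    HasPD S v (xiOf lam Θ ψ) (derivWithin Θ (Ico 0 T) p.1 * v.1 * Real.exp (lam * ψ p)
      + lam * xiOf lam Θ ψ p * pd S v ψ p) p := by
  have h1 := hasPD_time (O := O) (v := v)
    (hΘ.differentiableOn two_ne_zero p.1 hp.1).hasDerivWithinAt
  exact (h1.mul (hasPD_exp_weight lam hψ hp v)).congr_deriv (by simp only [xiOf]; ring)

theorem hasPD_phiOf (lam L : ℝ) (hΘ : ContDiffOn ℝ 2 Θ (Ico 0 T)) (hψ : ContDiffOn ℝ 2 ψ S)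
    (hp : p ∈ S) (v : ℝ × Plane) :
    HasPD S v (phiOf lam L Θ ψ) (derivWithin Θ (Ico 0 T) p.1 * v.1 * (L - Real.exp (lam * ψ p))
      - lam * xiOf lam Θ ψ p * pd S v ψ p) p := by
  have h1 := hasPD_time (O := O) (v := v)
    (hΘ.differentiableOn two_ne_zero p.1 hp.1).hasDerivWithinAt
  exact (h1.mul ((hasPD_const L).sub (hasPD_exp_weight lam hψ hp v))).congr_deriv
    (by simp only [xiOf]; ring)

theorem hasPD_phiTOf (lam L : ℝ) (hS : UniqueDiffOn ℝ S) (hΘ : ContDiffOn ℝ 2 Θ (Ico 0 T))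
    (hψ : ContDiffOn ℝ 2 ψ S) (hp : p ∈ S) (v : ℝ × Plane) :
    HasPD S v (phiTOf T O lam L Θ ψ)
      (derivWithin (derivWithin Θ (Ico 0 T)) (Ico 0 T) p.1 * v.1 * (L - Real.exp (lam * ψ p))
        - derivWithin Θ (Ico 0 T) p.1 * (lam * Real.exp (lam * ψ p) * pd S v ψ p)
        - lam * ((derivWithin Θ (Ico 0 T) p.1 * v.1 * Real.exp (lam * ψ p)
            + lam * xiOf lam Θ ψ p * pd S v ψ p) * pd S et ψ p
          + xiOf lam Θ ψ p * pd S v (pd S et ψ) p)) p := by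
  have hΘ1 : ContDiffOn ℝ 1 (derivWithin Θ (Ico 0 T)) (Ico 0 T) :=
    hΘ.derivWithin (uniqueDiffOn_Ico 0 T) (by norm_num)
  have h1 := hasPD_time (O := O) (v := v)
    (hΘ1.differentiableOn one_ne_zero p.1 hp.1).hasDerivWithinAt
  have h2 : HasPD S v (pd S et ψ) (pd S v (pd S et ψ) p) p :=
    hasPD_pd (contDiffOn_pd (m := 1) hψ hS (by norm_num)) one_ne_zero hp
  have h3 := (h1.mul ((hasPD_const L).sub (hasPD_exp_weight lam hψ hp v))).sub
    (((hasPD_xiOf lam hΘ hψ hp v).const_mul lam).mul h2)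
  exact h3.congr_deriv (by ring)

theorem contDiffOn_time {n : WithTop ℕ∞} {g : ℝ → ℝ} (hg : ContDiffOn ℝ n g (Ico 0 T)) :
    ContDiffOn ℝ n (fun q : ℝ × Plane => g q.1) S :=
  hg.comp contDiffOn_fst (fun _ hq => hq.1)

theorem contDiffOn_xiOf (lam : ℝ) (hΘ : ContDiffOn ℝ 2 Θ (Ico 0 T)) (hψ : ContDiffOn ℝ 2 ψ S) :
    ContDiffOn ℝ 2 (xiOf lam Θ ψ) S :=
  (contDiffOn_time hΘ).mul (contDiffOn_const.mul hψ).exp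

theorem contDiffOn_phiOf (lam L : ℝ) (hΘ : ContDiffOn ℝ 2 Θ (Ico 0 T))
    (hψ : ContDiffOn ℝ 2 ψ S) : ContDiffOn ℝ 2 (phiOf lam L Θ ψ) S :=
  (contDiffOn_time hΘ).mul (contDiffOn_const.sub (contDiffOn_const.mul hψ).exp)

theorem contDiffOn_phiTOf (lam L : ℝ) (hS : UniqueDiffOn ℝ S) (hΘ : ContDiffOn ℝ 2 Θ (Ico 0 T))
    (hψ : ContDiffOn ℝ 2 ψ S) : ContDiffOn ℝ 1 (phiTOf T O lam L Θ ψ) S := by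
  have hΘ1 : ContDiffOn ℝ 1 (derivWithin Θ (Ico 0 T)) (Ico 0 T) :=
    hΘ.derivWithin (uniqueDiffOn_Ico 0 T) (by norm_num)
  have hψ1 : ContDiffOn ℝ 1 ψ S := hψ.of_le (by norm_num)
  have hξ1 : ContDiffOn ℝ 1 (xiOf lam Θ ψ) S := (contDiffOn_xiOf lam hΘ hψ).of_le (by norm_num)
  exact ((contDiffOn_time hΘ1).mul (contDiffOn_const.sub (contDiffOn_const.mul hψ1).exp)).sub
    ((contDiffOn_const.mul hξ1).mul (contDiffOn_pd hψ hS (by norm_num)))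

theorem contDiffOn_conjOf (s lam L : ℝ) (hΘ : ContDiffOn ℝ 2 Θ (Ico 0 T)) (hψ : ContDiffOn ℝ 2 ψ S)
    (hz : ContDiffOn ℝ 2 z S) : ContDiffOn ℝ 2 (conjOf s lam L Θ ψ z) S :=
  (contDiffOn_const.mul (contDiffOn_phiOf lam L hΘ hψ)).exp.mul hz

theorem hasPD_conjOf (s lam L : ℝ) (hΘ : ContDiffOn ℝ 2 Θ (Ico 0 T)) (hψ : ContDiffOn ℝ 2 ψ S)
    (hz : ContDiffOn ℝ 2 z S) (hp : p ∈ S) (v : ℝ × Plane) :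
    HasPD S v (conjOf s lam L Θ ψ z) (Real.exp (-s * phiOf lam L Θ ψ p) *
      (pd S v z p - s * (derivWithin Θ (Ico 0 T) p.1 * v.1 * (L - Real.exp (lam * ψ p))
      - lam * xiOf lam Θ ψ p * pd S v ψ p) * z p)) p :=
  ((((hasPD_phiOf lam L hΘ hψ hp v).const_mul (-s)).exp).mul
    (hasPD_pd hz two_ne_zero hp)).congr_deriv (by ring)

theorem pd_conjOf_space (s lam L : ℝ) (hS : UniqueDiffOn ℝ S) (hΘ : ContDiffOn ℝ 2 Θ (Ico 0 T))
    (hψ : ContDiffOn ℝ 2 ψ S) (hz : ContDiffOn ℝ 2 z S) (hp : p ∈ S) (i : Fin 2) :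
    pd S (es i) (conjOf s lam L Θ ψ z) p = Real.exp (-s * phiOf lam L Θ ψ p) *
      (pd S (es i) z p + s * lam * xiOf lam Θ ψ p * pd S (es i) ψ p * z p) := by
  rw [(hasPD_conjOf s lam L hΘ hψ hz hp (es i)).pd_eq hS hp]
  simp only [es]
  ring

theorem pd_conjOf_time (s lam L : ℝ) (hS : UniqueDiffOn ℝ S) (hΘ : ContDiffOn ℝ 2 Θ (Ico 0 T))
    (hψ : ContDiffOn ℝ 2 ψ S) (hz : ContDiffOn ℝ 2 z S) (hp : p ∈ S) :
    pd S et (conjOf s lam L Θ ψ z) p = Real.exp (-s * phiOf lam L Θ ψ p) *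
      (pd S et z p - s * phiTOf T O lam L Θ ψ p * z p) := by
  rw [(hasPD_conjOf s lam L hΘ hψ hz hp et).pd_eq hS hp]
  simp only [et, phiTOf]
  ring

theorem pd_pd_conjOf_space (s lam L : ℝ) (hS : UniqueDiffOn ℝ S) (hΘ : ContDiffOn ℝ 2 Θ (Ico 0 T))
    (hψ : ContDiffOn ℝ 2 ψ S) (hz : ContDiffOn ℝ 2 z S) (hp : p ∈ S) (i : Fin 2) :
    pd S (es i) (pd S (es i) (conjOf s lam L Θ ψ z)) p = Real.exp (-s * phiOf lam L Θ ψ p) *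
      (pd S (es i) (pd S (es i) z) p
        + 2 * (s * lam * xiOf lam Θ ψ p * pd S (es i) ψ p) * pd S (es i) z p
        + (s * lam * xiOf lam Θ ψ p * pd S (es i) ψ p) ^ 2 * z p
        + s * lam * xiOf lam Θ ψ p * (lam * pd S (es i) ψ p ^ 2
          + pd S (es i) (pd S (es i) ψ) p) * z p) := by
  rw [pd_congr (fun q hq => pd_conjOf_space s lam L hS hΘ hψ hz hq i) hp]
  have hE := ((hasPD_phiOf lam L hΘ hψ hp (es i)).const_mul (-s)).exp
  have hξ := hasPD_xiOf lam hΘ hψ hp (es i)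
  have hψi : HasPD S (es i) (pd S (es i) ψ) (pd S (es i) (pd S (es i) ψ) p) p :=
    hasPD_pd (contDiffOn_pd (m := 1) hψ hS (by norm_num)) one_ne_zero hp
  have hzi : HasPD S (es i) (pd S (es i) z) (pd S (es i) (pd S (es i) z) p) p :=
    hasPD_pd (contDiffOn_pd (m := 1) hz hS (by norm_num)) one_ne_zero hp
  have hz0 := hasPD_pd (v := es i) hz two_ne_zero hp
  have h := hE.mul (hzi.add (((hξ.const_mul (s * lam)).mul hψi).mul hz0))
  rw [h.pd_eq hS hp]
  simp only [es]
  ring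

/-- Conjugating the heat operator by `e^{-sφ}`: the even and odd parts, and a lower-order term. -/
theorem exp_mul_heat_eq (ν s lam L ε : ℝ) (σ : ℝ × Plane → ℝ) (hS : UniqueDiffOn ℝ S)
    (hΘ : ContDiffOn ℝ 2 Θ (Ico 0 T)) (hψ : ContDiffOn ℝ 2 ψ S) (hz : ContDiffOn ℝ 2 z S)
    (hp : p ∈ S) :
    Real.exp (-s * phiOf lam L Θ ψ p) * (-σ p * pd S et z p
      - ν * (pd S (es 0) (pd S (es 0) z) p + pd S (es 1) (pd S (es 1) z) p)) =
    symmPart ν s lam (xiOf lam Θ ψ p) (phiTOf T O lam L Θ ψ p) (σ p) (pd S (es 0) ψ p)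
      (pd S (es 1) ψ p) (conjOf s lam L Θ ψ z p)
      (pd S (es 0) (pd S (es 0) (conjOf s lam L Θ ψ z)) p
        + pd S (es 1) (pd S (es 1) (conjOf s lam L Θ ψ z)) p)
    + skewPart ν s lam ε (xiOf lam Θ ψ p) (σ p) (pd S (es 0) ψ p) (pd S (es 1) ψ p)
      (conjOf s lam L Θ ψ z p) (pd S et (conjOf s lam L Θ ψ z) p)
      (pd S (es 0) (conjOf s lam L Θ ψ z) p) (pd S (es 1) (conjOf s lam L Θ ψ z) p)
    + s * ν * lam * xiOf lam Θ ψ p * ((pd S (es 0) (pd S (es 0) ψ) p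
      + pd S (es 1) (pd S (es 1) ψ) p) - lam * (pd S (es 0) ψ p ^ 2 + pd S (es 1) ψ p ^ 2 + ε))
      * conjOf s lam L Θ ψ z p := by
  rw [pd_pd_conjOf_space s lam L hS hΘ hψ hz hp, pd_pd_conjOf_space s lam L hS hΘ hψ hz hp,
    pd_conjOf_time s lam L hS hΘ hψ hz hp, pd_conjOf_space s lam L hS hΘ hψ hz hp,
    pd_conjOf_space s lam L hS hΘ hψ hz hp]
  simp only [symmPart, skewPart, conjOf]
  ring

end Weights

end

/-! ### The inequality up to a time before `T` -/

/-- The bounds on a time profile `Θ` that the Carleman estimate uses; `μ` is the parameter of the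
family. The sharper bound, without `μ`, is one-sided: `Θ'` may be very negative. -/
def TimeBounds (T K μ : ℝ) (Θ : ℝ → ℝ) : Prop :=
  ∀ t ∈ Ico 0 T, 1 ≤ Θ t ∧ derivWithin Θ (Ico 0 T) t ≤ K * Θ t ^ 2 ∧
    |derivWithin Θ (Ico 0 T) t| ≤ K * μ * Θ t ^ 2 ∧
    |derivWithin (derivWithin Θ (Ico 0 T)) (Ico 0 T) t| ≤ K * μ ^ 2 * Θ t ^ 3

section

variable {T : ℝ} {O : Set Plane} {ρ : Plane → ℝ}

/-- The component along the `i`-th axis of the spatial flux attached to `w`. -/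
noncomputable def fluxOf (T : ℝ) (O : Set Plane) (ν s lam ε L : ℝ) (Θ : ℝ → ℝ)
    (σ ψ w : ℝ × Plane → ℝ) (i : Fin 2) : ℝ × Plane → ℝ :=
  flux ν s lam ε σ (xiOf lam Θ ψ) (phiTOf T O lam L Θ ψ)
    (pd (halfCylinder T O) (es 0) ψ) (pd (halfCylinder T O) (es 1) ψ) w
    (pd (halfCylinder T O) et w) (pd (halfCylinder T O) (es 0) w) (pd (halfCylinder T O) (es 1) w)
    (pd (halfCylinder T O) (es i) ψ) (pd (halfCylinder T O) (es i) w)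

/-- The energy density attached to `w`. -/
noncomputable def energyOf (T : ℝ) (O : Set Plane) (ν s lam L : ℝ) (Θ : ℝ → ℝ)
    (σ ψ w : ℝ × Plane → ℝ) : ℝ × Plane → ℝ :=
  energy ν s lam σ (xiOf lam Θ ψ) (phiTOf T O lam L Θ ψ)
    (pd (halfCylinder T O) (es 0) ψ) (pd (halfCylinder T O) (es 1) ψ) w
    (pd (halfCylinder T O) (es 0) w) (pd (halfCylinder T O) (es 1) w)

/-- The heat operator with derivatives taken within `[0,T) × closure O`. -/
noncomputable def heatPD (T : ℝ) (O : Set Plane) (ν : ℝ) (σ z : ℝ × Plane → ℝ)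
    (p : ℝ × Plane) : ℝ :=
  -σ p * pd (halfCylinder T O) et z p
    - ν * (pd (halfCylinder T O) (es 0) (pd (halfCylinder T O) (es 0) z) p
      + pd (halfCylinder T O) (es 1) (pd (halfCylinder T O) (es 1) z) p)

variable {Θ : ℝ → ℝ} {σ ψ z : ℝ × Plane → ℝ} {ν m s lam ε c M K r : ℝ}

/-- The pointwise Carleman inequality for the functions at hand, at an interior point. -/
theorem pointwise_carleman_of_bounds (hO : IsBoundedC2Domain O ρ)
    (hΘ : ContDiffOn ℝ 2 Θ (Ico 0 T)) (hψ : ContDiffOn ℝ 2 ψ (halfCylinder T O))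
    (hσ : ContDiffOn ℝ 2 σ (halfCylinder T O)) (hz : ContDiffOn ℝ 2 z (halfCylinder T O))
    (hM : 1 ≤ M) (hr : 1 ≤ r) (hs : r ≤ s) (hl : r ≤ lam)
    (hν0 : 0 < ν) (hν : ν ≤ M) (hε0 : 0 < ε) (hε : ε ≤ 1)
    (hσM : BoundedC2 (halfCylinder T O) M σ) (hψM : BoundedC2 (halfCylinder T O) M ψ)
    (hσ1 : ∀ p ∈ halfCylinder T O, 1 ≤ M * σ p)
    (hc0 : 0 < c) (hc1 : c ≤ ν ^ 2 * ε) (hc2 : c ≤ 2 * ν ^ 2 * ε ^ 2) (hc3 : c * M ≤ ν * ε)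
    (hrc : 270 * M ^ 8 ≤ c * r)
    (hK : 0 ≤ K) (hKM : K ≤ M) (hm : 1 ≤ m) (hTB : TimeBounds T K (muParam m s lam) Θ)
    (hψm : ∀ p ∈ halfCylinder T O, 6 * m ≤ ψ p ∧ ψ p ≤ 6 * m + 1)
    {L : ℝ} (hL : L = lam * Real.exp (6 * lam * (m + 1))) {χ : ℝ} (hχ : 0 ≤ χ)
    {p : ℝ × Plane} (hp : p ∈ cylinder T O)
    (hχ' : χ = 1 ∨ 2 * ε ≤ pd (halfCylinder T O) (es 0) ψ p ^ 2
      + pd (halfCylinder T O) (es 1) ψ p ^ 2) :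
    ((∑ i, pd (halfCylinder T O) (es i)
        (fluxOf T O ν s lam ε L Θ σ ψ (conjOf s lam L Θ ψ z) i) p)
      + pd (halfCylinder T O) et (energyOf T O ν s lam L Θ σ ψ (conjOf s lam L Θ ψ z)) p)
      + c / (10 * M ^ 2) * (s * lam ^ 2 * (xiOf lam Θ ψ p * (pd (halfCylinder T O) (es 0) z p ^ 2
          + pd (halfCylinder T O) (es 1) z p ^ 2) * Real.exp (-s * phiOf lam L Θ ψ p) ^ 2)
        + s ^ 3 * lam ^ 4 * (xiOf lam Θ ψ p ^ 3 * z p ^ 2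
          * Real.exp (-s * phiOf lam L Θ ψ p) ^ 2))
      ≤ (Real.exp (-s * phiOf lam L Θ ψ p) * heatPD T O ν σ z p) ^ 2
        + 2 * M ^ 2 * (χ * (s ^ 3 * lam ^ 4 * (xiOf lam Θ ψ p ^ 3 * z p ^ 2
          * Real.exp (-s * phiOf lam L Θ ψ p) ^ 2))) := by
  have hS : UniqueDiffOn ℝ (halfCylinder T O) := uniqueDiffOn_halfCylinder hO
  have hpS : p ∈ halfCylinder T O := cylinder_subset_halfCylinder hp
  have hpi : p ∈ closure (interior (halfCylinder T O)) :=
    subset_closure (cylinder_subset_interior_halfCylinder hO hp)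
  have hw := contDiffOn_conjOf s lam L hΘ hψ hz
  set w := conjOf s lam L Θ ψ z with hwdef
  set S := halfCylinder T O with hSdef
  have first : ∀ {f : ℝ × Plane → ℝ} (_ : ContDiffOn ℝ 2 f S) (v : ℝ × Plane),
      HasPD S v f (pd S v f p) p := fun hf v => hasPD_pd hf two_ne_zero hpS
  have second : ∀ {f : ℝ × Plane → ℝ} (_ : ContDiffOn ℝ 2 f S) (u v : ℝ × Plane),
      HasPD S u (pd S v f) (pd S u (pd S v f) p) p := fun hf u v =>
    hasPD_pd (contDiffOn_pd (m := 1) hf hS (by norm_num)) one_ne_zero hpS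
  have swap : ∀ {f : ℝ × Plane → ℝ} (_ : ContDiffOn ℝ 2 f S) (u v : ℝ × Plane),
      HasPD S u (pd S v f) (pd S v (pd S u f) p) p := fun hf u v =>
    (second hf u v).congr_deriv (pd_comm hf hS hpS hpi)
  obtain ⟨hθ, hb1, hb2, hb3⟩ := hTB p.1 hpS.1
  obtain ⟨hξ1, ht1, ht1', hP', hT2⟩ := weight_scales hK hKM hm (hr.trans hs) (hr.trans hl) hθ
    (hψm p hpS).1 (hψm p hpS).2 hb1 hb2 hb3
  rw [← hL] at hP' hT2
  set E := L - Real.exp (lam * ψ p) with hE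
  set θ₁ := derivWithin Θ (Ico 0 T) p.1 with hθ₁
  set θ₂ := derivWithin (derivWithin Θ (Ico 0 T)) (Ico 0 T) p.1 with hθ₂
  have hq : phiTOf T O lam L Θ ψ p = -max (-(θ₁ * E)) 0 + max (θ₁ * E) 0
      - lam * xiOf lam Θ ψ p * pd S et ψ p := by
    have := max_zero_sub_max_neg_zero_eq_self (θ₁ * E)
    simp only [phiTOf]
    linarith
  have hid := symmPart_mul_skewPart_eq (S := S) (p := p) (σ := σ) (ξ := xiOf lam Θ ψ)
    (q := phiTOf T O lam L Θ ψ) (ψ₁ := pd S (es 0) ψ) (ψ₂ := pd S (es 1) ψ) (w := w)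
    (wt := pd S et w) (w₁ := pd S (es 0) w) (w₂ := pd S (es 1) w) (lam := lam) ν s ε hS hpS
    (first hσ et) (first hσ (es 0)) (first hσ (es 1))
    (ξt := θ₁ * Real.exp (lam * ψ p) + lam * xiOf lam Θ ψ p * pd S et ψ p)
    ((hasPD_xiOf lam hΘ hψ hpS et).congr_deriv (by simp only [et]; ring))
    ((hasPD_xiOf lam hΘ hψ hpS (es 0)).congr_deriv (by simp only [es]; ring))
    ((hasPD_xiOf lam hΘ hψ hpS (es 1)).congr_deriv (by simp only [es]; ring))
    (qt := θ₂ * E - 2 * lam * (θ₁ * Real.exp (lam * ψ p)) * pd S et ψ p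
      - lam ^ 2 * xiOf lam Θ ψ p * pd S et ψ p ^ 2
      - lam * xiOf lam Θ ψ p * pd S et (pd S et ψ) p)
    ((hasPD_phiTOf lam L hS hΘ hψ hpS et).congr_deriv (by simp only [et]; ring))
    (q₁ := -(lam * (θ₁ * Real.exp (lam * ψ p)) * pd S (es 0) ψ p)
      - lam * (lam * xiOf lam Θ ψ p * pd S (es 0) ψ p * pd S et ψ p
        + xiOf lam Θ ψ p * pd S (es 0) (pd S et ψ) p))
    ((hasPD_phiTOf lam L hS hΘ hψ hpS (es 0)).congr_deriv (by simp only [es]; ring))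
    (q₂ := -(lam * (θ₁ * Real.exp (lam * ψ p)) * pd S (es 1) ψ p)
      - lam * (lam * xiOf lam Θ ψ p * pd S (es 1) ψ p * pd S et ψ p
        + xiOf lam Θ ψ p * pd S (es 1) (pd S et ψ) p))
    ((hasPD_phiTOf lam L hS hΘ hψ hpS (es 1)).congr_deriv (by simp only [es]; ring))
    (swap hψ et (es 0)) (second hψ (es 0) (es 0)) (second hψ (es 1) (es 0))
    (swap hψ et (es 1)) (swap hψ (es 0) (es 1)) (second hψ (es 1) (es 1))
    (first hw et) (first hw (es 0)) (first hw (es 1))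
    (second hw (es 0) et) (second hw (es 1) et)
    (swap hw et (es 0)) (second hw (es 0) (es 0)) (second hw (es 1) (es 0))
    (swap hw et (es 1)) (swap hw (es 0) (es 1)) (second hw (es 1) (es 1))
  have hf := exp_mul_heat_eq ν s lam L ε σ hS hΘ hψ hz hpS
  rw [hq] at hid hf
  have hψ1 := fun u v hu hv => ((hψM p hpS).2 u v hu hv).1
  have hψ2 := fun u v hu hv => ((hψM p hpS).2 u v hu hv).2
  have hσ' := fun u v hu hv => ((hσM p hpS).2 u v hu hv).1
  have ne := norm_et_le
  have n0 := norm_es_le 0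
  have n1 := norm_es_le 1
  rw [Fin.sum_univ_two]
  exact pointwise_carleman hM hr hs hl hξ1 hν0 hν hε0 hε (hσM p hpS).1 (hσ1 p hpS)
    (hσ' et et ne ne) (hσ' (es 0) et n0 ne) (hσ' (es 1) et n1 ne)
    (hψ1 et et ne ne) (hψ2 et et ne ne) (hψ1 (es 0) et n0 ne) (hψ1 (es 1) et n1 ne)
    (hψ2 (es 0) (es 0) n0 n0) (hψ2 (es 1) (es 0) n1 n0) (hψ2 (es 1) (es 1) n1 n1)
    (hψ2 (es 0) et n0 ne) (hψ2 (es 1) et n1 ne) ht1 ht1' (le_max_right _ _) (le_max_right _ _)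
    hP' hT2 hc0 hc1 hc2 hc3 hrc hχ hχ' rfl
    (pd_conjOf_space s lam L hS hΘ hψ hz hpS 0) (pd_conjOf_space s lam L hS hΘ hψ hz hpS 1)
    hid hf

theorem contDiffOn_fluxOf (hS : UniqueDiffOn ℝ (halfCylinder T O)) {L : ℝ} {w : ℝ × Plane → ℝ}
    (hΘ : ContDiffOn ℝ 2 Θ (Ico 0 T)) (hψ : ContDiffOn ℝ 2 ψ (halfCylinder T O))
    (hσ : ContDiffOn ℝ 2 σ (halfCylinder T O)) (hw : ContDiffOn ℝ 2 w (halfCylinder T O))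
    (i : Fin 2) :
    ContDiffOn ℝ 1 (fluxOf T O ν s lam ε L Θ σ ψ w i) (halfCylinder T O) := by
  have h1 : ContDiffOn ℝ 1 σ (halfCylinder T O) := hσ.of_le (by norm_num)
  have h2 : ContDiffOn ℝ 1 w (halfCylinder T O) := hw.of_le (by norm_num)
  have h3 : ContDiffOn ℝ 1 (xiOf lam Θ ψ) (halfCylinder T O) :=
    (contDiffOn_xiOf lam hΘ hψ).of_le (by norm_num)
  have h4 := contDiffOn_phiTOf lam L hS hΘ hψ
  have h5 : ∀ v, ContDiffOn ℝ 1 (pd (halfCylinder T O) v ψ) (halfCylinder T O) := fun v =>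
    contDiffOn_pd hψ hS (by norm_num)
  have h6 : ∀ v, ContDiffOn ℝ 1 (pd (halfCylinder T O) v w) (halfCylinder T O) := fun v =>
    contDiffOn_pd hw hS (by norm_num)
  have a0 := h5 (es 0)
  have a1 := h5 (es 1)
  have ai := h5 (es i)
  have b0 := h6 (es 0)
  have b1 := h6 (es 1)
  have bi := h6 (es i)
  have bt := h6 et
  unfold fluxOf flux
  fun_prop

theorem contDiffOn_energyOf (hS : UniqueDiffOn ℝ (halfCylinder T O)) {L : ℝ} {w : ℝ × Plane → ℝ}
    (hΘ : ContDiffOn ℝ 2 Θ (Ico 0 T)) (hψ : ContDiffOn ℝ 2 ψ (halfCylinder T O))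
    (hσ : ContDiffOn ℝ 2 σ (halfCylinder T O)) (hw : ContDiffOn ℝ 2 w (halfCylinder T O)) :
    ContDiffOn ℝ 1 (energyOf T O ν s lam L Θ σ ψ w) (halfCylinder T O) := by
  have h1 : ContDiffOn ℝ 1 σ (halfCylinder T O) := hσ.of_le (by norm_num)
  have h2 : ContDiffOn ℝ 1 w (halfCylinder T O) := hw.of_le (by norm_num)
  have h3 : ContDiffOn ℝ 1 (xiOf lam Θ ψ) (halfCylinder T O) :=
    (contDiffOn_xiOf lam hΘ hψ).of_le (by norm_num)
  have h4 := contDiffOn_phiTOf lam L hS hΘ hψ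
  have a0 : ContDiffOn ℝ 1 (pd (halfCylinder T O) (es 0) ψ) (halfCylinder T O) :=
    contDiffOn_pd hψ hS (by norm_num)
  have a1 : ContDiffOn ℝ 1 (pd (halfCylinder T O) (es 1) ψ) (halfCylinder T O) :=
    contDiffOn_pd hψ hS (by norm_num)
  have b0 : ContDiffOn ℝ 1 (pd (halfCylinder T O) (es 0) w) (halfCylinder T O) :=
    contDiffOn_pd hw hS (by norm_num)
  have b1 : ContDiffOn ℝ 1 (pd (halfCylinder T O) (es 1) w) (halfCylinder T O) :=
    contDiffOn_pd hw hS (by norm_num)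
  unfold energyOf energy
  fun_prop

theorem continuousOn_heatPD (hS : UniqueDiffOn ℝ (halfCylinder T O))
    (hσ : ContDiffOn ℝ 2 σ (halfCylinder T O)) (hz : ContDiffOn ℝ 2 z (halfCylinder T O)) :
    ContinuousOn (heatPD T O ν σ z) (halfCylinder T O) := by
  have h1 := hσ.continuousOn
  have h2 : ContinuousOn (pd (halfCylinder T O) et z) (halfCylinder T O) :=
    continuousOn_pd hz hS (by norm_num)
  have h3 : ∀ i, ContinuousOn (pd (halfCylinder T O) (es i) (pd (halfCylinder T O) (es i) z))
      (halfCylinder T O) := fun i =>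
    continuousOn_pd (contDiffOn_pd (m := 1) hz hS (by norm_num)) hS le_rfl
  have h4 := h3 0
  have h5 := h3 1
  unfold heatPD
  fun_prop

/-- On the lateral boundary, where `w` vanishes, the flux points outward: only the terms with
`∇w`, which is normal there, survive, and `∂ₙψ ≤ 0` gives their sign. -/
theorem fluxOf_boundary_nonneg (hO : IsBoundedC2Domain O ρ) {L : ℝ} {w : ℝ × Plane → ℝ}
    (hw : ContDiffOn ℝ 2 w (halfCylinder T O))
    (hΘ1 : ∀ t ∈ Ico 0 T, 0 ≤ Θ t) (hs : 0 ≤ s) (hl : 0 ≤ lam)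
    (hw0 : ∀ t ∈ Ioo 0 T, ∀ x ∈ frontier O, w (t, x) = 0)
    (hψn : ∀ t ∈ Ioo 0 T, ∀ x ∈ frontier O,
      ∑ i, pd (halfCylinder T O) (es i) ψ (t, x) * fderiv ℝ ρ x (ex i) ≤ 0)
    {t : ℝ} (ht : t ∈ Ioo 0 T) {x : Plane} (hx : x ∈ frontier O) :
    0 ≤ ∑ i, fluxOf T O ν s lam ε L Θ σ ψ w i (t, x) * fderiv ℝ ρ x (ex i) := by
  have htI : t ∈ Ico 0 T := Ioo_subset_Ico_self ht
  have hxc : x ∈ closure O := hx.1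
  have hpS : ((t, x) : ℝ × Plane) ∈ halfCylinder T O := ⟨htI, hxc⟩
  have hwt : pd (halfCylinder T O) et w (t, x) = 0 := by
    have h1 := (hasPD_pd (v := et) hw two_ne_zero hpS).hasDerivAt_time ht hxc
    have h2 : HasDerivAt (fun r => w (r, x)) 0 t := by
      refine (hasDerivAt_const t (0 : ℝ)).congr_of_eventuallyEq ?_
      filter_upwards [Ioo_mem_nhds ht.1 ht.2] with r hr using hw0 r hr x hx
    exact h1.unique h2
  have hpar : pd (halfCylinder T O) (es 0) w (t, x) * fderiv ℝ ρ x (ex 1)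
      = pd (halfCylinder T O) (es 1) w (t, x) * fderiv ℝ ρ x (ex 0) := by
    have h1 := hasFDerivWithinAt_space_slice htI
      ((hw.differentiableOn two_ne_zero _ hpS).hasFDerivWithinAt)
    have h2 := hO.fderivWithin_parallel hx h1 (fun y hy => hw0 t ht y hy)
    simpa [pd] using h2
  have hψx := hψn t ht x hx
  have hξ : 0 ≤ xiOf lam Θ ψ (t, x) := mul_nonneg (hΘ1 t htI) (Real.exp_pos _).le
  rw [Fin.sum_univ_two] at hψx ⊢
  simp only [fluxOf, flux, hwt, hw0 t ht x hx]
  set w₁ := pd (halfCylinder T O) (es 0) w (t, x)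
  set w₂ := pd (halfCylinder T O) (es 1) w (t, x)
  set ψ₁ := pd (halfCylinder T O) (es 0) ψ (t, x)
  set ψ₂ := pd (halfCylinder T O) (es 1) ψ (t, x)
  set g₁ := fderiv ℝ ρ x (ex 0)
  set g₂ := fderiv ℝ ρ x (ex 1)
  have key : (ψ₁ * w₁ + ψ₂ * w₂) * (w₁ * g₁ + w₂ * g₂)
      = (w₁ ^ 2 + w₂ ^ 2) * (ψ₁ * g₁ + ψ₂ * g₂) := by
    linear_combination (ψ₁ * w₂ - ψ₂ * w₁) * hpar
  have hnn : 0 ≤ (s * ν ^ 2 * lam) * xiOf lam Θ ψ (t, x) *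
      ((w₁ ^ 2 + w₂ ^ 2) * -(ψ₁ * g₁ + ψ₂ * g₂)) := by
    have : 0 ≤ -(ψ₁ * g₁ + ψ₂ * g₂) := by linarith
    positivity
  refine hnn.trans_eq ?_
  linear_combination (2 * (s * ν ^ 2 * lam) * xiOf lam Θ ψ (t, x)) * key

theorem measurableSet_of_isRelOpen (hO : IsBoundedC2Domain O ρ) {A : Set (ℝ × Plane)}
    (hA : IsRelOpen T O A) : MeasurableSet A := by
  obtain ⟨U, hU, rfl⟩ := hA
  exact hU.measurableSet.inter (measurableSet_Icc.prod hO.isOpen.measurableSet)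

/-- The Carleman inequality up to a time `T' < T`, with the energies at the times `0` and `T'`. -/
theorem integral_carleman_lt (hO : IsBoundedC2Domain O ρ)
    (hΘ : ContDiffOn ℝ 2 Θ (Ico 0 T)) (hψ : ContDiffOn ℝ 2 ψ (halfCylinder T O))
    (hσ : ContDiffOn ℝ 2 σ (halfCylinder T O)) (hz : ContDiffOn ℝ 2 z (halfCylinder T O))
    (hz0 : ∀ t ∈ Ioo 0 T, ∀ x ∈ frontier O, z (t, x) = 0)
    (hψn : ∀ t ∈ Ioo 0 T, ∀ x ∈ frontier O,
      ∑ i, pd (halfCylinder T O) (es i) ψ (t, x) * fderiv ℝ ρ x (ex i) ≤ 0)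
    (hM : 1 ≤ M) (hr : 1 ≤ r) (hs : r ≤ s) (hl : r ≤ lam)
    (hν0 : 0 < ν) (hν : ν ≤ M) (hε0 : 0 < ε) (hε : ε ≤ 1)
    (hσM : BoundedC2 (halfCylinder T O) M σ) (hψM : BoundedC2 (halfCylinder T O) M ψ)
    (hσ1 : ∀ p ∈ halfCylinder T O, 1 ≤ M * σ p)
    (hc0 : 0 < c) (hc1 : c ≤ ν ^ 2 * ε) (hc2 : c ≤ 2 * ν ^ 2 * ε ^ 2) (hc3 : c * M ≤ ν * ε)
    (hrc : 270 * M ^ 8 ≤ c * r)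
    (hK : 0 ≤ K) (hKM : K ≤ M) (hm : 1 ≤ m) (hTB : TimeBounds T K (muParam m s lam) Θ)
    (hψm : ∀ p ∈ halfCylinder T O, 6 * m ≤ ψ p ∧ ψ p ≤ 6 * m + 1)
    {L : ℝ} (hL : L = lam * Real.exp (6 * lam * (m + 1))) {A : Set (ℝ × Plane)}
    (hA : MeasurableSet A)
    (hgrad : ∀ p ∈ cylinder T O \ A, 2 * ε ≤ pd (halfCylinder T O) (es 0) ψ p ^ 2
      + pd (halfCylinder T O) (es 1) ψ p ^ 2)
    {T' : ℝ} (hT'0 : 0 < T') (hT' : T' < T) :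
    (∫ x in O, energyOf T O ν s lam L Θ σ ψ (conjOf s lam L Θ ψ z) (T', x))
      - (∫ x in O, energyOf T O ν s lam L Θ σ ψ (conjOf s lam L Θ ψ z) (0, x))
      + c / (10 * M ^ 2) * (s * lam ^ 2 * (∫ p in cylinder T' O,
          xiOf lam Θ ψ p * (pd (halfCylinder T O) (es 0) z p ^ 2
          + pd (halfCylinder T O) (es 1) z p ^ 2) * Real.exp (-s * phiOf lam L Θ ψ p) ^ 2)
        + s ^ 3 * lam ^ 4 * ∫ p in cylinder T' O, xiOf lam Θ ψ p ^ 3 * z p ^ 2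
          * Real.exp (-s * phiOf lam L Θ ψ p) ^ 2)
      ≤ (∫ p in cylinder T' O, (Real.exp (-s * phiOf lam L Θ ψ p) * heatPD T O ν σ z p) ^ 2)
        + 2 * M ^ 2 * (s ^ 3 * lam ^ 4 * ∫ p in cylinder T' O ∩ A, xiOf lam Θ ψ p ^ 3 * z p ^ 2
          * Real.exp (-s * phiOf lam L Θ ψ p) ^ 2) := by
  have hS : UniqueDiffOn ℝ (halfCylinder T O) := uniqueDiffOn_halfCylinder hO
  have hw := contDiffOn_conjOf s lam L hΘ hψ hz
  have hs0 : 0 ≤ s := by linarith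
  have hl0 : 0 ≤ lam := by linarith
  have hF := fun i => contDiffOn_fluxOf (ν := ν) (s := s) (lam := lam) (ε := ε) (L := L)
    hS hΘ hψ hσ hw i
  have hH := contDiffOn_energyOf (ν := ν) (s := s) (lam := lam) (L := L) hS hΘ hψ hσ hw
  have hdiv := integral_spacetime_div_ge hO hT'0 hT' hF hH (fun t ht x hx =>
    fluxOf_boundary_nonneg hO hw (fun t ht => zero_le_one.trans (hTB t ht).1) hs0 hl0
      (fun t ht x hx => by simp [conjOf, hz0 t ht x hx]) hψn ht hx)
  have cξ := (contDiffOn_xiOf (T := T) (O := O) lam hΘ hψ).continuousOn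
  have cφ := (contDiffOn_phiOf (T := T) (O := O) lam L hΘ hψ).continuousOn
  have cz := hz.continuousOn
  have cz0 : ContinuousOn (pd (halfCylinder T O) (es 0) z) (halfCylinder T O) :=
    continuousOn_pd hz hS (by norm_num)
  have cz1 : ContinuousOn (pd (halfCylinder T O) (es 1) z) (halfCylinder T O) :=
    continuousOn_pd hz hS (by norm_num)
  have cheat := continuousOn_heatPD (ν := ν) hS hσ hz
  have cF : ∀ i, ContinuousOn (pd (halfCylinder T O) (es i)
      (fluxOf T O ν s lam ε L Θ σ ψ (conjOf s lam L Θ ψ z) i)) (halfCylinder T O) := fun i =>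
    continuousOn_pd (hF i) hS le_rfl
  have cH : ContinuousOn (pd (halfCylinder T O) et
      (energyOf T O ν s lam L Θ σ ψ (conjOf s lam L Θ ψ z))) (halfCylinder T O) :=
    continuousOn_pd hH hS le_rfl
  have ce : ContinuousOn (fun p => Real.exp (-s * phiOf lam L Θ ψ p)) (halfCylinder T O) := by
    fun_prop
  have i0 : IntegrableOn (fun p => (∑ i, pd (halfCylinder T O) (es i)
        (fluxOf T O ν s lam ε L Θ σ ψ (conjOf s lam L Θ ψ z) i) p)
      + pd (halfCylinder T O) et (energyOf T O ν s lam L Θ σ ψ (conjOf s lam L Θ ψ z)) p)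
      (cylinder T' O) :=
    integrableOn_cylinder_of_continuousOn hO hT' ((continuousOn_finsetSum _ fun i _ => cF i).add cH)
  have i1 : IntegrableOn (fun p => xiOf lam Θ ψ p * (pd (halfCylinder T O) (es 0) z p ^ 2
          + pd (halfCylinder T O) (es 1) z p ^ 2) * Real.exp (-s * phiOf lam L Θ ψ p) ^ 2)
      (cylinder T' O) := integrableOn_cylinder_of_continuousOn hO hT' (by fun_prop)
  have i2 : IntegrableOn (fun p => xiOf lam Θ ψ p ^ 3 * z p ^ 2
          * Real.exp (-s * phiOf lam L Θ ψ p) ^ 2)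
      (cylinder T' O) := integrableOn_cylinder_of_continuousOn hO hT' (by fun_prop)
  have i3 : IntegrableOn (fun p => (Real.exp (-s * phiOf lam L Θ ψ p) * heatPD T O ν σ z p) ^ 2)
      (cylinder T' O) := integrableOn_cylinder_of_continuousOn hO hT' (by fun_prop)
  have i4 : IntegrableOn (A.indicator fun p => xiOf lam Θ ψ p ^ 3 * z p ^ 2
          * Real.exp (-s * phiOf lam L Θ ψ p) ^ 2) (cylinder T' O) := i2.indicator hA
  have hmono := setIntegral_mono_on
    (i0.add (((i1.const_mul (s * lam ^ 2)).add (i2.const_mul (s ^ 3 * lam ^ 4))).const_mul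
      (c / (10 * M ^ 2))))
    (i3.add ((i4.const_mul (s ^ 3 * lam ^ 4)).const_mul (2 * M ^ 2)))
    (hO.isOpen_cylinder T').measurableSet (fun p hp => by
      have hpT : p ∈ cylinder T O := ⟨⟨hp.1.1, hp.1.2.trans hT'⟩, hp.2⟩
      have h := pointwise_carleman_of_bounds (χ := A.indicator (fun _ => (1 : ℝ)) p)
        hO hΘ hψ hσ hz hM hr hs hl hν0 hν hε0 hε hσM hψM hσ1
        hc0 hc1 hc2 hc3 hrc hK hKM hm hTB hψm hL
        (indicator_nonneg (fun _ _ => zero_le_one) p) hpT (by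
          by_cases hpA : p ∈ A
          · exact Or.inl (indicator_of_mem hpA _)
          · exact Or.inr (hgrad p ⟨hpT, hpA⟩))
      refine h.trans_eq ?_
      simp only [Pi.add_apply]
      by_cases hpA : p ∈ A
      · simp only [indicator_of_mem hpA]; ring
      · simp only [indicator_of_notMem hpA]; ring)
  rw [integral_add' i0 (((i1.const_mul (s * lam ^ 2)).add
      (i2.const_mul (s ^ 3 * lam ^ 4))).const_mul (c / (10 * M ^ 2))),
    integral_add' i3 ((i4.const_mul (s ^ 3 * lam ^ 4)).const_mul (2 * M ^ 2)),
    integral_const_mul, integral_const_mul, integral_const_mul,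
    integral_add' (i1.const_mul _) (i2.const_mul _), integral_const_mul, integral_const_mul,
    setIntegral_indicator hA] at hmono
  linarith only [hmono, hdiv]

end

/-! ### Gradient and heat operator in terms of partial derivatives -/

section

variable {T : ℝ} {O : Set Plane} {ρ : Plane → ℝ}

theorem gradient_apply_eq_fderiv (f : Plane → ℝ) (x : Plane) (i : Fin 2) :
    gradient f x i = fderiv ℝ f x (ex i) := by
  have h : inner ℝ (gradient f x) (ex i) = fderiv ℝ f x (ex i) := by
    rw [gradient, InnerProductSpace.toDual_symm_apply]
  rw [← h, EuclideanSpace.inner_single_right]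
  simp only [conj_trivial, one_mul]

theorem fderiv_space_slice (hO : IsBoundedC2Domain O ρ) {f : ℝ × Plane → ℝ} {t : ℝ} {x : Plane}
    (ht : t ∈ Ico 0 T) (hx : x ∈ O)
    (hf : DifferentiableWithinAt ℝ f (halfCylinder T O) (t, x)) (i : Fin 2) :
    fderiv ℝ (fun y => f (t, y)) x (ex i) = pd (halfCylinder T O) (es i) f (t, x) := by
  rw [((hasFDerivWithinAt_space_slice ht hf.hasFDerivWithinAt).hasFDerivAt
    (mem_of_superset (hO.isOpen.mem_nhds hx) subset_closure)).fderiv]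
  simp [pd]

theorem norm_spaceGrad_sq (hO : IsBoundedC2Domain O ρ) {f : ℝ × Plane → ℝ} {t : ℝ} {x : Plane}
    (ht : t ∈ Ico 0 T) (hx : x ∈ O)
    (hf : DifferentiableWithinAt ℝ f (halfCylinder T O) (t, x)) :
    ‖spaceGrad f (t, x)‖ ^ 2 = pd (halfCylinder T O) (es 0) f (t, x) ^ 2
      + pd (halfCylinder T O) (es 1) f (t, x) ^ 2 := by
  rw [EuclideanSpace.real_norm_sq_eq, Fin.sum_univ_two]
  simp only [spaceGrad, gradient_apply_eq_fderiv, fderiv_space_slice hO ht hx hf]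

theorem spaceLaplacian_eq (hO : IsBoundedC2Domain O ρ) {f : ℝ × Plane → ℝ} {t : ℝ} {x : Plane}
    (ht : t ∈ Ico 0 T) (hx : x ∈ O) (hf : ContDiffOn ℝ 2 f (halfCylinder T O)) :
    spaceLaplacian f (t, x) = pd (halfCylinder T O) (es 0) (pd (halfCylinder T O) (es 0) f) (t, x)
      + pd (halfCylinder T O) (es 1) (pd (halfCylinder T O) (es 1) f) (t, x) := by
  have hS : UniqueDiffOn ℝ (halfCylinder T O) := uniqueDiffOn_halfCylinder hO
  have hg : ContDiffOn ℝ 2 (fun y => f (t, y)) O :=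
    hf.comp (contDiffOn_const.prodMk contDiffOn_id) (fun y hy => ⟨ht, subset_closure hy⟩)
  have hg2 : DifferentiableAt ℝ (fderiv ℝ (fun y => f (t, y))) x :=
    ((hg.contDiffAt (hO.isOpen.mem_nhds hx)).fderiv_right (m := 1) (by norm_num)).differentiableAt
      one_ne_zero
  have key : ∀ i : Fin 2, fderiv ℝ (fderiv ℝ (fun y => f (t, y))) x (ex i) (ex i)
      = pd (halfCylinder T O) (es i) (pd (halfCylinder T O) (es i) f) (t, x) := by
    intro i
    have h1 : fderiv ℝ (fun y => fderiv ℝ (fun y => f (t, y)) y (ex i)) x (ex i)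
        = fderiv ℝ (fderiv ℝ (fun y => f (t, y))) x (ex i) (ex i) := by
      rw [fderiv_clm_apply hg2 (differentiableAt_const _)]
      simp
    have h2 : (fun y => fderiv ℝ (fun y => f (t, y)) y (ex i))
        =ᶠ[𝓝 x] fun y => pd (halfCylinder T O) (es i) f (t, y) := by
      filter_upwards [hO.isOpen.mem_nhds hx] with y hy
      exact fderiv_space_slice hO ht hy (hf.differentiableOn two_ne_zero _ ⟨ht, subset_closure hy⟩) i
    rw [← h1, h2.fderiv_eq]
    exact fderiv_space_slice hO ht hx ((contDiffOn_pd (m := 1) hf hS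
      (by norm_num)).differentiableOn one_ne_zero _ ⟨ht, subset_closure hx⟩) i
  rw [spaceLaplacian, InnerProductSpace.laplacian_eq_iteratedFDeriv_orthonormalBasis _
    (EuclideanSpace.basisFun (Fin 2) ℝ)]
  simp only [iteratedFDeriv_two_apply, Fin.sum_univ_two, ← key]
  simp

theorem heatOp_eq_heatPD (hO : IsBoundedC2Domain O ρ) {σ z : ℝ × Plane → ℝ} {ν : ℝ}
    (hz : ContDiffOn ℝ 2 z (halfCylinder T O)) {p : ℝ × Plane} (hp : p ∈ cylinder T O) :
    heatOp σ ν z p = heatPD T O ν σ z p := by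
  obtain ⟨t, x⟩ := p
  have ht : t ∈ Ioo 0 T := hp.1
  have hx : x ∈ O := hp.2
  have hpS := cylinder_subset_halfCylinder hp
  rw [heatOp, heatPD, spaceLaplacian_eq hO (Ioo_subset_Ico_self ht) hx hz, timeDeriv,
    ((hasPD_pd (v := et) hz two_ne_zero hpS).hasDerivAt_time ht (subset_closure hx)).deriv]

/-- The sign of the normal derivative, as a condition on the partial derivatives. -/
theorem sum_pd_mul_nonpos (hO : IsBoundedC2Domain O ρ) {f : ℝ × Plane → ℝ} {t : ℝ} {x : Plane}
    (ht : t ∈ Ico 0 T) (hx : x ∈ frontier O)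
    (hf : DifferentiableWithinAt ℝ f (halfCylinder T O) (t, x))
    (h : fderivWithin ℝ (fun y => f (t, y)) (closure O) x (outwardNormal ρ x) ≤ 0) :
    ∑ i, pd (halfCylinder T O) (es i) f (t, x) * fderiv ℝ ρ x (ex i) ≤ 0 := by
  have hg : 0 < ‖gradient ρ x‖ := norm_pos_iff.mpr (hO.gradient_ne_zero x hx)
  have hsum : gradient ρ x = ∑ i, fderiv ℝ ρ x (ex i) • ex i := by
    ext j
    fin_cases j <;> simp [Fin.sum_univ_two, gradient_apply_eq_fderiv, ex]
  rw [(hasFDerivWithinAt_space_slice ht hf.hasFDerivWithinAt).fderivWithin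
    (hO.uniqueDiffOn_closure x hx.1), outwardNormal, map_smul, smul_eq_mul] at h
  have h2 := nonpos_of_mul_nonpos_right h (inv_pos.mpr hg)
  rw [hsum, map_sum] at h2
  refine le_of_eq_of_le (Finset.sum_congr rfl fun i _ => ?_) h2
  rw [map_smul, smul_eq_mul, mul_comm]
  simp [pd]

end

/-! ### The initial time -/

/-- Minus the energy density at the initial time bounds the squares of `z` and `∇z`; here
`wᵢ - s λ ξ ψᵢ w` is `e^{-sφ} ∂ᵢz`, and `B = μ E / T₀` is the dominant part of `-∂ₜφ`. -/
theorem initial_energy_le {ν s lam M c Λ ξ q B σ ψ₁ ψ₂ ψt w w₁ w₂ : ℝ} (hM : 1 ≤ M) (hs : 1 ≤ s)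
    (hl : 40 * M ^ 7 ≤ lam) (hc0 : 0 < c) (hc1 : c ≤ 1) (hcν : c * M ≤ ν) (hνM : ν ≤ M)
    (hσM : |σ| ≤ M) (hσ1 : 1 ≤ M * σ) (hψt : |ψt| ≤ M) (hψ₁ : |ψ₁| ≤ M) (hψ₂ : |ψ₂| ≤ M)
    (hΛ : 1 ≤ Λ) (hξ0 : 0 ≤ ξ) (hξ : ξ ≤ 2 * Λ) (hq : q = -B - lam * ξ * ψt)
    (hB : s * lam ^ 3 * Λ ^ 2 ≤ 2 * M * B) :
    c / (16 * M ^ 3) * ((w₁ - s * lam * ξ * ψ₁ * w) ^ 2 + (w₂ - s * lam * ξ * ψ₂ * w) ^ 2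
      + s ^ 2 * lam ^ 3 * Λ ^ 2 * w ^ 2)
      ≤ -(-(ν / 2) * σ * (w₁ ^ 2 + w₂ ^ 2)
        + s ^ 2 * ν * lam ^ 2 / 2 * σ * ξ ^ 2 * (ψ₁ ^ 2 + ψ₂ ^ 2) * w ^ 2
        + s / 2 * σ ^ 2 * q * w ^ 2) := by
  have hM0 : 0 < M := by linarith
  have hM7 : 1 ≤ M ^ 7 := one_le_pow₀ hM
  have hl1 : 1 ≤ lam := by linarith
  have hl0 : 0 < lam := by linarith
  have hs0 : 0 < s := by linarith
  have hν0 : 0 < ν := (mul_pos hc0 hM0).trans_le hcν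
  have hσ0 : 0 < σ := pos_of_mul_pos_right (by linarith) hM0.le
  have hσM' : σ ≤ M := (le_abs_self σ).trans hσM
  have hsq : ∀ {a : ℝ}, |a| ≤ M → a ^ 2 ≤ M ^ 2 := fun h =>
    sq_le_sq' (abs_le.mp h).1 (abs_le.mp h).2
  set W := s ^ 2 * lam ^ 2 * Λ ^ 2 * w ^ 2 with hW
  have hW0 : 0 ≤ W := by positivity
  -- the gradient of `w`
  have h1 : c * (w₁ ^ 2 + w₂ ^ 2) ≤ ν * σ * (w₁ ^ 2 + w₂ ^ 2) := by
    refine mul_le_mul_of_nonneg_right ?_ (by positivity)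
    calc c ≤ c * (M * σ) := le_mul_of_one_le_right hc0.le hσ1
      _ = c * M * σ := by ring
      _ ≤ ν * σ := by gcongr
  -- the two negative terms
  have h2 : s ^ 2 * ν * lam ^ 2 / 2 * σ * ξ ^ 2 * (ψ₁ ^ 2 + ψ₂ ^ 2) * w ^ 2 ≤ 4 * M ^ 4 * W := by
    calc s ^ 2 * ν * lam ^ 2 / 2 * σ * ξ ^ 2 * (ψ₁ ^ 2 + ψ₂ ^ 2) * w ^ 2
        ≤ s ^ 2 * M * lam ^ 2 / 2 * M * (2 * Λ) ^ 2 * (M ^ 2 + M ^ 2) * w ^ 2 := by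
          have q₁ := hsq hψ₁
          have q₂ := hsq hψ₂
          gcongr s ^ 2 * ?_ * lam ^ 2 / 2 * ?_ * ?_ ^ 2 * (?_ + ?_) * w ^ 2
      _ = _ := by rw [hW]; ring
  have h3 : -(lam * ξ * ψt) ≤ lam * (2 * Λ) * M := by
    rw [← mul_neg]
    have : -ψt ≤ M := (neg_le_abs ψt).trans hψt
    calc lam * ξ * -ψt ≤ lam * ξ * M := by gcongr
      _ ≤ _ := by gcongr
  have h4 : s / 2 * σ ^ 2 * (lam * (2 * Λ) * M) * w ^ 2 ≤ M ^ 4 * W := by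
    calc s / 2 * σ ^ 2 * (lam * (2 * Λ) * M) * w ^ 2
        ≤ s / 2 * M ^ 2 * (lam * (2 * Λ) * M) * w ^ 2 := by gcongr
      _ = M ^ 3 * (s * lam * Λ * w ^ 2) := by ring
      _ ≤ M ^ 4 * (s ^ 2 * lam ^ 2 * Λ ^ 2 * w ^ 2) := by
          gcongr ?_ * (?_ * ?_ * ?_ * _)
          · exact pow_le_pow_right₀ hM (by norm_num)
          · exact le_self_pow₀ hs (by norm_num)
          · exact le_self_pow₀ hl1 (by norm_num)
          · exact le_self_pow₀ hΛ (by norm_num)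
  have h5 : lam * W ≤ 4 * M ^ 3 * (s / 2 * σ ^ 2 * B * w ^ 2) := by
    have hB0 : 0 ≤ B := by
      have : 0 ≤ 2 * M * B := le_trans (by positivity) hB
      exact nonneg_of_mul_nonneg_right this (by positivity)
    have hσ2 : 1 ≤ (M * σ) ^ 2 := one_le_pow₀ hσ1
    calc lam * W = s * (s * lam ^ 3 * Λ ^ 2) * w ^ 2 := by rw [hW]; ring
      _ ≤ s * (2 * M * B) * w ^ 2 := by gcongr
      _ ≤ (M * σ) ^ 2 * (s * (2 * M * B) * w ^ 2) := le_mul_of_one_le_left (by positivity) hσ2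
      _ = _ := by ring
  have h6 : s / 2 * σ ^ 2 * q * w ^ 2 ≤ M ^ 4 * W - s / 2 * σ ^ 2 * B * w ^ 2 := by
    have : s / 2 * σ ^ 2 * (-(lam * ξ * ψt)) * w ^ 2
        ≤ s / 2 * σ ^ 2 * (lam * (2 * Λ) * M) * w ^ 2 := by gcongr
    calc s / 2 * σ ^ 2 * q * w ^ 2
        = s / 2 * σ ^ 2 * (-(lam * ξ * ψt)) * w ^ 2 - s / 2 * σ ^ 2 * B * w ^ 2 := by rw [hq]; ring
      _ ≤ _ := by linarith
  have h7 : 5 * M ^ 4 * W ≤ lam * W / (8 * M ^ 3) := by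
    rw [le_div_iff₀ (by positivity)]
    calc 5 * M ^ 4 * W * (8 * M ^ 3) = 40 * M ^ 7 * W := by ring
      _ ≤ lam * W := by gcongr
  have h5' : lam * W / (4 * M ^ 3) ≤ s / 2 * σ ^ 2 * B * w ^ 2 := by
    rw [div_le_iff₀ (by positivity)]
    linarith
  -- back to the gradient of `z`
  have h8 : ∀ (a v : ℝ), |a| ≤ M → (v - s * lam * ξ * a * w) ^ 2 ≤ 2 * v ^ 2 + 8 * M ^ 2 * W := by
    intro a v ha
    have e1 : (s * lam * ξ * a * w) ^ 2 ≤ 4 * M ^ 2 * W := by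
      calc (s * lam * ξ * a * w) ^ 2 = s ^ 2 * lam ^ 2 * ξ ^ 2 * a ^ 2 * w ^ 2 := by ring
        _ ≤ s ^ 2 * lam ^ 2 * (2 * Λ) ^ 2 * M ^ 2 * w ^ 2 := by
          have q := hsq ha
          gcongr s ^ 2 * lam ^ 2 * ?_ ^ 2 * ?_ * w ^ 2
        _ = _ := by rw [hW]; ring
    have e2 : ∀ y : ℝ, (v - y) ^ 2 ≤ 2 * v ^ 2 + 2 * y ^ 2 := fun y => by
      nlinarith [sq_nonneg (v + y)]
    linarith [e2 (s * lam * ξ * a * w)]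
  have h9 : 16 * M ^ 2 * W ≤ lam * W := by
    refine mul_le_mul_of_nonneg_right ?_ hW0
    have : M ^ 2 ≤ M ^ 7 := pow_le_pow_right₀ hM (by norm_num)
    linarith
  have h10 : (w₁ - s * lam * ξ * ψ₁ * w) ^ 2 + (w₂ - s * lam * ξ * ψ₂ * w) ^ 2
      + s ^ 2 * lam ^ 3 * Λ ^ 2 * w ^ 2 ≤ 2 * (w₁ ^ 2 + w₂ ^ 2) + 2 * (lam * W) := by
    have e : s ^ 2 * lam ^ 3 * Λ ^ 2 * w ^ 2 = lam * W := by rw [hW]; ring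
    linarith [h8 ψ₁ w₁ hψ₁, h8 ψ₂ w₂ hψ₂]
  have hM3 : 1 ≤ M ^ 3 := one_le_pow₀ hM
  have h11 : c / (16 * M ^ 3) * (2 * (w₁ ^ 2 + w₂ ^ 2)) ≤ c / 2 * (w₁ ^ 2 + w₂ ^ 2) := by
    rw [← mul_assoc]
    refine mul_le_mul_of_nonneg_right ?_ (by positivity)
    rw [div_mul_eq_mul_div, div_le_div_iff₀ (by positivity) (by norm_num)]
    have := mul_le_mul_of_nonneg_left hM3 hc0.le
    linarith
  have h12 : c / (16 * M ^ 3) * (2 * (lam * W)) ≤ lam * W / (8 * M ^ 3) := by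
    rw [div_mul_eq_mul_div, div_le_div_iff₀ (by positivity) (by positivity)]
    have : c * (lam * W * M ^ 3) ≤ 1 * (lam * W * M ^ 3) := by gcongr
    linarith
  have h13 : lam * W / (4 * M ^ 3) = lam * W / (8 * M ^ 3) + lam * W / (8 * M ^ 3) := by
    field_simp; ring
  have h14 := mul_le_mul_of_nonneg_left h10 (show 0 ≤ c / (16 * M ^ 3) by positivity)
  rw [mul_add] at h14
  linarith

section

variable {T : ℝ} {O : Set Plane} {ρ : Plane → ℝ} {Θ : ℝ → ℝ} {σ ψ z : ℝ × Plane → ℝ}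
  {ν m s lam c M K L T₀ : ℝ}

/-- At the initial time the weight decreases so fast, at the rate `μ / T₀`, that the energy is
negative and controls `z(0)` and `∇z(0)`. -/
theorem energyOf_zero_le (hO : IsBoundedC2Domain O ρ) (hT : 0 < T)
    (hΘ : ContDiffOn ℝ 2 Θ (Ico 0 T)) (hψ : ContDiffOn ℝ 2 ψ (halfCylinder T O))
    (hz : ContDiffOn ℝ 2 z (halfCylinder T O))
    (hM : 1 ≤ M) (hs : 1 ≤ s) (hl : 40 * M ^ 7 ≤ lam) (hc0 : 0 < c) (hc1 : c ≤ 1)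
    (hcν : c * M ≤ ν) (hνM : ν ≤ M) (hT₀ : 0 < T₀) (hT₀M : T₀ ≤ M)
    (hσM : BoundedC2 (halfCylinder T O) M σ) (hψM : BoundedC2 (halfCylinder T O) M ψ)
    (hσ1 : ∀ p ∈ halfCylinder T O, 1 ≤ M * σ p) (hm : 1 ≤ m)
    (hψm : ∀ p ∈ halfCylinder T O, 6 * m ≤ ψ p ∧ ψ p ≤ 6 * m + 1)
    (hΘ0 : Θ 0 = 2) (hΘ0' : derivWithin Θ (Ico 0 T) 0 = -(muParam m s lam / T₀))
    (hL : L = lam * Real.exp (6 * lam * (m + 1))) {x : Plane} (hx : x ∈ closure O) :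
    c / (16 * M ^ 3) * ((pd (halfCylinder T O) (es 0) z (0, x) ^ 2
        + pd (halfCylinder T O) (es 1) z (0, x) ^ 2) * Real.exp (-s * phiOf lam L Θ ψ (0, x)) ^ 2
      + s ^ 2 * lam ^ 3 * Real.exp (2 * lam * (6 * m + 1)) *
        (z (0, x) ^ 2 * Real.exp (-s * phiOf lam L Θ ψ (0, x)) ^ 2))
      ≤ -energyOf T O ν s lam L Θ σ ψ (conjOf s lam L Θ ψ z) (0, x) := by
  have hS : UniqueDiffOn ℝ (halfCylinder T O) := uniqueDiffOn_halfCylinder hO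
  have hp : ((0, x) : ℝ × Plane) ∈ halfCylinder T O := ⟨⟨le_rfl, hT⟩, hx⟩
  have hM7 : 1 ≤ M ^ 7 := one_le_pow₀ hM
  have hl2 : 2 ≤ lam := by linarith
  have hl0 : 0 ≤ lam := by linarith
  obtain ⟨hψ0, hψ1⟩ := hψm _ hp
  set Λ := Real.exp (lam * (6 * m + 1)) with hΛ
  set η := Real.exp (lam * ψ (0, x)) with hη
  have hηΛ : η ≤ Λ := Real.exp_le_exp.mpr (by gcongr)
  have hΛL : 2 * Λ ≤ L := by
    have : Λ ≤ Real.exp (6 * lam * (m + 1)) := Real.exp_le_exp.mpr (by nlinarith)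
    rw [hL]
    exact mul_le_mul hl2 this (Real.exp_pos _).le hl0
  have hμL : muParam m s lam * L = s * lam ^ 3 * Λ ^ 2 := by
    have h : Real.exp (lam * (6 * m - 4)) * Real.exp (6 * lam * (m + 1)) = Λ ^ 2 := by
      rw [hΛ, ← Real.exp_nat_mul, ← Real.exp_add]
      congr 1
      push_cast
      ring
    rw [muParam, hL, ← h]
    ring
  have hμ0 : 0 ≤ muParam m s lam := by unfold muParam; positivity
  have hB : s * lam ^ 3 * Λ ^ 2 ≤ 2 * M * (muParam m s lam / T₀ * (L - η)) := by
    have h1 : muParam m s lam * L ≤ 2 * (muParam m s lam * (L - η)) := by nlinarith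
    have h2 : 0 ≤ muParam m s lam * (L - η) := mul_nonneg hμ0 (by
      have := Real.exp_pos (lam * (6 * m + 1)); linarith)
    rw [← hμL]
    refine h1.trans ?_
    calc 2 * (muParam m s lam * (L - η)) = 2 * T₀ * (muParam m s lam / T₀ * (L - η)) := by
          field_simp
      _ ≤ _ := by
          refine mul_le_mul_of_nonneg_right (by linarith) ?_
          rw [div_mul_eq_mul_div]
          positivity
  have hψ' := fun u v hu hv => ((hψM _ hp).2 u v hu hv).1
  have hξ : xiOf lam Θ ψ (0, x) = 2 * η := by simp only [xiOf, hΘ0, hη]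
  have hmain := initial_energy_le (w := conjOf s lam L Θ ψ z (0, x))
    (w₁ := pd (halfCylinder T O) (es 0) (conjOf s lam L Θ ψ z) (0, x))
    (w₂ := pd (halfCylinder T O) (es 1) (conjOf s lam L Θ ψ z) (0, x))
    (ξ := xiOf lam Θ ψ (0, x)) (q := phiTOf T O lam L Θ ψ (0, x))
    (B := muParam m s lam / T₀ * (L - η))
    hM hs hl hc0 hc1 hcν hνM (hσM _ hp).1 (hσ1 _ hp)
    (hψ' et et norm_et_le norm_et_le) (hψ' (es 0) et (norm_es_le 0) norm_et_le)
    (hψ' (es 1) et (norm_es_le 1) norm_et_le) (Real.one_le_exp (by positivity))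
    (by rw [hξ]; positivity) (by rw [hξ]; linarith)
    (by simp only [phiTOf, hΘ0', hη]; ring) hB
  refine le_of_eq_of_le ?_ hmain
  have hexp : Real.exp (2 * lam * (6 * m + 1)) = Λ ^ 2 := by
    rw [hΛ, ← Real.exp_nat_mul]
    congr 1
    push_cast
    ring
  rw [pd_conjOf_space s lam L hS hΘ hψ hz hp, pd_conjOf_space s lam L hS hΘ hψ hz hp, hexp]
  simp only [conjOf]
  ring

end

/-! ### The final time -/

theorem tendsto_sq_mul_exp_neg {a : ℝ} (ha : 0 < a) :
    Tendsto (fun y : ℝ => y ^ 2 * Real.exp (-(a * y))) atTop (𝓝 0) := by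
  have h := (Real.tendsto_pow_mul_exp_neg_atTop_nhds_zero 2).comp
    (tendsto_id.const_mul_atTop ha)
  have h2 := h.const_mul ((a ^ 2)⁻¹)
  rw [mul_zero] at h2
  refine h2.congr fun y => ?_
  simp only [Function.comp_apply, id_eq]
  field_simp

theorem cube_mul_exp_neg_le {a y : ℝ} (ha : 0 < a) (hy : 0 ≤ y) :
    y ^ 3 * Real.exp (-(a * y)) ≤ 6 / a ^ 3 := by
  have h := Real.pow_div_factorial_le_exp (a * y) (by positivity) 3
  rw [Real.exp_neg, ← div_eq_mul_inv, div_le_div_iff₀ (Real.exp_pos _) (by positivity)]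
  simp only [Nat.factorial] at h
  push_cast at h
  rw [div_le_iff₀ (by norm_num)] at h
  linarith [mul_pow a y 3]

/-- A bound for the energy density by `θ² e^{-2sφ}`, once the fields in it are bounded. -/
theorem abs_energy_le {ν s lam M Z A₁ A₂ Λ σ ξ q ψ₁ ψ₂ w w₁ w₂ θ e : ℝ} (hν : 0 ≤ ν) (hs : 0 ≤ s)
    (hA₂ : 0 ≤ A₂) (hM : 0 ≤ M)
    (hσ : |σ| ≤ M) (hψ₁ : |ψ₁| ≤ M) (hψ₂ : |ψ₂| ≤ M) (hξ0 : 0 ≤ ξ) (hξ : ξ ≤ Λ * θ)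
    (hq : |q| ≤ A₂ * θ ^ 2) (hw : |w| ≤ Z * e) (hw₁ : |w₁| ≤ A₁ * (θ * e))
    (hw₂ : |w₂| ≤ A₁ * (θ * e)) :
    |(-(ν / 2) * σ * (w₁ ^ 2 + w₂ ^ 2)
      + s ^ 2 * ν * lam ^ 2 / 2 * σ * ξ ^ 2 * (ψ₁ ^ 2 + ψ₂ ^ 2) * w ^ 2
      + s / 2 * σ ^ 2 * q * w ^ 2)|
    ≤ (ν * M * A₁ ^ 2 + s ^ 2 * ν * lam ^ 2 * M ^ 3 * Λ ^ 2 * Z ^ 2 + s / 2 * M ^ 2 * A₂ * Z ^ 2)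
      * (θ ^ 2 * e ^ 2) := by
  have sq : ∀ {a b : ℝ}, |a| ≤ b → a ^ 2 ≤ b ^ 2 := fun h =>
    sq_le_sq' (abs_le.mp h).1 (abs_le.mp h).2
  have g₁ := sq hψ₁
  have g₂ := sq hψ₂
  have k₁ := sq hw₁
  have k₂ := sq hw₂
  have k := sq hw
  have t1 : |(-(ν / 2) * σ * (w₁ ^ 2 + w₂ ^ 2))| ≤ ν * M * A₁ ^ 2 * (θ ^ 2 * e ^ 2) := by
    rw [abs_mul, abs_mul, abs_neg, abs_of_nonneg (show 0 ≤ ν / 2 by positivity),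
      abs_of_nonneg (show 0 ≤ w₁ ^ 2 + w₂ ^ 2 by positivity)]
    calc ν / 2 * |σ| * (w₁ ^ 2 + w₂ ^ 2)
        ≤ ν / 2 * M * ((A₁ * (θ * e)) ^ 2 + (A₁ * (θ * e)) ^ 2) := by gcongr ν / 2 * ?_ * (?_ + ?_)
      _ = _ := by ring
  have t2 : |s ^ 2 * ν * lam ^ 2 / 2 * σ * ξ ^ 2 * (ψ₁ ^ 2 + ψ₂ ^ 2) * w ^ 2|
      ≤ s ^ 2 * ν * lam ^ 2 * M ^ 3 * Λ ^ 2 * Z ^ 2 * (θ ^ 2 * e ^ 2) := by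
    rw [abs_mul, abs_mul, abs_mul, abs_mul,
      abs_of_nonneg (show 0 ≤ s ^ 2 * ν * lam ^ 2 / 2 by positivity),
      abs_of_nonneg (show 0 ≤ ξ ^ 2 by positivity), abs_of_nonneg (show 0 ≤ w ^ 2 by positivity),
      abs_of_nonneg (show 0 ≤ ψ₁ ^ 2 + ψ₂ ^ 2 by positivity)]
    calc s ^ 2 * ν * lam ^ 2 / 2 * |σ| * ξ ^ 2 * (ψ₁ ^ 2 + ψ₂ ^ 2) * w ^ 2
        ≤ s ^ 2 * ν * lam ^ 2 / 2 * M * (Λ * θ) ^ 2 * (M ^ 2 + M ^ 2) * (Z * e) ^ 2 := by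
          gcongr s ^ 2 * ν * lam ^ 2 / 2 * ?_ * ?_ ^ 2 * (?_ + ?_) * ?_
      _ = _ := by ring
  have t3 : |s / 2 * σ ^ 2 * q * w ^ 2| ≤ s / 2 * M ^ 2 * A₂ * Z ^ 2 * (θ ^ 2 * e ^ 2) := by
    have g := sq hσ
    rw [abs_mul, abs_mul, abs_of_nonneg (show 0 ≤ s / 2 * σ ^ 2 by positivity),
      abs_of_nonneg (show 0 ≤ w ^ 2 by positivity)]
    calc s / 2 * σ ^ 2 * |q| * w ^ 2 ≤ s / 2 * M ^ 2 * (A₂ * θ ^ 2) * (Z * e) ^ 2 := by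
          gcongr s / 2 * ?_ * ?_ * ?_
      _ = _ := by ring
  have := abs_add_three (-(ν / 2) * σ * (w₁ ^ 2 + w₂ ^ 2))
    (s ^ 2 * ν * lam ^ 2 / 2 * σ * ξ ^ 2 * (ψ₁ ^ 2 + ψ₂ ^ 2) * w ^ 2) (s / 2 * σ ^ 2 * q * w ^ 2)
  linarith

section

variable {T : ℝ} {O : Set Plane} {ρ : Plane → ℝ} {Θ : ℝ → ℝ} {σ ψ z : ℝ × Plane → ℝ}
  {ν m s lam M K μ L : ℝ}

/-- The energy density is at most of the order of `θ² e^{-2sφ}`, uniformly in time. -/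
theorem exists_energyOf_bound (hO : IsBoundedC2Domain O ρ)
    (hΘ : ContDiffOn ℝ 2 Θ (Ico 0 T)) (hψ : ContDiffOn ℝ 2 ψ (halfCylinder T O))
    (hz : ContDiffOn ℝ 2 z (halfCylinder T O)) (hν : 0 ≤ ν) (hs : 0 ≤ s) (hl : 0 ≤ lam)
    (hM : 1 ≤ M) {Z : ℝ} (hZ : 0 ≤ Z) (hK : 0 ≤ K) (hμ : 0 ≤ μ)
    (hσM : BoundedC2 (halfCylinder T O) M σ) (hψM : BoundedC2 (halfCylinder T O) M ψ)
    (hzZ : BoundedC2 (halfCylinder T O) Z z) (hTB : TimeBounds T K μ Θ)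
    (hψm : ∀ p ∈ halfCylinder T O, 6 * m ≤ ψ p ∧ ψ p ≤ 6 * m + 1)
    (hL : Real.exp (lam * (6 * m + 1)) ≤ L) :
    ∃ C, 0 ≤ C ∧ ∀ t ∈ Ico 0 T, ∀ x ∈ closure O,
      |energyOf T O ν s lam L Θ σ ψ (conjOf s lam L Θ ψ z) (t, x)| ≤ C * (Θ t ^ 2 *
        Real.exp (-s * phiOf lam L Θ ψ (t, x)) ^ 2) := by
  have hS : UniqueDiffOn ℝ (halfCylinder T O) := uniqueDiffOn_halfCylinder hO
  have hM0 : 0 ≤ M := by linarith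
  set Λ := Real.exp (lam * (6 * m + 1)) with hΛ
  have hΛ0 : 0 < Λ := Real.exp_pos _
  have hL0 : 0 ≤ L := hΛ0.le.trans hL
  refine ⟨ν * M * (Z + s * lam * Λ * M * Z) ^ 2 + s ^ 2 * ν * lam ^ 2 * M ^ 3 * Λ ^ 2 * Z ^ 2
    + s / 2 * M ^ 2 * (K * μ * L + lam * Λ * M) * Z ^ 2, by positivity, fun t ht x hx => ?_⟩
  have hp : ((t, x) : ℝ × Plane) ∈ halfCylinder T O := ⟨ht, hx⟩
  obtain ⟨hθ1, -, hθ2, -⟩ := hTB t ht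
  have hθ0 : 0 ≤ Θ t := by linarith
  have hη : Real.exp (lam * ψ (t, x)) ≤ Λ := Real.exp_le_exp.mpr (by gcongr; exact (hψm _ hp).2)
  have hξ0 : 0 ≤ xiOf lam Θ ψ (t, x) := by unfold xiOf; positivity
  have hξ : xiOf lam Θ ψ (t, x) ≤ Λ * Θ t := by
    rw [xiOf, mul_comm]; gcongr
  have hψ' := fun u v hu hv => ((hψM _ hp).2 u v hu hv).1
  have hz' := fun u v hu hv => ((hzZ _ hp).2 u v hu hv).1
  have hθθ : Θ t ≤ Θ t ^ 2 := le_self_pow₀ hθ1 (by norm_num)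
  have hq : |phiTOf T O lam L Θ ψ (t, x)| ≤ (K * μ * L + lam * Λ * M) * Θ t ^ 2 := by
    rw [phiTOf]
    refine (abs_sub _ _).trans ?_
    rw [abs_mul, abs_mul, abs_of_nonneg (mul_nonneg hl hξ0),
      abs_of_nonneg (sub_nonneg.mpr (hη.trans hL))]
    have e1 : L - Real.exp (lam * ψ (t, x)) ≤ L := sub_le_self _ (Real.exp_pos _).le
    calc |derivWithin Θ (Ico 0 T) t| * (L - Real.exp (lam * ψ (t, x)))
          + lam * xiOf lam Θ ψ (t, x) * |pd (halfCylinder T O) et ψ (t, x)|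
        ≤ K * μ * Θ t ^ 2 * L + lam * (Λ * Θ t ^ 2) * M := by
          have e2 := hψ' et et norm_et_le norm_et_le
          have e3 : xiOf lam Θ ψ (t, x) ≤ Λ * Θ t ^ 2 := hξ.trans (by gcongr)
          have e4 : 0 ≤ L - Real.exp (lam * ψ (t, x)) := sub_nonneg.mpr (hη.trans hL)
          gcongr
      _ = _ := by ring
  have hw : |conjOf s lam L Θ ψ z (t, x)| ≤ Z * Real.exp (-s * phiOf lam L Θ ψ (t, x)) := by
    rw [conjOf, abs_mul, abs_of_pos (Real.exp_pos _), mul_comm]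
    exact mul_le_mul_of_nonneg_right (hzZ _ hp).1 (Real.exp_pos _).le
  have hwi : ∀ i, |pd (halfCylinder T O) (es i) (conjOf s lam L Θ ψ z) (t, x)|
      ≤ (Z + s * lam * Λ * M * Z) * (Θ t * Real.exp (-s * phiOf lam L Θ ψ (t, x))) := by
    intro i
    have e1 := hz' (es i) et (norm_es_le i) norm_et_le
    have e2 := hψ' (es i) et (norm_es_le i) norm_et_le
    have e3 := (hzZ _ hp).1
    rw [pd_conjOf_space s lam L hS hΘ hψ hz hp, abs_mul, abs_of_pos (Real.exp_pos _)]
    have e4 : |pd (halfCylinder T O) (es i) z (t, x) + s * lam * xiOf lam Θ ψ (t, x) *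
        pd (halfCylinder T O) (es i) ψ (t, x) * z (t, x)|
        ≤ (Z + s * lam * Λ * M * Z) * Θ t := by
      refine (abs_add_le _ _).trans ?_
      rw [abs_mul, abs_mul, abs_of_nonneg (show 0 ≤ s * lam * xiOf lam Θ ψ (t, x) by positivity)]
      calc |pd (halfCylinder T O) (es i) z (t, x)| + s * lam * xiOf lam Θ ψ (t, x) *
            |pd (halfCylinder T O) (es i) ψ (t, x)| * |z (t, x)|
          ≤ Z * Θ t + s * lam * (Λ * Θ t) * M * Z := by
            have : |pd (halfCylinder T O) (es i) z (t, x)| ≤ Z * Θ t :=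
              e1.trans (le_mul_of_one_le_right hZ hθ1)
            gcongr
        _ = _ := by ring
    calc _ ≤ Real.exp (-s * phiOf lam L Θ ψ (t, x)) * ((Z + s * lam * Λ * M * Z) * Θ t) := by
          gcongr
      _ = _ := by ring
  exact abs_energy_le hν hs (by positivity) hM0
    (hσM _ hp).1 (hψ' (es 0) et (norm_es_le 0) norm_et_le)
    (hψ' (es 1) et (norm_es_le 1) norm_et_le) hξ0 hξ hq hw (hwi 0) (hwi 1)

theorem exp_phiOf_sq_le (hs : 0 ≤ s) (hl : 0 ≤ lam)
    (hψm : ∀ p ∈ halfCylinder T O, 6 * m ≤ ψ p ∧ ψ p ≤ 6 * m + 1) {p : ℝ × Plane}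
    (hp : p ∈ halfCylinder T O) (hΘ : 0 ≤ Θ p.1) :
    Real.exp (-s * phiOf lam L Θ ψ p) ^ 2
      ≤ Real.exp (-(2 * s * (L - Real.exp (lam * (6 * m + 1))) * Θ p.1)) := by
  rw [← Real.exp_nat_mul]
  apply Real.exp_le_exp.mpr
  have h : Real.exp (lam * ψ p) ≤ Real.exp (lam * (6 * m + 1)) :=
    Real.exp_le_exp.mpr (by gcongr; exact (hψm p hp).2)
  have h2 : s * (Θ p.1 * (L - Real.exp (lam * (6 * m + 1)))) ≤ s * phiOf lam L Θ ψ p := by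
    unfold phiOf
    gcongr
  push_cast
  linarith

/-- The energy vanishes in the limit `t → T`. -/
theorem tendsto_integral_energyOf (hO : IsBoundedC2Domain O ρ)
    (hΘ : ContDiffOn ℝ 2 Θ (Ico 0 T)) (hψ : ContDiffOn ℝ 2 ψ (halfCylinder T O))
    (hz : ContDiffOn ℝ 2 z (halfCylinder T O)) (hν : 0 ≤ ν) (hs : 0 < s) (hl : 0 ≤ lam)
    (hM : 1 ≤ M) {Z : ℝ} (hZ : 0 ≤ Z) (hK : 0 ≤ K) (hμ : 0 ≤ μ)
    (hσM : BoundedC2 (halfCylinder T O) M σ) (hψM : BoundedC2 (halfCylinder T O) M ψ)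
    (hzZ : BoundedC2 (halfCylinder T O) Z z) (hTB : TimeBounds T K μ Θ)
    (hψm : ∀ p ∈ halfCylinder T O, 6 * m ≤ ψ p ∧ ψ p ≤ 6 * m + 1)
    (hL : Real.exp (lam * (6 * m + 1)) < L) {u : ℕ → ℝ} (hu : ∀ n, u n ∈ Ioo 0 T)
    (hΘu : Tendsto (fun n => Θ (u n)) atTop atTop) :
    Tendsto (fun n => ∫ x in O, energyOf T O ν s lam L Θ σ ψ (conjOf s lam L Θ ψ z) (u n, x))
      atTop (𝓝 0) := by
  obtain ⟨C, hC, hbound⟩ := exists_energyOf_bound (ν := ν) (s := s) (σ := σ) hO hΘ hψ hz hν hs.le hl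
    hM hZ hK hμ hσM hψM hzZ hTB hψm hL.le
  have ha : 0 < 2 * s * (L - Real.exp (lam * (6 * m + 1))) := by
    have := sub_pos.mpr hL
    positivity
  have hlim := ((tendsto_sq_mul_exp_neg ha).comp hΘu).const_mul (C * volume.real O)
  rw [mul_zero] at hlim
  refine squeeze_zero_norm (fun n => ?_) hlim
  have hvol : volume O < ⊤ := hO.bounded.measure_lt_top
  have h := norm_setIntegral_le_of_norm_le_const (f := fun x =>
    energyOf T O ν s lam L Θ σ ψ (conjOf s lam L Θ ψ z) (u n, x)) (C := C * (Θ (u n) ^ 2 *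
      Real.exp (-(2 * s * (L - Real.exp (lam * (6 * m + 1))) * Θ (u n))))) hvol (fun x hx => by
    have htI : u n ∈ Ico 0 T := Ioo_subset_Ico_self (hu n)
    refine (hbound (u n) htI x (subset_closure hx)).trans ?_
    gcongr
    exact exp_phiOf_sq_le hs.le hl hψm ⟨htI, subset_closure hx⟩
      (zero_le_one.trans (hTB _ htI).1))
  refine h.trans_eq ?_
  simp only [Function.comp_apply]
  ring

theorem integrableOn_cylinder_of_bounded (hO : IsBoundedC2Domain O ρ) {f : ℝ × Plane → ℝ} {B : ℝ}
    (hf : ContinuousOn f (halfCylinder T O)) (hB : ∀ p ∈ cylinder T O, |f p| ≤ B) :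
    IntegrableOn f (cylinder T O) := by
  have hm : MeasurableSet (cylinder T O) := (hO.isOpen_cylinder T).measurableSet
  exact IntegrableOn.of_bound ((Metric.isBounded_Ioo 0 T).prod hO.bounded).measure_lt_top
    ((hf.mono cylinder_subset_halfCylinder).aestronglyMeasurable hm) B
    ((ae_restrict_iff' hm).mpr (ae_of_all _ hB))

end

/-! ### The inequality on the whole cylinder -/

section

variable {T : ℝ} {O : Set Plane} {ρ : Plane → ℝ} {Θ : ℝ → ℝ} {σ ψ z : ℝ × Plane → ℝ}
  {ν m s lam ε c M K L T₀ r : ℝ}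

theorem iUnion_cylinder {u : ℕ → ℝ} (hu : ∀ n, u n ∈ Ioo 0 T)
    (hlim : Tendsto u atTop (𝓝 T)) : ⋃ n, cylinder (u n) O = cylinder T O := by
  refine Subset.antisymm (iUnion_subset fun n p hp => ⟨⟨hp.1.1, hp.1.2.trans (hu n).2⟩, hp.2⟩) ?_
  intro p hp
  obtain ⟨n, hn⟩ := (hlim.eventually (lt_mem_nhds hp.1.2)).exists
  exact mem_iUnion.mpr ⟨n, ⟨hp.1.1, hn⟩, hp.2⟩

/-- A relatively open subset of `[0,T] × O` differs from its part in `(0,T) × O` by a null set. -/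
theorem inter_cylinder_ae_eq {A : Set (ℝ × Plane)} (hA : A ⊆ Icc 0 T ×ˢ O) :
    (cylinder T O ∩ A : Set (ℝ × Plane)) =ᵐ[volume] A := by
  have hnull : volume (({0, T} : Set ℝ) ×ˢ O) = 0 := by
    rw [Measure.volume_eq_prod, Measure.prod_prod, (Set.toFinite _).measure_zero, zero_mul]
  refine (inter_subset_right.eventuallyLE).antisymm ?_
  rw [ae_le_set]
  refine measure_mono_null (fun p hp => ?_) hnull
  obtain ⟨hpt, hpO⟩ := hA hp.1
  refine ⟨?_, hpO⟩
  by_contra hne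
  simp only [mem_insert_iff, mem_singleton_iff, not_or] at hne
  exact hp.2 ⟨⟨⟨lt_of_le_of_ne hpt.1 (Ne.symm hne.1), lt_of_le_of_ne hpt.2 hne.2⟩, hpO⟩, hp.1⟩

/-- The weight `ξ³ e^{-2sφ}` is bounded, since `φ` is at least a positive multiple of `θ`. -/
theorem xiOf_cube_mul_exp_le (hs : 0 < s) (hl : 0 ≤ lam)
    (hψm : ∀ p ∈ halfCylinder T O, 6 * m ≤ ψ p ∧ ψ p ≤ 6 * m + 1)
    (hL : Real.exp (lam * (6 * m + 1)) < L) {p : ℝ × Plane}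
    (hp : p ∈ halfCylinder T O) (hΘ : 0 ≤ Θ p.1) :
    xiOf lam Θ ψ p ^ 3 * Real.exp (-s * phiOf lam L Θ ψ p) ^ 2
      ≤ Real.exp (lam * (6 * m + 1)) ^ 3
        * (6 / (2 * s * (L - Real.exp (lam * (6 * m + 1)))) ^ 3) := by
  have h : Real.exp (lam * ψ p) ≤ Real.exp (lam * (6 * m + 1)) :=
    Real.exp_le_exp.mpr (by gcongr; exact (hψm p hp).2)
  have ha : 0 < 2 * s * (L - Real.exp (lam * (6 * m + 1))) := by
    have := sub_pos.mpr hL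
    positivity
  have h1 := exp_phiOf_sq_le (s := s) (L := L) hs.le hl hψm hp hΘ
  have h2 := cube_mul_exp_neg_le ha hΘ
  calc xiOf lam Θ ψ p ^ 3 * Real.exp (-s * phiOf lam L Θ ψ p) ^ 2
      ≤ (Θ p.1 * Real.exp (lam * (6 * m + 1))) ^ 3 *
        Real.exp (-(2 * s * (L - Real.exp (lam * (6 * m + 1))) * Θ p.1)) := by
        unfold xiOf
        gcongr
    _ = Real.exp (lam * (6 * m + 1)) ^ 3 * (Θ p.1 ^ 3 *
        Real.exp (-(2 * s * (L - Real.exp (lam * (6 * m + 1))) * Θ p.1))) := by ring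
    _ ≤ _ := by gcongr

/-- The Carleman inequality on the whole cylinder, in terms of partial derivatives. -/
theorem integral_carleman (hO : IsBoundedC2Domain O ρ) (hT : 0 < T)
    (hΘ : ContDiffOn ℝ 2 Θ (Ico 0 T)) (hψ : ContDiffOn ℝ 2 ψ (halfCylinder T O))
    (hσ : ContDiffOn ℝ 2 σ (halfCylinder T O)) (hz : ContDiffOn ℝ 2 z (halfCylinder T O))
    (hz0 : ∀ t ∈ Ioo 0 T, ∀ x ∈ frontier O, z (t, x) = 0)
    {Z : ℝ} (hZ : 0 ≤ Z) (hzZ : BoundedC2 (halfCylinder T O) Z z)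
    (hψn : ∀ t ∈ Ioo 0 T, ∀ x ∈ frontier O,
      ∑ i, pd (halfCylinder T O) (es i) ψ (t, x) * fderiv ℝ ρ x (ex i) ≤ 0)
    (hM : 1 ≤ M) (hr : 1 ≤ r) (hs : r ≤ s) (hl : r ≤ lam)
    (hν0 : 0 < ν) (hν : ν ≤ M) (hε0 : 0 < ε) (hε : ε ≤ 1) (hT₀ : 0 < T₀) (hT₀M : T₀ ≤ M)
    (hσM : BoundedC2 (halfCylinder T O) M σ) (hψM : BoundedC2 (halfCylinder T O) M ψ)
    (hσ1 : ∀ p ∈ halfCylinder T O, 1 ≤ M * σ p)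
    (hc0 : 0 < c) (hc1 : c ≤ ν ^ 2 * ε) (hc2 : c ≤ 2 * ν ^ 2 * ε ^ 2) (hc3 : c * M ≤ ν * ε)
    (hrc : 270 * M ^ 8 ≤ c * r)
    (hK : 0 ≤ K) (hKM : K ≤ M) (hm : 1 ≤ m) (hTB : TimeBounds T K (muParam m s lam) Θ)
    (hψm : ∀ p ∈ halfCylinder T O, 6 * m ≤ ψ p ∧ ψ p ≤ 6 * m + 1)
    (hΘ0 : Θ 0 = 2) (hΘ0' : derivWithin Θ (Ico 0 T) 0 = -(muParam m s lam / T₀))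
    (hΘT : Tendsto Θ (𝓝[<] T) atTop)
    (hL : L = lam * Real.exp (6 * lam * (m + 1))) {A A₁ : Set (ℝ × Plane)}
    (hA : MeasurableSet A) (hA₁ : MeasurableSet A₁) (hAA₁ : A ⊆ A₁) (hA₁T : A₁ ⊆ Icc 0 T ×ˢ O)
    (hgrad : ∀ p ∈ cylinder T O \ A, 2 * ε ≤ pd (halfCylinder T O) (es 0) ψ p ^ 2
      + pd (halfCylinder T O) (es 1) ψ p ^ 2) :
    c / (16 * M ^ 3) * ((∫ x in O, (pd (halfCylinder T O) (es 0) z (0, x) ^ 2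
        + pd (halfCylinder T O) (es 1) z (0, x) ^ 2) * Real.exp (-s * phiOf lam L Θ ψ (0, x)) ^ 2)
      + s ^ 2 * lam ^ 3 * Real.exp (2 * lam * (6 * m + 1)) * ∫ x in O,
        z (0, x) ^ 2 * Real.exp (-s * phiOf lam L Θ ψ (0, x)) ^ 2)
      + c / (10 * M ^ 2) * (s * lam ^ 2 * (∫ p in cylinder T O,
          xiOf lam Θ ψ p * (pd (halfCylinder T O) (es 0) z p ^ 2
          + pd (halfCylinder T O) (es 1) z p ^ 2) * Real.exp (-s * phiOf lam L Θ ψ p) ^ 2)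
        + s ^ 3 * lam ^ 4 * ∫ p in cylinder T O, xiOf lam Θ ψ p ^ 3 * z p ^ 2
          * Real.exp (-s * phiOf lam L Θ ψ p) ^ 2)
      ≤ (∫ p in cylinder T O, (Real.exp (-s * phiOf lam L Θ ψ p) * heatPD T O ν σ z p) ^ 2)
        + 2 * M ^ 2 * (s ^ 3 * lam ^ 4 * ∫ p in A₁, xiOf lam Θ ψ p ^ 3 * z p ^ 2
          * Real.exp (-s * phiOf lam L Θ ψ p) ^ 2) := by
  have hS : UniqueDiffOn ℝ (halfCylinder T O) := uniqueDiffOn_halfCylinder hO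
  have hM0 : 0 < M := by linarith
  have hs1 : 1 ≤ s := hr.trans hs
  have hs0 : 0 < s := by linarith
  have hl0 : 0 < lam := by linarith
  have hμ0 : 0 ≤ muParam m s lam := by unfold muParam; positivity
  have hcM : c * M ≤ ν := hc3.trans (mul_le_of_le_one_right hν0.le hε)
  have hcone : c ≤ 1 := le_of_mul_le_mul_right (by linarith) hM0
  have hr40 : 40 * M ^ 7 ≤ r := by
    have h1 : M ^ 7 ≤ M ^ 8 := pow_le_pow_right₀ hM (by norm_num)
    have h2 : c * r ≤ 1 * r := by gcongr
    have h3 : 0 < M ^ 7 := by positivity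
    linarith
  have hΛL : Real.exp (lam * (6 * m + 1)) < L := by
    rw [hL]
    have h1 : Real.exp (lam * (6 * m + 1)) < Real.exp (6 * lam * (m + 1)) :=
      Real.exp_lt_exp.mpr (by linarith)
    exact h1.trans_le (le_mul_of_one_le_left (Real.exp_pos _).le (hr.trans hl))
  have hw := contDiffOn_conjOf s lam L hΘ hψ hz
  -- continuity and integrability of the integrands
  have cξ := (contDiffOn_xiOf (T := T) (O := O) lam hΘ hψ).continuousOn
  have cφ := (contDiffOn_phiOf (T := T) (O := O) lam L hΘ hψ).continuousOn
  have cz := hz.continuousOn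
  have cz0 : ContinuousOn (pd (halfCylinder T O) (es 0) z) (halfCylinder T O) :=
    continuousOn_pd hz hS (by norm_num)
  have cz1 : ContinuousOn (pd (halfCylinder T O) (es 1) z) (halfCylinder T O) :=
    continuousOn_pd hz hS (by norm_num)
  have cheat := continuousOn_heatPD (ν := ν) hS hσ hz
  have ce : ContinuousOn (fun p => Real.exp (-s * phiOf lam L Θ ψ p)) (halfCylinder T O) := by
    fun_prop
  have cH := (contDiffOn_energyOf (ν := ν) (s := s) (lam := lam) (L := L) hS hΘ hψ hσ hw).continuousOn
  have cg0 : ContinuousOn (fun p => (pd (halfCylinder T O) (es 0) z p ^ 2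
      + pd (halfCylinder T O) (es 1) z p ^ 2) * Real.exp (-s * phiOf lam L Θ ψ p) ^ 2)
      (halfCylinder T O) := by fun_prop
  have cg1 : ContinuousOn (fun p => z p ^ 2 * Real.exp (-s * phiOf lam L Θ ψ p) ^ 2)
      (halfCylinder T O) := by fun_prop
  set B := Real.exp (lam * (6 * m + 1)) ^ 3
        * (6 / (2 * s * (L - Real.exp (lam * (6 * m + 1)))) ^ 3) with hB
  have hweight : ∀ p ∈ cylinder T O,
      xiOf lam Θ ψ p ^ 3 * Real.exp (-s * phiOf lam L Θ ψ p) ^ 2 ≤ B := fun p hp => by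
    have hpS := cylinder_subset_halfCylinder hp
    exact xiOf_cube_mul_exp_le hs0 hl0.le hψm hΛL hpS (zero_le_one.trans (hTB _ hpS.1).1)
  have hξ1 : ∀ p ∈ cylinder T O, 1 ≤ xiOf lam Θ ψ p := fun p hp => by
    have hpS := cylinder_subset_halfCylinder hp
    refine one_le_mul_of_one_le_of_one_le (hTB _ hpS.1).1 (Real.one_le_exp ?_)
    exact mul_nonneg hl0.le (by linarith [(hψm p hpS).1])
  have sq : ∀ {a b : ℝ}, |a| ≤ b → a ^ 2 ≤ b ^ 2 := fun h =>
    sq_le_sq' (abs_le.mp h).1 (abs_le.mp h).2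
  have j1 : IntegrableOn (fun p => xiOf lam Θ ψ p * (pd (halfCylinder T O) (es 0) z p ^ 2
      + pd (halfCylinder T O) (es 1) z p ^ 2) * Real.exp (-s * phiOf lam L Θ ψ p) ^ 2)
      (cylinder T O) := by
    refine integrableOn_cylinder_of_bounded (B := B * (Z ^ 2 + Z ^ 2)) hO (by fun_prop)
      fun p hp => ?_
    have hpS := cylinder_subset_halfCylinder hp
    have h1 := hξ1 p hp
    have h2 := sq ((hzZ p hpS).2 (es 0) et (norm_es_le 0) norm_et_le).1
    have h3 := sq ((hzZ p hpS).2 (es 1) et (norm_es_le 1) norm_et_le).1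
    have hξ0 : 0 ≤ xiOf lam Θ ψ p := by linarith
    rw [abs_of_nonneg (by positivity)]
    calc xiOf lam Θ ψ p * (pd (halfCylinder T O) (es 0) z p ^ 2
          + pd (halfCylinder T O) (es 1) z p ^ 2) * Real.exp (-s * phiOf lam L Θ ψ p) ^ 2
        ≤ xiOf lam Θ ψ p ^ 3 * (Z ^ 2 + Z ^ 2) * Real.exp (-s * phiOf lam L Θ ψ p) ^ 2 := by
          have h4 : xiOf lam Θ ψ p ≤ xiOf lam Θ ψ p ^ 3 := le_self_pow₀ h1 (by norm_num)
          gcongr ?_ * (?_ + ?_) * _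
      _ = xiOf lam Θ ψ p ^ 3 * Real.exp (-s * phiOf lam L Θ ψ p) ^ 2 * (Z ^ 2 + Z ^ 2) := by ring
      _ ≤ B * (Z ^ 2 + Z ^ 2) := by
          have := hweight p hp
          gcongr
  have j2 : IntegrableOn (fun p => xiOf lam Θ ψ p ^ 3 * z p ^ 2
      * Real.exp (-s * phiOf lam L Θ ψ p) ^ 2) (cylinder T O) := by
    refine integrableOn_cylinder_of_bounded (B := B * Z ^ 2) hO (by fun_prop) fun p hp => ?_
    have hpS := cylinder_subset_halfCylinder hp
    have hξ0 : 0 ≤ xiOf lam Θ ψ p := zero_le_one.trans (hξ1 p hp)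
    rw [abs_of_nonneg (by positivity)]
    have h1 := hweight p hp
    have h2 := sq (hzZ p hpS).1
    calc xiOf lam Θ ψ p ^ 3 * z p ^ 2 * Real.exp (-s * phiOf lam L Θ ψ p) ^ 2
        = xiOf lam Θ ψ p ^ 3 * Real.exp (-s * phiOf lam L Θ ψ p) ^ 2 * z p ^ 2 := by ring
      _ ≤ B * Z ^ 2 := mul_le_mul h1 h2 (by positivity) (le_trans (by positivity) h1)
  have j3 : IntegrableOn (fun p => (Real.exp (-s * phiOf lam L Θ ψ p) * heatPD T O ν σ z p) ^ 2)
      (cylinder T O) := by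
    refine integrableOn_cylinder_of_bounded (B := (1 * (M * Z + ν * (Z + Z))) ^ 2) hO (by fun_prop)
      fun p hp => ?_
    have hpS := cylinder_subset_halfCylinder hp
    have hz' := hzZ p hpS
    have hexp : Real.exp (-s * phiOf lam L Θ ψ p) ≤ 1 := by
      have h1 : Real.exp (lam * ψ p) ≤ Real.exp (lam * (6 * m + 1)) :=
        Real.exp_le_exp.mpr (by gcongr; exact (hψm p hpS).2)
      have h2 : 0 ≤ phiOf lam L Θ ψ p :=
        mul_nonneg (zero_le_one.trans (hTB _ hpS.1).1) (by linarith)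
      rw [Real.exp_le_one_iff, neg_mul]
      exact neg_nonpos.mpr (mul_nonneg hs0.le h2)
    have hheat : |heatPD T O ν σ z p| ≤ M * Z + ν * (Z + Z) := by
      rw [heatPD]
      refine (abs_sub _ _).trans ?_
      rw [abs_mul, abs_mul, abs_neg, abs_of_pos hν0]
      have h1 := (hσM p hpS).1
      have h2 := (hz'.2 et et norm_et_le norm_et_le).1
      have h3 := (abs_add_le _ _).trans (add_le_add
        (hz'.2 (es 0) (es 0) (norm_es_le 0) (norm_es_le 0)).2
        (hz'.2 (es 1) (es 1) (norm_es_le 1) (norm_es_le 1)).2)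
      gcongr
    rw [abs_pow, abs_mul, abs_of_pos (Real.exp_pos _)]
    gcongr
  have hAset : (∫ p in A₁, xiOf lam Θ ψ p ^ 3 * z p ^ 2 * Real.exp (-s * phiOf lam L Θ ψ p) ^ 2)
      = ∫ p in cylinder T O ∩ A₁, xiOf lam Θ ψ p ^ 3 * z p ^ 2
        * Real.exp (-s * phiOf lam L Θ ψ p) ^ 2 :=
    (setIntegral_congr_set (inter_cylinder_ae_eq hA₁T)).symm
  -- the energy at the initial time
  have hi : (∫ x in O, energyOf T O ν s lam L Θ σ ψ (conjOf s lam L Θ ψ z) (0, x))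
      ≤ -(c / (16 * M ^ 3) * ((∫ x in O, (pd (halfCylinder T O) (es 0) z (0, x) ^ 2
        + pd (halfCylinder T O) (es 1) z (0, x) ^ 2) * Real.exp (-s * phiOf lam L Θ ψ (0, x)) ^ 2)
      + s ^ 2 * lam ^ 3 * Real.exp (2 * lam * (6 * m + 1)) * ∫ x in O,
        z (0, x) ^ 2 * Real.exp (-s * phiOf lam L Θ ψ (0, x)) ^ 2)) := by
    have h0 : (0 : ℝ) ∈ Ico 0 T := ⟨le_rfl, hT⟩
    have k0 := integrableOn_slice_of_continuousOn hO h0 cg0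
    have k1 := integrableOn_slice_of_continuousOn hO h0 cg1
    have kH := integrableOn_slice_of_continuousOn hO h0 cH
    have h := setIntegral_mono_on ((k0.add (k1.const_mul (s ^ 2 * lam ^ 3 *
      Real.exp (2 * lam * (6 * m + 1))))).const_mul (c / (16 * M ^ 3))) kH.neg
      hO.isOpen.measurableSet (fun x hx => energyOf_zero_le hO hT hΘ hψ hz hM hs1 (hr40.trans hl)
        hc0 hcone hcM hν hT₀ hT₀M hσM hψM hσ1 hm hψm hΘ0 hΘ0' hL (subset_closure hx))
    rw [integral_const_mul, integral_add' k0 (k1.const_mul _), integral_const_mul,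
      integral_neg'] at h
    linarith
  -- the limit `T' → T`
  obtain ⟨u, humono, hu, hulim⟩ := exists_seq_strictMono_tendsto' hT
  have hmono : Monotone fun n => cylinder (u n) O := fun i j hij p hp =>
    ⟨⟨hp.1.1, hp.1.2.trans_le (humono.monotone hij)⟩, hp.2⟩
  have hmeas : ∀ n, MeasurableSet (cylinder (u n) O) := fun n =>
    (hO.isOpen_cylinder (u n)).measurableSet
  have hsub : ∀ n, cylinder (u n) O ⊆ cylinder T O := fun n p hp =>
    ⟨⟨hp.1.1, hp.1.2.trans (hu n).2⟩, hp.2⟩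
  have hunion := iUnion_cylinder (O := O) hu hulim
  have hulim' : Tendsto u atTop (𝓝[<] T) :=
    tendsto_nhdsWithin_iff.mpr ⟨hulim, Eventually.of_forall fun n => (hu n).2⟩
  have l0 := tendsto_integral_energyOf (ν := ν) (σ := σ) hO hΘ hψ hz hν0.le hs0 hl0.le hM hZ hK hμ0
    hσM hψM hzZ hTB hψm hΛL hu (hΘT.comp hulim')
  have l1 := tendsto_setIntegral_of_monotone hmeas hmono (by rw [hunion]; exact j1)
  have l2 := tendsto_setIntegral_of_monotone hmeas hmono (by rw [hunion]; exact j2)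
  rw [hunion] at l1 l2
  have hlim := (l0.add_const (c / (16 * M ^ 3) * ((∫ x in O,
        (pd (halfCylinder T O) (es 0) z (0, x) ^ 2
        + pd (halfCylinder T O) (es 1) z (0, x) ^ 2) * Real.exp (-s * phiOf lam L Θ ψ (0, x)) ^ 2)
      + s ^ 2 * lam ^ 3 * Real.exp (2 * lam * (6 * m + 1)) * ∫ x in O,
        z (0, x) ^ 2 * Real.exp (-s * phiOf lam L Θ ψ (0, x)) ^ 2))).add
    (((l1.const_mul (s * lam ^ 2)).add (l2.const_mul (s ^ 3 * lam ^ 4))).const_mul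
      (c / (10 * M ^ 2)))
  rw [zero_add] at hlim
  refine le_of_tendsto' hlim fun n => ?_
  have hmain := integral_carleman_lt hO hΘ hψ hσ hz hz0 hψn hM hr hs hl hν0 hν hε0 hε hσM hψM hσ1
    hc0 hc1 hc2 hc3 hrc hK hKM hm hTB hψm hL hA hgrad (hu n).1 (hu n).2
  have m1 : (∫ p in cylinder (u n) O, (Real.exp (-s * phiOf lam L Θ ψ p) * heatPD T O ν σ z p) ^ 2)
      ≤ ∫ p in cylinder T O, (Real.exp (-s * phiOf lam L Θ ψ p) * heatPD T O ν σ z p) ^ 2 :=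
    setIntegral_mono_set j3 (ae_of_all _ fun p => sq_nonneg _) (hsub n).eventuallyLE
  have m2 : (∫ p in cylinder (u n) O ∩ A, xiOf lam Θ ψ p ^ 3 * z p ^ 2
        * Real.exp (-s * phiOf lam L Θ ψ p) ^ 2)
      ≤ ∫ p in cylinder T O ∩ A₁, xiOf lam Θ ψ p ^ 3 * z p ^ 2
        * Real.exp (-s * phiOf lam L Θ ψ p) ^ 2 := by
    refine setIntegral_mono_set (j2.mono_set inter_subset_left) ?_
      (inter_subset_inter (hsub n) hAA₁).eventuallyLE
    refine (ae_restrict_iff' ((hO.isOpen_cylinder T).measurableSet.inter hA₁)).mpr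
      (ae_of_all _ fun p hp => ?_)
    have := hξ1 p hp.1
    simp only [Pi.zero_apply]
    positivity
  have m3 := mul_le_mul_of_nonneg_left m2 (show 0 ≤ 2 * M ^ 2 * (s ^ 3 * lam ^ 4) by positivity)
  rw [hAset]
  linarith only [hmain, m1, m3, hi]

end

theorem two_lt_muParam {m s lam : ℝ} (hm : 1 ≤ m) (hs : 1 ≤ s) (hl : 1 ≤ lam) :
    2 < muParam m s lam := by
  have h1 : 2 ≤ lam * (6 * m - 4) := by nlinarith
  have h2 : 2 < Real.exp (lam * (6 * m - 4)) := by
    linarith [Real.add_one_le_exp (lam * (6 * m - 4))]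
  have h3 : 1 ≤ s * lam ^ 2 := one_le_mul_of_one_le_of_one_le hs (one_le_pow₀ hl)
  exact h2.trans_le (le_mul_of_one_le_left (Real.exp_pos _).le h3)

theorem pd_psi {S : Set (ℝ × Plane)} {ψ₀ : ℝ × Plane → ℝ} {v p : ℝ × Plane} (m : ℝ) :
    pd S v (psi m ψ₀) p = pd S v ψ₀ p := by
  change fderivWithin ℝ (fun q => ψ₀ q + 6 * m) S p v = _
  rw [fderivWithin_add_const, pd]

end CarlemanHeat

theorem theorem2p4
    (T T₀ T₁ ν : ℝ) (hT₀ : 0 < T₀) (hT₁ : 0 < T₁) (hT₁' : T₁ ≤ 1 / 4)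
    (hT : T₀ + 2 * T₁ < T) (hν : 0 < ν)
    (O : Set CarlemanHeat.Plane) (ρ : CarlemanHeat.Plane → ℝ)
    (hO : CarlemanHeat.IsBoundedC2Domain O ρ)
    (σ : ℝ × CarlemanHeat.Plane → ℝ)
    (hσ : ContDiffOn ℝ 2 σ (CarlemanHeat.closedCylinder T O))
    (hσ_pos : ∃ c : ℝ, 0 < c ∧ ∀ p ∈ CarlemanHeat.closedCylinder T O, c ≤ σ p)
    (ω₀ ω₁ : Set (ℝ × CarlemanHeat.Plane))
    (hω₀ : CarlemanHeat.IsRelOpen T O ω₀) (hω₁ : CarlemanHeat.IsRelOpen T O ω₁)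
    (hω : CarlemanHeat.CompactlyInside T O ω₀ ω₁)
    (ψ₀ : ℝ × CarlemanHeat.Plane → ℝ)
    (hψ₀ : CarlemanHeat.IsSpaceWeight T O ρ ω₀ ψ₀)
    (m : ℝ) (hm : 1 ≤ m)
    (θ : ℝ → ℝ → ℝ) (hθ : CarlemanHeat.IsTimeWeightFamily T T₀ T₁ m θ) :
    ∃ C₀ s₀ lam₀ : ℝ, 0 < C₀ ∧ 1 ≤ s₀ ∧ 1 ≤ lam₀ ∧
      ∀ z : ℝ × CarlemanHeat.Plane → ℝ,
        ContDiffOn ℝ ∞ z (CarlemanHeat.closedCylinder T O) →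
        (∀ t ∈ Ioo 0 T, ∀ x ∈ frontier O, z (t, x) = 0) →
        ∀ s lam : ℝ, s₀ ≤ s → lam₀ ≤ lam →
          (∫ x in O, ‖CarlemanHeat.spaceGrad z (0, x)‖ ^ 2 *
                Real.exp (-2 * s * CarlemanHeat.phi θ ψ₀ m s lam (0, x))) +
            s ^ 2 * lam ^ 3 * Real.exp (2 * lam * (6 * m + 1)) *
              (∫ x in O, |z (0, x)| ^ 2 *
                Real.exp (-2 * s * CarlemanHeat.phi θ ψ₀ m s lam (0, x))) +
            s * lam ^ 2 *
              (∫ p in CarlemanHeat.cylinder T O,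
                CarlemanHeat.xi θ ψ₀ m s lam p * ‖CarlemanHeat.spaceGrad z p‖ ^ 2 *
                  Real.exp (-2 * s * CarlemanHeat.phi θ ψ₀ m s lam p)) +
            s ^ 3 * lam ^ 4 *
              (∫ p in CarlemanHeat.cylinder T O,
                CarlemanHeat.xi θ ψ₀ m s lam p ^ 3 * |z p| ^ 2 *
                  Real.exp (-2 * s * CarlemanHeat.phi θ ψ₀ m s lam p))
          ≤ C₀ *
              (∫ p in CarlemanHeat.cylinder T O,
                |CarlemanHeat.heatOp σ ν z p| ^ 2 *
                  Real.exp (-2 * s * CarlemanHeat.phi θ ψ₀ m s lam p)) +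
            C₀ * s ^ 3 * lam ^ 4 *
              (∫ p in ω₁,
                CarlemanHeat.xi θ ψ₀ m s lam p ^ 3 * |z p| ^ 2 *
                  Real.exp (-2 * s * CarlemanHeat.phi θ ψ₀ m s lam p)) := by
  open CarlemanHeat in
  have hT0 : 0 < T := by linarith
  have hsub : halfCylinder T O ⊆ closedCylinder T O := halfCylinder_subset_closedCylinder
  have hψ : ContDiffOn ℝ 2 (psi m ψ₀) (closedCylinder T O) := hψ₀.contDiffOn.add contDiffOn_const
  obtain ⟨cσ, hcσ, hσc⟩ := hσ_pos
  obtain ⟨Mσ, hMσ⟩ := exists_boundedC2 hO hT0 hσ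
  obtain ⟨Mψ, hMψ⟩ := exists_boundedC2 hO hT0 hψ
  obtain ⟨K, hK0, hK⟩ := hθ.exists_bound hT₀ hT₁ hT₁' hT hm
  obtain ⟨α, hα, hgrad⟩ := hψ₀.gradient_lower
  obtain ⟨Kc, -, -, hω₀K, hKω₁⟩ := hω
  obtain ⟨M, hM1, hνM, hKM, hMσM, hMψM, hcM, hT₀M⟩ : ∃ M : ℝ, 1 ≤ M ∧ ν ≤ M ∧ K ≤ M ∧ Mσ ≤ M ∧
      Mψ ≤ M ∧ 1 / cσ ≤ M ∧ T₀ ≤ M := by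
    have h : 0 < 1 / cσ := by positivity
    exact ⟨1 + ν + K + |Mσ| + |Mψ| + 1 / cσ + T₀, by linarith [abs_nonneg Mσ, abs_nonneg Mψ],
      by linarith [abs_nonneg Mσ, abs_nonneg Mψ], by linarith [abs_nonneg Mσ, abs_nonneg Mψ],
      by linarith [le_abs_self Mσ, abs_nonneg Mψ], by linarith [abs_nonneg Mσ, le_abs_self Mψ],
      by linarith [abs_nonneg Mσ, abs_nonneg Mψ], by linarith [abs_nonneg Mσ, abs_nonneg Mψ]⟩
  have hM0 : 0 < M := by linarith
  obtain ⟨ε, hε0, hε1, hεα⟩ : ∃ ε : ℝ, 0 < ε ∧ ε ≤ 1 ∧ 2 * ε ≤ α ^ 2 :=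
    ⟨min (α ^ 2 / 2) 1, lt_min (by positivity) one_pos, min_le_right _ _,
      by linarith [min_le_left (α ^ 2 / 2) 1]⟩
  obtain ⟨c, hc0, hc1, hc2, hc3⟩ : ∃ c : ℝ, 0 < c ∧ c ≤ ν ^ 2 * ε ∧ c ≤ 2 * ν ^ 2 * ε ^ 2 ∧
      c * M ≤ ν * ε :=
    ⟨min (ν ^ 2 * ε) (min (2 * ν ^ 2 * ε ^ 2) (ν * ε / M)),
      lt_min (by positivity) (lt_min (by positivity) (by positivity)), min_le_left _ _,
      (min_le_right _ _).trans (min_le_left _ _),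
      (le_div_iff₀ hM0).mp ((min_le_right _ _).trans (min_le_right _ _))⟩
  obtain ⟨r, hr1, hrc⟩ : ∃ r : ℝ, 1 ≤ r ∧ 270 * M ^ 8 ≤ c * r := by
    refine ⟨1 + 270 * M ^ 8 / c, le_add_of_nonneg_right (by positivity), ?_⟩
    rw [mul_add, mul_div_cancel₀ _ hc0.ne']
    linarith
  set d := c / (16 * M ^ 3) with hd
  have hd0 : 0 < d := by positivity
  have hdc : d ≤ c / (10 * M ^ 2) := by
    rw [hd, div_le_div_iff_of_pos_left hc0 (by positivity) (by positivity)]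
    have : M ^ 2 ≤ M ^ 3 := pow_le_pow_right₀ hM1 (by norm_num)
    linarith [sq_nonneg M]
  refine ⟨2 * M ^ 2 / d, r, r, by positivity, hr1, hr1, fun z hz hz0 s lam hs hl => ?_⟩
  have hs1 : 1 ≤ s := hr1.trans hs
  have hl1 : 1 ≤ lam := hr1.trans hl
  have hμ := two_lt_muParam hm hs1 hl1
  have hΘ := hθ.isTimeWeight _ hμ
  have hz2 : ContDiffOn ℝ 2 z (closedCylinder T O) := by
    exact_mod_cast contDiffOn_infty.mp hz 2
  obtain ⟨Z, hZ⟩ := exists_boundedC2 hO hT0 hz2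
  have hzS := hz2.mono hsub
  have hψS := hψ.mono hsub
  have hψ₀S := hψ₀.contDiffOn.mono hsub
  have hTB : TimeBounds T K (muParam m s lam) (θ (muParam m s lam)) := fun t ht =>
    ⟨hΘ.one_le hT₀ hT₁ hT₁' hT hm ht, hK _ hμ t ht⟩
  have hψm : ∀ p ∈ halfCylinder T O, 6 * m ≤ psi m ψ₀ p ∧ psi m ψ₀ p ≤ 6 * m + 1 := fun p hp => by
    have := hψ₀.mem_Icc p (hsub hp)
    exact ⟨by linarith [this.1, show psi m ψ₀ p = ψ₀ p + 6 * m from rfl],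
      by linarith [this.2, show psi m ψ₀ p = ψ₀ p + 6 * m from rfl]⟩
  have hgradsq : ∀ p ∈ cylinder T O, ∀ f : ℝ × Plane → ℝ, ContDiffOn ℝ 2 f (halfCylinder T O) →
      ‖spaceGrad f p‖ ^ 2 = pd (halfCylinder T O) (es 0) f p ^ 2
        + pd (halfCylinder T O) (es 1) f p ^ 2 := fun p hp f hf =>
    norm_spaceGrad_sq hO (Ioo_subset_Ico_self hp.1) hp.2
      (hf.differentiableOn two_ne_zero _ (cylinder_subset_halfCylinder hp))
  have hmain := integral_carleman (ν := ν) (s := s) (lam := lam) (σ := σ) (ψ := psi m ψ₀)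
    (Θ := θ (muParam m s lam)) (A := ω₀) (A₁ := ω₁) hO hT0 hΘ.contDiffOn hψS (hσ.mono hsub) hzS hz0
    (le_max_right Z 0) (hZ.mono (le_max_left Z 0))
    (fun t ht x hx => by
      simp only [pd_psi]
      exact sum_pd_mul_nonpos hO (Ioo_subset_Ico_self ht) hx
        (hψ₀S.differentiableOn two_ne_zero _ ⟨Ioo_subset_Ico_self ht, hx.1⟩)
        (hψ₀.normal_deriv_nonpos t ht x hx))
    hM1 hr1 hs hl hν hνM hε0 hε1 hT₀ hT₀M (hMσ.mono hMσM) (hMψ.mono hMψM)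
    (fun p hp => by
      have h1 := hσc p (hsub hp)
      calc 1 = 1 / cσ * cσ := by field_simp
        _ ≤ M * σ p := by gcongr)
    hc0 hc1 hc2 hc3 hrc hK0 hKM hm hTB hψm (hΘ.apply_zero hT₀)
    (hΘ.derivWithin_zero hT₀ (by linarith) hμ) (hΘ.tendsto_atTop hT₁ hm) rfl
    (measurableSet_of_isRelOpen hO hω₀) (measurableSet_of_isRelOpen hO hω₁) (hω₀K.trans hKω₁)
    (by obtain ⟨U, -, rfl⟩ := hω₁; exact inter_subset_right)
    (fun p hp => by
      simp only [pd_psi]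
      rw [← hgradsq p hp.1 ψ₀ hψ₀S]
      exact hεα.trans (pow_le_pow_left₀ hα.le (hgrad p hp) 2))
  have hexp : ∀ p, Real.exp (-2 * s * phi θ ψ₀ m s lam p) = Real.exp (-s * phiOf lam
      (lam * Real.exp (6 * lam * (m + 1))) (θ (muParam m s lam)) (psi m ψ₀) p) ^ 2 := fun p => by
    rw [← Real.exp_nat_mul, phi, phiOf]
    congr 1
    push_cast
    ring
  have hξ : ∀ p, xi θ ψ₀ m s lam p = xiOf lam (θ (muParam m s lam)) (psi m ψ₀) p := fun p => rfl
  have hmeas := (hO.isOpen_cylinder T).measurableSet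
  set Θ := θ (muParam m s lam)
  set L := lam * Real.exp (6 * lam * (m + 1))
  set e : ℝ × Plane → ℝ := fun p => Real.exp (-s * phiOf lam L Θ (psi m ψ₀) p) with he
  have hI₁ : (∫ x in O, ‖spaceGrad z (0, x)‖ ^ 2 * Real.exp (-2 * s * phi θ ψ₀ m s lam (0, x)))
      = ∫ x in O, (pd (halfCylinder T O) (es 0) z (0, x) ^ 2
        + pd (halfCylinder T O) (es 1) z (0, x) ^ 2) * e (0, x) ^ 2 :=
    setIntegral_congr_fun hO.isOpen.measurableSet fun x hx => by
      simp only [hexp, he]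
      rw [norm_spaceGrad_sq hO ⟨le_rfl, hT0⟩ hx
        (hzS.differentiableOn two_ne_zero _ ⟨⟨le_rfl, hT0⟩, subset_closure hx⟩)]
  have hI₂ : (∫ x in O, |z (0, x)| ^ 2 * Real.exp (-2 * s * phi θ ψ₀ m s lam (0, x)))
      = ∫ x in O, z (0, x) ^ 2 * e (0, x) ^ 2 := by
    simp only [hexp, he, sq_abs]
  have hJ₁ : (∫ p in cylinder T O, xi θ ψ₀ m s lam p * ‖spaceGrad z p‖ ^ 2 *
      Real.exp (-2 * s * phi θ ψ₀ m s lam p))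
      = ∫ p in cylinder T O, xiOf lam Θ (psi m ψ₀) p * (pd (halfCylinder T O) (es 0) z p ^ 2
        + pd (halfCylinder T O) (es 1) z p ^ 2) * e p ^ 2 :=
    setIntegral_congr_fun hmeas fun p hp => by
      simp only [hexp, hξ, he, hgradsq p hp z hzS]
  have hJ₂ : ∀ A : Set (ℝ × Plane), (∫ p in A, xi θ ψ₀ m s lam p ^ 3 * |z p| ^ 2 *
      Real.exp (-2 * s * phi θ ψ₀ m s lam p))
      = ∫ p in A, xiOf lam Θ (psi m ψ₀) p ^ 3 * z p ^ 2 * e p ^ 2 := fun A => by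
    simp only [hexp, hξ, he, sq_abs]
  have hR₁ : (∫ p in cylinder T O, |heatOp σ ν z p| ^ 2 * Real.exp (-2 * s * phi θ ψ₀ m s lam p))
      = ∫ p in cylinder T O, (e p * heatPD T O ν σ z p) ^ 2 :=
    setIntegral_congr_fun hmeas fun p hp => by
      simp only [hexp, he, sq_abs, heatOp_eq_heatPD hO hzS hp]
      ring
  rw [hI₁, hI₂, hJ₁, hJ₂, hJ₂, hR₁]
  have hξ0 : ∀ p ∈ cylinder T O, 0 ≤ xiOf lam Θ (psi m ψ₀) p := fun p hp =>
    mul_nonneg (zero_le_one.trans (hTB _ (Ioo_subset_Ico_self hp.1)).1) (Real.exp_pos _).le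
  set J₁ := ∫ p in cylinder T O, xiOf lam Θ (psi m ψ₀) p * (pd (halfCylinder T O) (es 0) z p ^ 2
    + pd (halfCylinder T O) (es 1) z p ^ 2) * e p ^ 2
  set J₂ := ∫ p in cylinder T O, xiOf lam Θ (psi m ψ₀) p ^ 3 * z p ^ 2 * e p ^ 2
  set R₁ := ∫ p in cylinder T O, (e p * heatPD T O ν σ z p) ^ 2
  set R₂ := ∫ p in ω₁, xiOf lam Θ (psi m ψ₀) p ^ 3 * z p ^ 2 * e p ^ 2
  have hJ₁0 : 0 ≤ J₁ := setIntegral_nonneg hmeas fun p hp => by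
    have := hξ0 p hp
    positivity
  have hJ₂0 : 0 ≤ J₂ := setIntegral_nonneg hmeas fun p hp => by
    have := hξ0 p hp
    positivity
  have hR₁0 : 0 ≤ R₁ := setIntegral_nonneg hmeas fun p _ => sq_nonneg _
  have hJ0 : 0 ≤ s * lam ^ 2 * J₁ + s ^ 3 * lam ^ 4 * J₂ := by positivity
  have hJ := mul_le_mul_of_nonneg_right hdc hJ0
  have hR : R₁ ≤ 2 * M ^ 2 * R₁ := le_mul_of_one_le_left hR₁0 (by nlinarith)
  rw [show 2 * M ^ 2 / d * R₁ + 2 * M ^ 2 / d * s ^ 3 * lam ^ 4 * R₂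
    = (2 * M ^ 2 * R₁ + 2 * M ^ 2 * (s ^ 3 * lam ^ 4 * R₂)) / d by ring, le_div_iff₀ hd0]
  linarith only [hmain, hJ, hR]
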